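/- Let $d\ge 1$, $1<p<\infty$ and $\frac1p+\frac1{p'}=1$. Let $\Omega:\mathbb{R}^d\setminus\{0\}\to\mathbb{R}$ be homogeneous of degree $0$, of class $C^1$ on the unit sphere $\mathbb{S}^{d-1}$, not identically zero, with $\int_{\mathbb{S}^{d-1}}\Omega\,d\sigma=0$, and let $T$ be the classical Calderón–Zygmund operator $$Tf(x)=\mathrm{p.v.}\int_{\mathbb{R}^d}\frac{\Omega(x-y)}{|x-y|^d}\,f(y)\,dy .$$ Let $Mf(x)=\sup_{Q\ni x}\frac1{|Q|}\int_Q|f|$ be the non-centered Hardy–Littlewood maximal operator over cubes $Q$ with sides parallel to the coordinate axes. A weight is a measurable function $w:\mathbb{R}^d\to[0,\infty]$; for $\alpha<0$ the power $w^\alpha$ is set to be $0$ where $w=0$. For $1<q<\infty$ write $\|g\|_{L^q(w)}=\left(\int|g|^qw\right)^{1/q}$, and let $L^q(w)$ be the set of measurable $f$ that vanish a.e. on $\{w=0\}$ and have $\|f\|_{L^q(w)}<\infty$. Write $M:L^q(u)\to L^q(v)$ if there is a constant $C<\infty$ with $\|Mf\|_{L^q(v)}\le C\|f\|_{L^q(u)}$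 for all $f\in L^q(u)$. Then there are weights $u$ and $v$ on $\mathbb{R}^d$ (depending on $T$ and $p$) such that $$M:L^p(u)\to L^p(v),\qquad M:L^{p'}(v^{1-p'})\to L^{p'}(u^{1-p'}),\qquad M:L^{p'}(u^{1-p'})\to L^{p'}(v^{1-p'}),$$ and yet there is a function $f\in L^p(u)\cap L^p(\mathbb{R}^d)$ for which the principal value $Tf(x)$ exists for a.e. $x\in\mathbb{R}^d$ and $\|Tf\|_{L^p(v)}=\infty$. In particular, for every $d\ge1$ and every such $T$, the two conditions $M:L^p(u)\to L^p(v)$ and $M:L^{p'}(v^{1-p'})\to L^{p'}(u^{1-p'})$ do not imply that $T$ is bounded from $L^p(u)$ to $L^p(v)$. -/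

import Mathlib

open MeasureTheory Filter Topology
open scoped ENNReal NNReal

namespace MuckenhouptWheeden

/-- The space `ℝ^d` with its Euclidean norm and Lebesgue measure. -/
abbrev Space (d : ℕ) : Type := EuclideanSpace ℝ (Fin d)

/-! ### Classical Calderón-Zygmund operators -/

/-- `Ω` is the symbol of a classical (non-trivial) Calderón-Zygmund kernel `Ω(x - y) / |x - y|^d`:
it is homogeneous of degree zero, of class `C¹` away from the origin (for a function that is
homogeneous of degree zero this is the same as being `C¹` on the unit sphere), has mean value zero
on the unit sphere with respect to surface measure, and does not vanish identically there.
The value of `Ω` at the origin is irrelevant. -/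
structure IsCZSymbol {d : ℕ} (Ω : Space d → ℝ) : Prop where
  homogeneous : ∀ (t : ℝ) (x : Space d), 0 < t → x ≠ 0 → Ω (t • x) = Ω x
  contDiffOn : ContDiffOn ℝ 1 Ω {0}ᶜ
  integral_sphere_eq_zero :
    ∫ x : Metric.sphere (0 : Space d) 1, Ω x ∂(volume : Measure (Space d)).toSphere = 0
  exists_ne_zero : ∃ x ∈ Metric.sphere (0 : Space d) 1, Ω x ≠ 0

/-- The kernel `K(x, y) = Ω(x - y) / |x - y|^d`. -/
noncomputable def czKernel {d : ℕ} (Ω : Space d → ℝ) (x y : Space d) : ℝ :=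
  Ω (x - y) / ‖x - y‖ ^ d

/-- `Tf(x)` exists as a principal value and equals `a`: all the truncated integrals
`∫_{|x - y| > ε} K(x, y) f(y) dy`, `ε > 0`, converge absolutely and they tend to `a` as `ε → 0⁺`. -/
def HasCZValue {d : ℕ} (Ω : Space d → ℝ) (f : Space d → ℝ) (x : Space d) (a : ℝ) : Prop :=
  (∀ ε : ℝ, 0 < ε →
    IntegrableOn (fun y => czKernel Ω x y * f y) {y | ε < ‖x - y‖} volume) ∧
  Tendsto (fun ε : ℝ => ∫ y in {y | ε < ‖x - y‖}, czKernel Ω x y * f y) (𝓝[>] 0) (𝓝 a)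

/-! ### The maximal operator -/

/-- The closed cube with sides parallel to the axes, lower corner `a` and edge length `l`. -/
def cube {d : ℕ} (a : Space d) (l : ℝ) : Set (Space d) :=
  {y | ∀ i, y i ∈ Set.Icc (a i) (a i + l)}

/-- The non-centered Hardy-Littlewood maximal function over cubes with sides parallel to the
axes, with values in `[0, ∞]`. -/
noncomputable def maximalFunction {d : ℕ} (f : Space d → ℝ) (x : Space d) : ℝ≥0∞ :=
  ⨆ (a : Space d) (l : ℝ) (_ : 0 < l) (_ : x ∈ cube a l), ⨍⁻ y in cube a l, ‖f y‖ₑ ∂volume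

/-! ### Weights and weighted Lebesgue spaces

A weight is a measurable function with values in `[0, ∞]`. -/

/-- The power `w^α` of a weight for a negative exponent `α`, set to be zero where `w` vanishes. -/
noncomputable def weightPow {d : ℕ} (w : Space d → ℝ≥0∞) (α : ℝ) (x : Space d) : ℝ≥0∞ :=
  if w x = 0 then 0 else w x ^ α

/-- `‖g‖_{L^p(w)} = (∫ |g|^p w)^{1/p}`, for a function `|g|` with values in `[0, ∞]`. -/
noncomputable def weightedNorm {d : ℕ} (p : ℝ) (w : Space d → ℝ≥0∞) (g : Space d → ℝ≥0∞) : ℝ≥0∞ :=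
  (∫⁻ x, g x ^ p * w x ∂volume) ^ (1 / p)

/-- `f ∈ L^p(w)`: `f` is measurable, vanishes a.e. outside the set where `w` is non-zero, and has
finite norm. -/
structure MemWeightedLp {d : ℕ} (p : ℝ) (w : Space d → ℝ≥0∞) (f : Space d → ℝ) : Prop where
  aemeasurable : AEMeasurable f volume
  eq_zero : ∀ᵐ x ∂(volume : Measure (Space d)), w x = 0 → f x = 0
  norm_lt_top : weightedNorm p w (fun x => ‖f x‖ₑ) < ∞

/-- `M : L^p(u) → L^p(v)` is bounded (equivalently, `M` being sublinear, continuous). -/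
def MaximalBounded {d : ℕ} (p : ℝ) (u v : Space d → ℝ≥0∞) : Prop :=
  ∃ C : ℝ≥0, ∀ f : Space d → ℝ, MemWeightedLp p u f →
    weightedNorm p v (maximalFunction f) ≤ C * weightedNorm p u (fun x => ‖f x‖ₑ)

end MuckenhouptWheeden

open MuckenhouptWheeden

namespace MuckenhouptWheeden

section

/-! ### Marcinkiewicz interpolation between weak type `(1, 1)` and `L^∞` -/

/-! Both weights are the power 1 - p of a single weight W, set to 0 off the support of W. Then
u^(1-p') = W, and the three conditions reduce to the boundedness of M on L^p(W^(1-p)) and on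
L^{p'}(W). Functions in these spaces vanish where W does, so an A₁ condition at the points of the
support alone (`LocalA1`) is enough: two Vitali arguments (`weakType_ballMaximal`,
`weakType_ballMaximal_div`) give weak type bounds and interpolation does the rest. Such a weight may
live on a sparse set with many gaps, and this leaves T uncontrolled.

T is tested on the weight itself. For a profile w the integral of w^p w^(1-p) is the mass of w,
which is normalised, while the integral of |Tw|^p w^(1-p) can be made as large as desired with a
fixed A₁ constant. One step (`Scheme.step`) keeps density one on two tiny balls, the core, and
concentrates the remaining mass in still smaller balls, the children, placed on n dyadic scales in a
cone seen from each core ball. On each cone Ω has a fixed sign, so every scale adds a fixed amount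
to Tw near the vertex: Tw is at least 2κ on half of one core ball and at most -2κ on half of the
other. The number n grows with κ, but the density `lam` of the children stays bounded
(`IsCZSymbol.exists_scheme`). As the core carries little mass, the step is repeated inside the
children until at least half of the mass lies in cores of some generation.

The danger is cancellation between generations. The rest of the mass acts on a child as a Lipschitz
function, whose constant after rescaling does not depend on the scheme or on the profile
(`Scheme.exists_lipschitz_rest`). For large κ such a function cannot cancel both signs of Tw. The
lower bound is therefore proved for Tw + g, uniformly in all g with a fixed Lipschitz constant, and
in this form it reproduces itself (`Scheme.le_dualEnergy_step`).

Finally, profiles w_k of energy at least 2^(kp) are put at very distant centres, with f = Σ a_k w_k,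
W = Σ b_k w_k and a_k^p b_k^(1-p) = 2^(-kp). The norm of f becomes a convergent series, while each
profile adds at least 1 to the integral for Tf. Principal values exist because f is locally constant
almost everywhere and Ω has mean zero. -/

theorem ENNReal.rpow_le_tsum_dyadic {p : ℝ} (hp : 0 < p) (Y : ℝ≥0∞) :
    Y ^ p ≤ ∑' k : ℤ, if (2 : ℝ≥0∞) ^ k < Y then ((2 : ℝ≥0∞) ^ (k + 1)) ^ p else 0 := by
  rcases eq_or_ne Y 0 with rfl | h0
  · simp [hp]
  rcases eq_or_ne Y ∞ with rfl | hT
  · have h1 : (∑' n : ℕ, (1 : ℝ≥0∞)) ≤ ∑' n : ℕ,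
        (fun k : ℤ => if (2 : ℝ≥0∞) ^ k < ∞ then ((2 : ℝ≥0∞) ^ (k + 1)) ^ p else 0) n := by
      refine ENNReal.tsum_le_tsum fun n => ?_
      have : (2 : ℝ≥0∞) ^ (n : ℤ) < ∞ := ENNReal.zpow_lt_top (by simp) (by simp) _
      simp only [this, if_true]
      refine ENNReal.one_le_rpow ?_ hp
      exact_mod_cast one_le_pow₀ (M₀ := ℝ≥0∞) (n := n + 1) (by norm_num : (1 : ℝ≥0∞) ≤ 2)
    have h2 := ENNReal.tsum_comp_le_tsum_of_injective (f := ((↑) : ℕ → ℤ)) Nat.cast_injective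
      (fun k : ℤ => if (2 : ℝ≥0∞) ^ k < ∞ then ((2 : ℝ≥0∞) ^ (k + 1)) ^ p else 0)
    rw [ENNReal.tsum_const_eq_top_of_ne_zero one_ne_zero] at h1
    exact le_top.trans (h1.trans h2)
  · obtain ⟨n, hn1, hn2⟩ := ENNReal.exists_mem_Ioc_zpow h0 hT (y := 2) (by norm_num) (by simp)
    refine le_trans ?_ (ENNReal.le_tsum n)
    simp only [hn1, if_true]
    exact ENNReal.rpow_le_rpow hn2 hp.le

/-- The constant in the geometric sum below. -/
noncomputable def geomConst (p : ℝ) : ℝ≥0∞ := ∑' j : ℕ, ((2 : ℝ≥0∞) ^ (-p)) ^ j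

theorem geomConst_ne_top {p : ℝ} (hp : 0 < p) : geomConst p ≠ ∞ := by
  have : (2 : ℝ≥0∞) ^ (-p) < 1 := ENNReal.rpow_lt_one_of_one_lt_of_neg (by norm_num) (by linarith)
  rw [geomConst, ENNReal.tsum_geometric]
  exact ENNReal.inv_ne_top.2 (tsub_pos_of_lt this).ne'

theorem ENNReal.tsum_dyadic_le {p : ℝ} (hp : 0 < p) (Z : ℝ≥0∞) (hZ : Z ≠ ∞) :
    (∑' k : ℤ, if (2 : ℝ≥0∞) ^ k < Z then ((2 : ℝ≥0∞) ^ k) ^ p else 0) ≤ geomConst p * Z ^ p := by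
  rcases eq_or_ne Z 0 with rfl | h0
  · simp
  obtain ⟨n, hn1, hn2⟩ := ENNReal.exists_mem_Ioc_zpow h0 hZ (y := 2) (by norm_num) (by simp)
  -- With 2^n < Z ≤ 2^(n+1) and k = n - j, only j ≥ 0 contributes, which leaves a geometric series.
  rw [← (Equiv.subLeft n).tsum_eq]
  have hinj : Function.Injective ((↑) : ℕ → ℤ) := Nat.cast_injective
  rw [← hinj.tsum_eq, geomConst, ← ENNReal.tsum_mul_right]
  · refine ENNReal.tsum_le_tsum fun j => ?_
    split_ifs
    · have h2 : (2 : ℝ≥0∞) ^ (n - (j : ℤ)) = 2 ^ n * (2 ^ (-1 : ℝ)) ^ j := by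
        rw [ENNReal.zpow_sub (by simp) (by simp), ENNReal.rpow_neg_one, zpow_natCast,
          ENNReal.inv_pow]
      simp only [Equiv.subLeft_apply]
      rw [h2, ENNReal.mul_rpow_of_nonneg _ _ hp.le, mul_comm]
      refine mul_le_mul' (le_of_eq ?_) (ENNReal.rpow_le_rpow hn1.le hp.le)
      rw [← ENNReal.rpow_natCast, ← ENNReal.rpow_mul, ← ENNReal.rpow_mul, ← ENNReal.rpow_natCast,
        ← ENNReal.rpow_mul]
      ring_nf
    · exact bot_le
  · intro k hk
    by_contra hk2
    apply hk
    have : k < 0 := by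
      by_contra h
      exact hk2 ⟨k.toNat, by simp; omega⟩
    have h3 : ¬ (2 : ℝ≥0∞) ^ (n - k) < Z := by
      rw [not_lt]
      refine hn2.trans (ENNReal.zpow_le_of_le (by norm_num) (by omega))
    simp [h3]

/-- The hypothesis is what weak type (1,1) and an L^∞ bound give once the part of `g` below t / B is
discarded. After a decomposition of `G` into dyadic levels and an interchange of sum and integral,
the sum over 2^k < B g(x) of 2^(k(p-1)) is geometric because p > 1. -/
theorem lintegral_rpow_le_of_weakType {α : Type*} [MeasurableSpace α] {μ : Measure α} {p : ℝ}
    (hp : 1 < p) {G g : α → ℝ≥0∞} (hG : Measurable G) (hg : Measurable g) (hg' : ∀ x, g x ≠ ∞)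
    {A B : ℝ≥0∞} (hB : B ≠ ∞)
    (h : ∀ t : ℝ≥0∞, t ≠ 0 → t ≠ ∞ →
      t * μ {x | t < G x} ≤ A * ∫⁻ x in {x | t < B * g x}, g x ∂μ) :
    ∫⁻ x, G x ^ p ∂μ ≤ 2 ^ p * A * geomConst (p - 1) * B ^ (p - 1) * ∫⁻ x, g x ^ p ∂μ := by
  have hp0 : 0 < p := by linarith
  have hmG : ∀ t, MeasurableSet {x | t < G x} := fun t => measurableSet_lt measurable_const hG
  have hmg : ∀ t, MeasurableSet {x | t < B * g x} := fun t =>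
    measurableSet_lt measurable_const (hg.const_mul _)
  calc ∫⁻ x, G x ^ p ∂μ
      ≤ ∫⁻ x, ∑' k : ℤ, {x | (2 : ℝ≥0∞) ^ k < G x}.indicator
          (fun _ => ((2 : ℝ≥0∞) ^ (k + 1)) ^ p) x ∂μ := by
        refine lintegral_mono fun x => (ENNReal.rpow_le_tsum_dyadic hp0 (G x)).trans (le_of_eq ?_)
        exact tsum_congr fun k => by simp [Set.indicator_apply]
    _ = ∑' k : ℤ, ((2 : ℝ≥0∞) ^ (k + 1)) ^ p * μ {x | (2 : ℝ≥0∞) ^ k < G x} := by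
        rw [lintegral_tsum fun k => (measurable_const.indicator (hmG _)).aemeasurable]
        exact tsum_congr fun k => by rw [lintegral_indicator_const (hmG _)]
    _ ≤ ∑' k : ℤ, 2 ^ p * A * ∫⁻ x, {x | (2 : ℝ≥0∞) ^ k < B * g x}.indicator
          (fun x => ((2 : ℝ≥0∞) ^ k) ^ (p - 1) * g x) x ∂μ := by
        refine ENNReal.tsum_le_tsum fun k => ?_
        have ht0 : (2 : ℝ≥0∞) ^ k ≠ 0 := (ENNReal.zpow_pos (by simp) (by simp) k).ne'
        have htT : (2 : ℝ≥0∞) ^ k ≠ ∞ := (ENNReal.zpow_lt_top (by simp) (by simp) k).ne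
        have h1 := h _ ht0 htT
        have e1 : ((2 : ℝ≥0∞) ^ (k + 1)) ^ p = 2 ^ p * (2 ^ k) ^ (p - 1) * 2 ^ k := by
          rw [ENNReal.zpow_add (by simp) (by simp), ENNReal.mul_rpow_of_nonneg _ _ hp0.le, zpow_one,
            mul_comm, mul_assoc]
          congr 1
          nth_rewrite 3 [← ENNReal.rpow_one (2 ^ k)]
          rw [← ENNReal.rpow_add _ _ ht0 htT]
          ring_nf
        rw [lintegral_indicator (hmg _), lintegral_const_mul _ hg, e1]
        calc _ = 2 ^ p * (2 ^ k) ^ (p - 1) * (2 ^ k * μ {x | 2 ^ k < G x}) := by ring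
          _ ≤ 2 ^ p * (2 ^ k) ^ (p - 1) * (A * ∫⁻ x in {x | 2 ^ k < B * g x}, g x ∂μ) := by gcongr
          _ = _ := by ring
    _ = 2 ^ p * A * ∫⁻ x, ∑' k : ℤ, {x | (2 : ℝ≥0∞) ^ k < B * g x}.indicator
          (fun x => ((2 : ℝ≥0∞) ^ k) ^ (p - 1) * g x) x ∂μ := by
        rw [ENNReal.tsum_mul_left, lintegral_tsum]
        exact fun k => ((hg.const_mul _).indicator (hmg _)).aemeasurable
    _ ≤ 2 ^ p * A * ∫⁻ x, geomConst (p - 1) * B ^ (p - 1) * g x ^ p ∂μ := by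
        gcongr with x
        calc _ = ∑' k : ℤ, (if (2 : ℝ≥0∞) ^ k < B * g x then ((2 : ℝ≥0∞) ^ k) ^ (p - 1) else 0)
                  * g x := tsum_congr fun k => by simp [Set.indicator_apply]
          _ ≤ geomConst (p - 1) * (B * g x) ^ (p - 1) * g x := by
              rw [ENNReal.tsum_mul_right]
              gcongr
              exact ENNReal.tsum_dyadic_le (by linarith) _ (ENNReal.mul_ne_top hB (hg' x))
          _ = _ := by
              rw [ENNReal.mul_rpow_of_nonneg _ _ (by linarith), mul_assoc, mul_assoc, mul_assoc]
              congr 2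
              rcases eq_or_ne (g x) 0 with h0 | h0
              · simp [h0, hp0]
              nth_rewrite 2 [← ENNReal.rpow_one (g x)]
              rw [← ENNReal.rpow_add _ _ h0 (hg' x)]
              ring_nf
    _ = _ := by
        rw [lintegral_const_mul _ (hg.pow_const p)]
        ring

end

section

/-! ### The maximal operator and weights satisfying a local `A₁` condition -/

variable {d : ℕ}

/-- The centered maximal function over open Euclidean balls (up to the volume of the unit ball). -/
noncomputable def ballMaximal (f : Space d → ℝ≥0∞) (x : Space d) : ℝ≥0∞ :=
  ⨆ (R : ℝ) (_ : 0 < R), (∫⁻ y in Metric.ball x R, f y) / ENNReal.ofReal R ^ d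

theorem lt_ballMaximal_iff {f : Space d → ℝ≥0∞} {x : Space d} {t : ℝ≥0∞} :
    t < ballMaximal f x ↔
      ∃ R : ℝ, 0 < R ∧ t * ENNReal.ofReal R ^ d < ∫⁻ y in Metric.ball x R, f y := by
  simp only [ballMaximal, lt_iSup_iff, exists_prop]
  refine exists_congr fun R => and_congr_right fun hR => ?_
  rw [ENNReal.lt_div_iff_mul_lt]
  · left; exact pow_ne_zero _ (by simpa using hR)
  · left; exact ENNReal.pow_ne_top ENNReal.ofReal_ne_top

/-- The integral over a ball is the supremum of the integrals over smaller concentric balls. Hence a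
strict inequality persists for some smaller ball, which is contained in the ball of the original
radius about any nearby centre. -/
theorem isOpen_lt_ballMaximal (f : Space d → ℝ≥0∞) (t : ℝ≥0∞) :
    IsOpen {x | t < ballMaximal f x} := by
  rw [Metric.isOpen_iff]
  intro x hx
  obtain ⟨R, hR, h⟩ := lt_ballMaximal_iff.1 hx
  have hU : Metric.ball x R = ⋃ n : ℕ, Metric.ball x (R - R / (n + 2)) := by
    ext y
    simp only [Metric.mem_ball, Set.mem_iUnion]
    constructor
    · intro hy
      obtain ⟨n, hn⟩ := exists_nat_gt (R / (R - dist y x))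
      refine ⟨n, ?_⟩
      have h1 : 0 < R - dist y x := by linarith
      rw [div_lt_iff₀ h1] at hn
      have : R / (n + 2) < R - dist y x := by
        rw [div_lt_iff₀ (by positivity)]
        nlinarith
      linarith
    · rintro ⟨n, hn⟩
      have : 0 < R / ((n : ℝ) + 2) := by positivity
      linarith
  have hmono : Monotone fun n : ℕ => Metric.ball x (R - R / ((n : ℝ) + 2)) := by
    intro m n hmn
    apply Metric.ball_subset_ball
    have : (m : ℝ) ≤ n := by exact_mod_cast hmn
    gcongr
  rw [hU, setLIntegral_iUnion_of_directed _ (directed_of_isDirected_le hmono), lt_iSup_iff] at h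
  obtain ⟨n, hn⟩ := h
  have hpos : 0 < R / ((n : ℝ) + 2) := by positivity
  refine ⟨R / (n + 2), hpos, fun y hy => lt_ballMaximal_iff.2 ⟨R, hR, hn.trans_le ?_⟩⟩
  refine lintegral_mono_set (Metric.ball_subset_ball' ?_)
  rw [Metric.mem_ball, dist_comm] at hy
  linarith

theorem measurable_ballMaximal (f : Space d → ℝ≥0∞) : Measurable (ballMaximal f) :=
  measurable_of_Ioi fun t => (isOpen_lt_ballMaximal f t).measurableSet

/-! ### Cubes against balls, and a Vitali covering estimate -/

theorem volume_cube (a : Space d) {l : ℝ} : volume (cube a l) = ENNReal.ofReal l ^ d := by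
  have h := (EuclideanSpace.volume_preserving_symm_measurableEquiv_toLp (Fin d)).measure_preimage
    (s := Set.univ.pi fun i => Set.Icc (a i) (a i + l))
    (MeasurableSet.univ_pi fun i => measurableSet_Icc).nullMeasurableSet
  rw [volume_pi_pi] at h
  simp only [Real.volume_Icc, add_sub_cancel_left, Finset.prod_const, Finset.card_univ,
    Fintype.card_fin] at h
  rw [← h]
  congr 1
  ext y
  simp only [cube, Set.mem_ofPred_eq, Set.mem_preimage, Set.mem_univ_pi]
  rfl

theorem norm_le_sum_abs (x : Space d) : ‖x‖ ≤ ∑ i, |x i| := by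
  rw [EuclideanSpace.norm_eq]
  apply Real.sqrt_le_iff.2 ⟨by positivity, ?_⟩
  simp only [Real.norm_eq_abs]
  exact Finset.sum_sq_le_sq_sum_of_nonneg (fun i _ => abs_nonneg (x i))

theorem cube_subset_ball {a x : Space d} {l : ℝ} (hl : 0 < l) (hx : x ∈ cube a l) :
    cube a l ⊆ Metric.ball x ((d + 1) * l) := by
  intro y hy
  rw [Metric.mem_ball, dist_eq_norm]
  refine (norm_le_sum_abs _).trans_lt ?_
  have : ∑ i, |(y - x) i| ≤ ∑ i : Fin d, l := by
    refine Finset.sum_le_sum fun i _ => ?_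
    have h1 := hy i; have h2 := hx i
    simp only [Set.mem_Icc] at h1 h2
    simp only [PiLp.sub_apply]
    rw [abs_le]; constructor <;> linarith
  rw [Finset.sum_const, Finset.card_univ, Fintype.card_fin, nsmul_eq_mul] at this
  linarith

theorem maximalFunction_le (f : Space d → ℝ) (x : Space d) :
    maximalFunction f x ≤ (d + 1) ^ d * ballMaximal (fun y => ‖f y‖ₑ) x := by
  refine iSup_le fun a => iSup_le fun l => iSup_le fun hl => iSup_le fun hx => ?_
  rw [setLAverage_eq, volume_cube]
  have hR : 0 < (d + 1) * l := by positivity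
  calc _ ≤ (∫⁻ y in Metric.ball x ((d + 1) * l), ‖f y‖ₑ) / ENNReal.ofReal l ^ d := by
        gcongr
        exact cube_subset_ball hl hx
    _ = (d + 1) ^ d * ((∫⁻ y in Metric.ball x ((d + 1) * l), ‖f y‖ₑ)
          / ENNReal.ofReal ((d + 1) * l) ^ d) := by
        rw [ENNReal.ofReal_mul (by positivity), mul_pow]
        have : ENNReal.ofReal ((d : ℝ) + 1) = (d + 1 : ℝ≥0∞) := by
          rw [ENNReal.ofReal_add (by positivity) (by norm_num)]; simp
        rw [this, ← mul_div_assoc, ENNReal.mul_div_mul_left]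
        · positivity
        · finiteness
    _ ≤ _ := by
        gcongr
        exact le_iSup₂_of_le _ hR le_rfl

/-- The covering lemma supplies disjoint balls whose fivefold enlargements cover. The hypothesis
compares μ of an enlargement directly with the integral of `G` over the ball, so μ need not be
doubling. -/
theorem measure_le_of_vitali {μ : Measure (Space d)} {G : Space d → ℝ≥0∞} {A : ℝ≥0∞}
    {S : Set (Space d)}
    (h : ∀ x ∈ S, ∃ R : ℝ, 0 < R ∧
      μ (Metric.closedBall x (5 * R)) ≤ A * ∫⁻ y in Metric.ball x R, G y) :
    μ S ≤ A * ∫⁻ y, G y := by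
  choose! R hR hRA using h
  -- The covering lemma needs bounded radii, so S is exhausted by the sets where the radius is at
  -- most n.
  have hS : S = ⋃ n : ℕ, {x ∈ S | R x ≤ n} := by
    ext x
    simp only [Set.mem_iUnion, Set.mem_ofPred_eq]
    exact ⟨fun hx => (exists_nat_ge (R x)).imp fun n hn => ⟨hx, hn⟩, fun ⟨n, hn⟩ => hn.1⟩
  have hmono : Monotone fun n : ℕ => {x ∈ S | R x ≤ n} := by
    intro m n hmn x hx
    exact ⟨hx.1, hx.2.trans (by exact_mod_cast hmn)⟩
  rw [hS, hmono.measure_iUnion]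
  refine iSup_le fun n => ?_
  obtain ⟨u, huS, hdisj, hcov⟩ := Vitali.exists_disjoint_subfamily_covering_enlargement_closedBall
    {x ∈ S | R x ≤ n} id R n (fun x hx => hx.2) 5 (by norm_num)
  have hcount : u.Countable := by
    refine hdisj.countable_of_nonempty_interior fun x hx => ?_
    exact ⟨x, interior_mono Metric.ball_subset_closedBall
      (by simpa [interior_eq_iff_isOpen.2 Metric.isOpen_ball] using hR x (huS hx).1)⟩
  have hdisj' : u.PairwiseDisjoint fun x => Metric.ball x (R x) :=
    hdisj.mono fun x => Metric.ball_subset_closedBall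
  calc μ {x ∈ S | R x ≤ n} ≤ μ (⋃ x ∈ u, Metric.closedBall x (5 * R x)) := by
        refine measure_mono fun x hx => ?_
        obtain ⟨b, hb, hsub⟩ := hcov x hx
        exact Set.mem_biUnion hb (hsub (Metric.mem_closedBall_self (hR x hx.1).le))
    _ ≤ ∑' x : u, μ (Metric.closedBall (x : Space d) (5 * R x)) := measure_biUnion_le _ hcount _
    _ ≤ ∑' x : u, A * ∫⁻ y in Metric.ball (x : Space d) (R x), G y :=
        ENNReal.tsum_le_tsum fun x => hRA x (huS x.2).1
    _ = A * ∫⁻ y in ⋃ x ∈ u, Metric.ball x (R x), G y := by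
        rw [ENNReal.tsum_mul_left, lintegral_biUnion hcount (fun x _ => measurableSet_ball) hdisj']
    _ ≤ A * ∫⁻ y, G y := by
        gcongr
        exact Measure.restrict_le_self

/-- The condition `Mw ≤ C w` on the set where `w` does not vanish, stated for Euclidean balls. -/
def LocalA1 (C : ℝ≥0∞) (w : Space d → ℝ≥0∞) : Prop :=
  ∀ x, w x ≠ 0 → ∀ R : ℝ, 0 < R →
    ∫⁻ y in Metric.closedBall x R, w y ≤ C * w x * ENNReal.ofReal R ^ d

theorem volume_ball_eq (x : Space d) {R : ℝ} (hR : 0 < R) :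
    volume (Metric.ball x R) = ENNReal.ofReal R ^ d * volume (Metric.ball (0 : Space d) 1) := by
  rw [Measure.addHaar_ball_of_pos _ _ hR, finrank_euclideanSpace_fin,
    ENNReal.ofReal_pow hR.le]

theorem ENNReal.le_two_mul_of_le_add_half {a b : ℝ≥0∞} (ha : a ≠ ∞) (h : a ≤ b + a / 2) :
    a ≤ 2 * b := by
  nth_rewrite 1 [← ENNReal.add_halves a] at h
  have h5 := (ENNReal.add_le_add_iff_right (by finiteness)).1 h
  rw [mul_comm, ← ENNReal.div_le_iff (by simp) (by simp)]
  exact h5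

theorem ENNReal.div_two_mul_mul_cancel {V : ℝ≥0∞} (h0 : V ≠ 0) (hT : V ≠ ∞) (t r : ℝ≥0∞) :
    t / (2 * V) * (r * V) = t * r / 2 := by
  rw [div_eq_mul_inv, div_eq_mul_inv, ENNReal.mul_inv (by simp) (by simp)]
  calc t * (2⁻¹ * V⁻¹) * (r * V) = t * r * 2⁻¹ * (V⁻¹ * V) := by ring
    _ = _ := by rw [ENNReal.inv_mul_cancel h0 hT, mul_one]

theorem lintegral_le_add_of_truncation {μ : Measure (Space d)} {g : Space d → ℝ≥0∞}
    {B t : ℝ≥0∞} (hB0 : B ≠ 0) (hB : B ≠ ∞) (s : Set (Space d)) :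
    ∫⁻ y in s, g y ∂μ ≤
      ∫⁻ y in s, {y | t < B * g y}.indicator g y ∂μ + t / B * μ s := by
  rw [← setLIntegral_const, ← lintegral_add_right _ measurable_const]
  refine lintegral_mono fun y => ?_
  by_cases h : t < B * g y
  · simp [h]
  · simp only [Set.indicator_apply, Set.mem_ofPred_eq, h, if_false, zero_add]
    rw [ENNReal.le_div_iff_mul_le (Or.inl hB0) (Or.inl hB), mul_comm]
    exact not_lt.1 h

/-- Take a ball B of radius R about x that witnesses the level t. Values of `g` below the threshold
account for at most half of t R^d. For y in B with w(y) ≠ 0, the fivefold ball lies in the ball of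
radius 6R about y, so its weight is at most C w(y) (6R)^d. Integration against `g` over B gives the
estimate. The A₁ condition is used only at points where `g` does not vanish; the centre x may lie
off the support. -/
theorem weakType_ballMaximal {C : ℝ≥0∞} {w : Space d → ℝ≥0∞} (hw : Measurable w)
    (hA : LocalA1 C w) {g : Space d → ℝ≥0∞} (hg : Measurable g) (hgw : ∀ x, w x = 0 → g x = 0)
    {t : ℝ≥0∞} (ht : t ≠ ∞) :
    t * volume.withDensity w {x | t < ballMaximal g x} ≤
      2 * C * 6 ^ d * ∫⁻ x in {x | t < 2 * volume (Metric.ball (0 : Space d) 1) * g x}, g x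
        ∂(volume.withDensity w) := by
  set V := volume (Metric.ball (0 : Space d) 1) with hV
  have hV0 : V ≠ 0 := (Metric.measure_ball_pos _ _ one_pos).ne'
  have hVT : V ≠ ∞ := measure_ball_lt_top.ne
  set μ := (volume : Measure (Space d)).withDensity w
  have hms : MeasurableSet {x | t < 2 * V * g x} :=
    measurableSet_lt measurable_const (hg.const_mul _)
  have hrw : ∫⁻ x in {x | t < 2 * V * g x}, g x ∂μ =
      ∫⁻ x, w x * {x | t < 2 * V * g x}.indicator g x := by
    rw [← lintegral_indicator hms, lintegral_withDensity_eq_lintegral_mul _ hw (hg.indicator hms)]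
    rfl
  rw [hrw, ← smul_eq_mul, ← Measure.smul_apply]
  refine measure_le_of_vitali fun x hx => ?_
  obtain ⟨R, hR, hlt⟩ := lt_ballMaximal_iff.1 hx
  refine ⟨R, hR, ?_⟩
  set r := ENNReal.ofReal R ^ d with hr
  have hr0 : r ≠ 0 := pow_ne_zero _ (by simpa using hR)
  have hrT : r ≠ ∞ := ENNReal.pow_ne_top ENNReal.ofReal_ne_top
  set I := ∫⁻ y in Metric.ball x R, {y | t < 2 * V * g y}.indicator g y with hI
  have h1 : t * r ≤ 2 * I := by
    have h2 := hlt.le.trans (lintegral_le_add_of_truncation (μ := volume) (g := g) (t := t)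
      (B := 2 * V) (by simp [hV0]) (by finiteness) (Metric.ball x R))
    have h3 : t / (2 * V) * volume (Metric.ball x R) = t * r / 2 := by
      rw [volume_ball_eq x hR, ENNReal.div_two_mul_mul_cancel hV0 hVT]
    rw [h3] at h2
    exact ENNReal.le_two_mul_of_le_add_half (by finiteness) h2
  set W := μ (Metric.closedBall x (5 * R)) with hW
  have h6 : W * I ≤ C * 6 ^ d * r *
      ∫⁻ y in Metric.ball x R, w y * {x | t < 2 * V * g x}.indicator g y := by
    have hm2 : Measurable fun y => w y * {x | t < 2 * V * g x}.indicator g y :=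
      hw.mul (hg.indicator hms)
    rw [hI, ← lintegral_const_mul _ (hg.indicator hms), ← lintegral_const_mul _ hm2]
    refine setLIntegral_mono (measurable_const.mul hm2) fun y hy => ?_
    by_cases h0 : w y = 0
    · simp [hgw y h0]
    · have : W ≤ C * w y * (6 ^ d * r) := by
        calc W ≤ ∫⁻ y in Metric.closedBall y (6 * R), w y := by
              rw [hW, withDensity_apply _ measurableSet_closedBall]
              refine lintegral_mono_set (Metric.closedBall_subset_closedBall' ?_)
              rw [dist_comm]
              linarith [Metric.mem_ball.1 hy]
          _ ≤ _ := by
              refine (hA y h0 (6 * R) (by positivity)).trans (le_of_eq ?_)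
              rw [ENNReal.ofReal_mul (by norm_num), mul_pow, ← hr]
              simp
      calc _ ≤ C * w y * (6 ^ d * r) * {y | t < 2 * V * g y}.indicator g y := by gcongr
        _ = _ := by ring
  have h7 : r * (t * W) ≤ r * (2 * C * 6 ^ d *
      ∫⁻ y in Metric.ball x R, w y * {x | t < 2 * V * g x}.indicator g y) := by
    calc r * (t * W) = t * r * W := by ring
      _ ≤ 2 * I * W := by gcongr
      _ = 2 * (W * I) := by ring
      _ ≤ 2 * (C * 6 ^ d * r *
          ∫⁻ y in Metric.ball x R, w y * {x | t < 2 * V * g x}.indicator g y) := by gcongr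
      _ = _ := by ring
  exact (ENNReal.mul_le_mul_iff_right hr0 hrT).1 h7

/-- This is the operator g ↦ M(wg)/w with respect to the measure w dx. Here the A₁ condition is
applied at the centre x, which lies in the support by the definition of the operator: it bounds the
contribution of small values of `g` by t w(x) R^d / 2, and also the measure of the enlarged ball. -/
theorem weakType_ballMaximal_div {C : ℝ≥0∞} (hC0 : C ≠ 0) (hC : C ≠ ∞) {w : Space d → ℝ≥0∞}
    (hw : Measurable w) (hwT : ∀ x, w x ≠ ∞)
    (hA : LocalA1 C w) {g : Space d → ℝ≥0∞} (hg : Measurable g)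
    {t : ℝ≥0∞} (ht : t ≠ ∞) :
    t * volume.withDensity w
        {x | t < if w x = 0 then 0 else ballMaximal (fun y => w y * g y) x / w x} ≤
      2 * C * 5 ^ d * ∫⁻ x in {x | t < 2 * C * g x}, g x ∂(volume.withDensity w) := by
  set μ := (volume : Measure (Space d)).withDensity w with hμ
  have hms : MeasurableSet {x | t < 2 * C * g x} :=
    measurableSet_lt measurable_const (hg.const_mul _)
  have hrw : ∀ s, MeasurableSet s → ∫⁻ x in s, {x | t < 2 * C * g x}.indicator g x ∂μ =
      ∫⁻ x in s, w x * {x | t < 2 * C * g x}.indicator g x := by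
    intro s hs
    rw [hμ, restrict_withDensity hs,
      lintegral_withDensity_eq_lintegral_mul _ hw (hg.indicator hms)]
    rfl
  have hrw' := hrw Set.univ MeasurableSet.univ
  rw [setLIntegral_univ, setLIntegral_univ, lintegral_indicator hms] at hrw'
  rw [hrw', ← smul_eq_mul, ← Measure.smul_apply]
  refine measure_le_of_vitali fun x hx => ?_
  have h0 : w x ≠ 0 := by
    intro h0
    simp [h0] at hx
  simp only [Set.mem_ofPred_eq, h0, if_false] at hx
  rw [ENNReal.lt_div_iff_mul_lt (Or.inl h0) (Or.inl (hwT x))] at hx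
  obtain ⟨R, hR, hlt⟩ := lt_ballMaximal_iff.1 hx
  refine ⟨R, hR, ?_⟩
  set r := ENNReal.ofReal R ^ d with hr
  have hr0 : r ≠ 0 := pow_ne_zero _ (by simpa using hR)
  have hrT : r ≠ ∞ := ENNReal.pow_ne_top ENNReal.ofReal_ne_top
  rw [← hrw _ measurableSet_ball]
  set I := ∫⁻ y in Metric.ball x R, {y | t < 2 * C * g y}.indicator g y ∂μ with hI
  have hgμ : ∫⁻ y in Metric.ball x R, w y * g y = ∫⁻ y in Metric.ball x R, g y ∂μ := by
    rw [hμ, restrict_withDensity measurableSet_ball,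
      lintegral_withDensity_eq_lintegral_mul _ hw hg]
    rfl
  rw [hgμ] at hlt
  have h1 : t * w x * r ≤ 2 * I := by
    have h2 := hlt.le.trans (lintegral_le_add_of_truncation (μ := μ) (g := g) (t := t)
      (B := 2 * C) (by simp [hC0]) (by finiteness) (Metric.ball x R))
    have h3 : t / (2 * C) * μ (Metric.ball x R) ≤ t * w x * r / 2 := by
      calc t / (2 * C) * μ (Metric.ball x R) ≤ t / (2 * C) * (C * w x * r) := by
            gcongr
            rw [hμ, withDensity_apply _ measurableSet_ball]
            exact (lintegral_mono_set Metric.ball_subset_closedBall).trans (hA x h0 R hR)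
        _ = t * w x * r / 2 := by
            rw [mul_assoc C, mul_comm C, ENNReal.div_two_mul_mul_cancel hC0 hC, mul_assoc]
    have := hwT x
    exact ENNReal.le_two_mul_of_le_add_half (by finiteness) (h2.trans (add_le_add_right h3 _))
  have hW : μ (Metric.closedBall x (5 * R)) ≤ C * w x * (5 ^ d * r) := by
    rw [hμ, withDensity_apply _ measurableSet_closedBall]
    refine (hA x h0 (5 * R) (by positivity)).trans (le_of_eq ?_)
    rw [ENNReal.ofReal_mul (by norm_num), mul_pow, ← hr]
    simp
  calc t * μ (Metric.closedBall x (5 * R)) ≤ t * (C * w x * (5 ^ d * r)) := by gcongr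
    _ = C * 5 ^ d * (t * w x * r) := by ring
    _ ≤ C * 5 ^ d * (2 * I) := by gcongr
    _ = _ := by ring

/-! ### Strong type bounds -/

theorem MemWeightedLp.exists_measurable {p : ℝ} {u w : Space d → ℝ≥0∞} {f : Space d → ℝ}
    (hf : MemWeightedLp p u f) (hw : Measurable w) (huw : ∀ x, w x = 0 → u x = 0) :
    ∃ g : Space d → ℝ≥0∞, Measurable g ∧ (∀ x, g x ≠ ∞) ∧ (∀ x, w x = 0 → g x = 0) ∧
      g =ᵐ[volume] fun x => ‖f x‖ₑ := by
  refine ⟨fun x => if w x = 0 then 0 else ‖hf.aemeasurable.mk f x‖ₑ, ?_, ?_, ?_, ?_⟩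
  · exact Measurable.ite (hw (measurableSet_singleton 0)) measurable_const
      hf.aemeasurable.measurable_mk.enorm
  · intro x
    dsimp only
    split_ifs <;> simp
  · intro x hx
    simp [hx]
  · filter_upwards [hf.eq_zero, hf.aemeasurable.ae_eq_mk] with x h1 h2
    split_ifs with h
    · simp [h1 (huw x h)]
    · rw [h2]

theorem ballMaximal_congr {f g : Space d → ℝ≥0∞} (h : f =ᵐ[volume] g) :
    ballMaximal f = ballMaximal g := by
  funext x
  simp only [ballMaximal]
  refine iSup_congr fun R => iSup_congr fun _ => ?_
  rw [lintegral_congr_ae (ae_restrict_of_ae h)]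

theorem maximalBounded_of_lintegral_le {p : ℝ} (hp : 1 < p) {u v : Space d → ℝ≥0∞} {K : ℝ≥0∞}
    (hK : K ≠ ∞) (h : ∀ f : Space d → ℝ, MemWeightedLp p u f →
      ∫⁻ x, ballMaximal (fun y => ‖f y‖ₑ) x ^ p * v x ≤ K * ∫⁻ x, ‖f x‖ₑ ^ p * u x) :
    MaximalBounded p u v := by
  have hp0 : 0 < p := by linarith
  refine ⟨((((d : ℝ≥0∞) + 1) ^ d) ^ p * K).toNNReal ^ (1 / p), fun f hf => ?_⟩
  have hKT : (((d : ℝ≥0∞) + 1) ^ d) ^ p * K ≠ ∞ := by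
    have : (((d : ℝ≥0∞) + 1) ^ d) ^ p ≠ ∞ :=
      ENNReal.rpow_ne_top_of_nonneg hp0.le (by finiteness)
    finiteness
  rw [ENNReal.coe_rpow_of_nonneg _ (by positivity), ENNReal.coe_toNNReal hKT, weightedNorm,
    weightedNorm, ← ENNReal.mul_rpow_of_nonneg _ _ (by positivity)]
  refine ENNReal.rpow_le_rpow ?_ (by positivity)
  calc ∫⁻ x, maximalFunction f x ^ p * v x
      ≤ ∫⁻ x, (((d : ℝ≥0∞) + 1) ^ d) ^ p * (ballMaximal (fun y => ‖f y‖ₑ) x ^ p * v x) := by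
        refine lintegral_mono fun x => ?_
        rw [← mul_assoc, ← ENNReal.mul_rpow_of_nonneg _ _ hp0.le]
        gcongr
        exact maximalFunction_le f x
    _ = (((d : ℝ≥0∞) + 1) ^ d) ^ p * ∫⁻ x, ballMaximal (fun y => ‖f y‖ₑ) x ^ p * v x := by
        rw [lintegral_const_mul' _ _ (ENNReal.rpow_ne_top_of_nonneg hp0.le (by finiteness))]
    _ ≤ _ := by
        rw [mul_assoc]
        gcongr
        exact h f hf

theorem LocalA1.maximalBounded {p : ℝ} (hp : 1 < p) {C : ℝ≥0∞} (hC : C ≠ ∞)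
    {w : Space d → ℝ≥0∞} (hw : Measurable w) (hA : LocalA1 C w) : MaximalBounded p w w := by
  have hV : volume (Metric.ball (0 : Space d) 1) ≠ ∞ := measure_ball_lt_top.ne
  refine maximalBounded_of_lintegral_le hp (K := 2 ^ p * (2 * C * 6 ^ d) * geomConst (p - 1) *
    (2 * volume (Metric.ball (0 : Space d) 1)) ^ (p - 1)) ?_ fun f hf => ?_
  · have h1 := geomConst_ne_top (p := p - 1) (by linarith)
    have h2 : (2 * volume (Metric.ball (0 : Space d) 1)) ^ (p - 1) ≠ ∞ :=
      ENNReal.rpow_ne_top_of_nonneg (by linarith) (by finiteness)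
    finiteness
  · obtain ⟨g, hg, hgT, hgw, hgf⟩ := hf.exists_measurable hw fun x hx => hx
    have key := lintegral_rpow_le_of_weakType hp (measurable_ballMaximal g) hg hgT
      (μ := volume.withDensity w) (A := 2 * C * 6 ^ d)
      (B := 2 * volume (Metric.ball (0 : Space d) 1)) (by finiteness)
      fun t _ ht => weakType_ballMaximal hw hA hg hgw ht
    rw [lintegral_withDensity_eq_lintegral_mul _ hw ((measurable_ballMaximal g).pow_const p),
      lintegral_withDensity_eq_lintegral_mul _ hw (hg.pow_const p)] at key
    rw [← ballMaximal_congr hgf]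
    refine (lintegral_congr fun x => ?_).trans_le (key.trans_eq ?_)
    · exact mul_comm _ _
    · congr 1
      refine lintegral_congr_ae ?_
      filter_upwards [hgf] with x hx
      simp only [Pi.mul_apply, hx, mul_comm]

/-- The substitution f = wg turns the norm of f in L^p(w^(1-p)) into the norm of g in L^p(w), and Mf
into w times the operator of `weakType_ballMaximal_div`. -/
theorem LocalA1.maximalBounded_weightPow {p : ℝ} (hp : 1 < p) {C : ℝ≥0∞} (hC0 : C ≠ 0)
    (hC : C ≠ ∞) {w : Space d → ℝ≥0∞} (hw : Measurable w) (hwT : ∀ x, w x ≠ ∞)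
    (hA : LocalA1 C w) : MaximalBounded p (weightPow w (1 - p)) (weightPow w (1 - p)) := by
  have hp0 : 0 < p := by linarith
  refine maximalBounded_of_lintegral_le hp (K := 2 ^ p * (2 * C * 5 ^ d) * geomConst (p - 1) *
    (2 * C) ^ (p - 1)) ?_ fun f hf => ?_
  · have h1 := geomConst_ne_top (p := p - 1) (by linarith)
    have h2 : (2 * C) ^ (p - 1) ≠ ∞ :=
      ENNReal.rpow_ne_top_of_nonneg (by linarith) (by finiteness)
    finiteness
  · obtain ⟨g, hg, hgT, hgw, hgf⟩ := hf.exists_measurable hw fun x hx => by simp [weightPow, hx]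
    have hgm : Measurable fun x => g x / w x := hg.div hw
    have hwg : (fun y => w y * (g y / w y)) = g := by
      funext y
      rcases eq_or_ne (w y) 0 with h | h
      · simp [h, hgw y h]
      · exact ENNReal.mul_div_cancel h (hwT y)
    have hSm : Measurable fun x => if w x = 0 then 0 else
        ballMaximal (fun y => w y * (g y / w y)) x / w x :=
      Measurable.ite (hw (measurableSet_singleton 0)) measurable_const
        ((measurable_ballMaximal _).div hw)
    have hgT' : ∀ x, g x / w x ≠ ∞ := by
      intro x
      rcases eq_or_ne (w x) 0 with h | h
      · simp [h, hgw x h]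
      · exact ENNReal.div_ne_top (hgT x) h
    have key := lintegral_rpow_le_of_weakType hp hSm hgm hgT'
      (μ := volume.withDensity w) (A := 2 * C * 5 ^ d) (B := 2 * C) (by finiteness)
      fun t _ ht => weakType_ballMaximal_div hC0 hC hw hwT hA hgm ht
    rw [lintegral_withDensity_eq_lintegral_mul _ hw (hSm.pow_const p),
      lintegral_withDensity_eq_lintegral_mul _ hw (hgm.pow_const p)] at key
    rw [hwg] at key
    have hpow : ∀ (a : ℝ≥0∞) x, w x ≠ 0 → w x * (a / w x) ^ p = a ^ p * w x ^ (1 - p) := by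
      intro a x hx
      rw [ENNReal.div_rpow_of_nonneg _ _ hp0.le, ENNReal.rpow_sub _ _ hx (hwT x),
        ENNReal.rpow_one, div_eq_mul_inv, div_eq_mul_inv]
      ring
    rw [← ballMaximal_congr hgf]
    refine (lintegral_congr fun x => ?_).trans_le (key.trans_eq ?_)
    · rcases eq_or_ne (w x) 0 with h | h
      · simp [weightPow, h]
      · simp only [weightPow, h, if_false, Pi.mul_apply, hpow _ x h]
    · congr 1
      refine lintegral_congr_ae ?_
      filter_upwards [hgf] with x hx
      rcases eq_or_ne (w x) 0 with h | h
      · simp [weightPow, h]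
      · simp only [weightPow, h, if_false, Pi.mul_apply, hpow _ x h, hx]

end

section

/-! ### Calderón-Zygmund kernels -/

variable {d : ℕ} {Ω : Space d → ℝ}

/-- The convolution kernel `Ω(z) / |z|^d`. -/
noncomputable def convKernel (Ω : Space d → ℝ) (z : Space d) : ℝ := Ω z / ‖z‖ ^ d

theorem czKernel_eq (x y : Space d) : czKernel Ω x y = convKernel Ω (x - y) := rfl

theorem IsCZSymbol.exists_bound (hΩ : IsCZSymbol Ω) :
    ∃ B : ℝ, 0 ≤ B ∧ ∀ z, z ≠ 0 → |Ω z| ≤ B := by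
  have hc : ContinuousOn Ω (Metric.sphere 0 1) := hΩ.contDiffOn.continuousOn.mono fun z hz => by
    rintro rfl
    simp at hz
  obtain ⟨B, hB⟩ := (isCompact_sphere (0 : Space d) 1).exists_bound_of_continuousOn hc
  refine ⟨max B 0, le_max_right _ _, fun z hz => ?_⟩
  have hz' : 0 < ‖z‖ := norm_pos_iff.2 hz
  rw [← hΩ.homogeneous ‖z‖⁻¹ z (by positivity) hz]
  exact (hB _ (by simp [norm_smul, hz'.ne'])).trans (le_max_left _ _)

theorem IsCZSymbol.measurable_convKernel (hd : d ≠ 0) (hΩ : IsCZSymbol Ω) :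
    Measurable (convKernel Ω) := by
  have h1 : ContinuousOn (convKernel Ω) {0}ᶜ := by
    refine hΩ.contDiffOn.continuousOn.div (by fun_prop) fun z hz => ?_
    exact pow_ne_zero _ (norm_ne_zero_iff.2 hz)
  have h2 : convKernel Ω = ({0}ᶜ : Set (Space d)).indicator (convKernel Ω) := by
    funext z
    by_cases hz : z = 0
    · simp [hz, convKernel, hd]
    · simp [hz]
  have h3 := h1.measurable_piecewise (g := fun _ => 0) continuousOn_const
    (measurableSet_singleton (0 : Space d)).compl
  rwa [h2, ← Set.piecewise_eq_indicator]

theorem abs_convKernel_le (hd : d ≠ 0) {B : ℝ} (hB : ∀ z, z ≠ 0 → |Ω z| ≤ B) (z : Space d) :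
    |convKernel Ω z| ≤ B / ‖z‖ ^ d := by
  by_cases hz : z = 0
  · simp [hz, convKernel, hd]
  · rw [convKernel, abs_div, abs_of_nonneg (by positivity : 0 ≤ ‖z‖ ^ d)]
    gcongr
    exact hB z hz

theorem IsCZSymbol.convKernel_smul (hd : d ≠ 0) (hΩ : IsCZSymbol Ω) {t : ℝ} (ht : 0 < t)
    (z : Space d) : convKernel Ω (t • z) = (t ^ d)⁻¹ * convKernel Ω z := by
  by_cases hz : z = 0
  · simp [hz, convKernel, hd]
  · rw [convKernel, convKernel, hΩ.homogeneous t z ht hz, norm_smul, Real.norm_eq_abs,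
      abs_of_pos ht, mul_pow]
    field_simp

theorem IsCZSymbol.contDiffOn_convKernel (hΩ : IsCZSymbol Ω) :
    ContDiffOn ℝ 1 (convKernel Ω) {0}ᶜ := by
  refine hΩ.contDiffOn.div ?_ fun z hz => pow_ne_zero _ (norm_ne_zero_iff.2 hz)
  exact ((contDiffOn_id (𝕜 := ℝ)).norm ℝ fun z hz => hz).pow d

/-- The derivative of a function homogeneous of degree -d is homogeneous of degree -(d+1), so the
bound on the compact unit sphere determines it everywhere. -/
theorem IsCZSymbol.exists_fderiv_bound (hd : d ≠ 0) (hΩ : IsCZSymbol Ω) :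
    ∃ C : ℝ, 0 ≤ C ∧ ∀ z, z ≠ 0 → ‖fderiv ℝ (convKernel Ω) z‖ ≤ C / ‖z‖ ^ (d + 1) := by
  have hc : ContinuousOn (fderiv ℝ (convKernel Ω)) (Metric.sphere 0 1) :=
    (hΩ.contDiffOn_convKernel.continuousOn_fderiv_of_isOpen isOpen_compl_singleton le_rfl).mono
      fun z hz => by
        rintro rfl
        simp at hz
  obtain ⟨C, hC⟩ := (isCompact_sphere (0 : Space d) 1).exists_bound_of_continuousOn hc
  refine ⟨max C 0, le_max_right _ _, fun z hz => ?_⟩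
  have hz' : 0 < ‖z‖ := norm_pos_iff.2 hz
  have h1 := hC (‖z‖⁻¹ • z) (by simp [norm_smul, hz'.ne'])
  have ht : 0 < ‖z‖⁻¹ := by positivity
  have h2 : (fun y => convKernel Ω (‖z‖⁻¹ • y)) = fun y => (‖z‖⁻¹ ^ d)⁻¹ • convKernel Ω y := by
    funext y
    exact hΩ.convKernel_smul hd ht y
  have hdiff : DifferentiableAt ℝ (convKernel Ω) z :=
    (hΩ.contDiffOn_convKernel.differentiableOn one_ne_zero).differentiableAt
      (isOpen_compl_singleton.mem_nhds hz)
  have h3 := congrArg (fun F => fderiv ℝ F z) h2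
  simp only [fderiv_comp_smul, fderiv_fun_const_smul hdiff] at h3
  have h4 := congrArg norm h3
  rw [norm_smul, norm_smul, Real.norm_eq_abs, Real.norm_eq_abs, abs_of_pos ht,
    abs_of_pos (by positivity)] at h4
  have h5 : ‖fderiv ℝ (convKernel Ω) z‖ =
      ‖fderiv ℝ (convKernel Ω) (‖z‖⁻¹ • z)‖ / ‖z‖ ^ (d + 1) := by
    rw [eq_div_iff (by positivity), pow_succ]
    rw [inv_pow, inv_inv, inv_mul_eq_iff_eq_mul₀ hz'.ne'] at h4
    rw [h4]
    ring
  rw [h5]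
  gcongr
  exact h1.trans (le_max_left _ _)

/-- The mean value inequality on the ball of radius ρ about c - y, all of whose points have norm at
least ‖y - c‖ / 2; this costs the factor 2^(d+1). -/
theorem IsCZSymbol.exists_lipschitz (hd : d ≠ 0) (hΩ : IsCZSymbol Ω) :
    ∃ C : ℝ, 0 ≤ C ∧ ∀ (c y x x' : Space d) (ρ : ℝ), 0 < ρ → 2 * ρ ≤ ‖y - c‖ →
      x ∈ Metric.closedBall c ρ → x' ∈ Metric.closedBall c ρ →
      |convKernel Ω (x - y) - convKernel Ω (x' - y)| ≤ C / ‖y - c‖ ^ (d + 1) * ‖x - x'‖ := by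
  obtain ⟨C, hC0, hC⟩ := hΩ.exists_fderiv_bound hd
  refine ⟨2 ^ (d + 1) * C, by positivity, fun c y x x' ρ hρ hy hx hx' => ?_⟩
  have hpos : 0 < ‖y - c‖ := by linarith
  have hball : ∀ z ∈ Metric.closedBall (c - y) ρ, ‖y - c‖ / 2 ≤ ‖z‖ := by
    intro z hz
    rw [Metric.mem_closedBall, dist_eq_norm] at hz
    have h1 := norm_sub_le (c - y - z) (-z)
    rw [sub_neg_eq_add, sub_add_cancel, norm_neg, norm_sub_rev c y, norm_sub_rev (c - y) z] at h1
    linarith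
  have hne : ∀ z ∈ Metric.closedBall (c - y) ρ, z ≠ 0 := by
    rintro z hz rfl
    have := hball 0 hz
    rw [norm_zero] at this
    linarith
  have key := (convex_closedBall (c - y) ρ).norm_image_sub_le_of_norm_fderiv_le (𝕜 := ℝ)
    (f := convKernel Ω) (C := 2 ^ (d + 1) * C / ‖y - c‖ ^ (d + 1)) (x := x' - y) (y := x - y)
    (fun z hz => (hΩ.contDiffOn_convKernel.differentiableOn one_ne_zero).differentiableAt
      (isOpen_compl_singleton.mem_nhds (hne z hz)))
    (fun z hz => (hC z (hne z hz)).trans (by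
      have h1 := hball z hz
      calc C / ‖z‖ ^ (d + 1) ≤ C / (‖y - c‖ / 2) ^ (d + 1) := by gcongr
        _ = _ := by rw [div_pow]; field_simp))
    (by rwa [Metric.mem_closedBall, dist_sub_right])
    (by rwa [Metric.mem_closedBall, dist_sub_right])
  simpa using key

/-- In polar coordinates the integrand is Ω on the sphere times a radial function, and Ω has mean
zero. -/
theorem IsCZSymbol.setIntegral_annulus_eq_zero (hd : d ≠ 0) (hΩ : IsCZSymbol Ω)
    (ε R : ℝ) : ∫ z in {z : Space d | ε < ‖z‖ ∧ ‖z‖ ≤ R}, convKernel Ω z = 0 := by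
  have : Nonempty (Fin d) := ⟨⟨0, Nat.pos_of_ne_zero hd⟩⟩
  have hms : MeasurableSet {z : Space d | ε < ‖z‖ ∧ ‖z‖ ≤ R} :=
    (measurableSet_lt measurable_const measurable_norm).inter
      (measurableSet_le measurable_norm measurable_const)
  rw [← integral_indicator hms]
  set F := {z : Space d | ε < ‖z‖ ∧ ‖z‖ ≤ R}.indicator (convKernel Ω) with hF
  have h1 : ∫ z, F z = ∫ z : ({(0)}ᶜ : Set (Space d)), F z ∂(volume.comap Subtype.val) := by
    rw [integral_subtype_comap (measurableSet_singleton _).compl F, restrict_compl_singleton]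
  have h2 := (Measure.measurePreserving_homeomorphUnitSphereProd
    (volume : Measure (Space d))).integral_comp (Homeomorph.measurableEmbedding _)
    (fun q => Ω q.1 * (Set.Ioc ε R).indicator (fun r => (r ^ d)⁻¹) (q.2 : ℝ))
  rw [h1]
  have h3 : ∀ z : ({(0)}ᶜ : Set (Space d)), F z =
      Ω ((homeomorphUnitSphereProd (Space d) z).1) *
        (Set.Ioc ε R).indicator (fun r => (r ^ d)⁻¹) ((homeomorphUnitSphereProd (Space d) z).2 : ℝ) := by
    intro z
    have hz : (z : Space d) ≠ 0 := z.2
    have hz' : 0 < ‖(z : Space d)‖ := norm_pos_iff.2 hz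
    simp only [homeomorphUnitSphereProd_apply_fst_coe, homeomorphUnitSphereProd_apply_snd_coe]
    rw [hΩ.homogeneous _ _ (by positivity) hz]
    by_cases h : ε < ‖(z : Space d)‖ ∧ ‖(z : Space d)‖ ≤ R
    · rw [hF, Set.indicator_of_mem (by exact h), Set.indicator_of_mem (by exact h), convKernel,
        div_eq_mul_inv]
    · rw [hF, Set.indicator_of_notMem (by exact h), Set.indicator_of_notMem (by exact h), mul_zero]
  rw [integral_congr_ae (Eventually.of_forall h3)]
  rw [h2, integral_prod_mul (fun x : Metric.sphere (0 : Space d) 1 => Ω x)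
    (fun r : Set.Ioi (0 : ℝ) => (Set.Ioc ε R).indicator (fun r => (r ^ d)⁻¹) (r : ℝ)),
    hΩ.integral_sphere_eq_zero, zero_mul]

/-! ### Principal values -/

theorem measurableSet_truncation (x : Space d) (ε : ℝ) :
    MeasurableSet {y : Space d | ε < ‖x - y‖} :=
  measurableSet_lt measurable_const (by fun_prop)

theorem IsCZSymbol.integrableOn_truncation (hd : d ≠ 0) (hΩ : IsCZSymbol Ω) {f : Space d → ℝ}
    (hf : Integrable f) (x : Space d) {ε : ℝ} (hε : 0 < ε) :
    IntegrableOn (fun y => czKernel Ω x y * f y) {y | ε < ‖x - y‖} volume := by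
  obtain ⟨B, hB0, hB⟩ := hΩ.exists_bound
  refine Integrable.bdd_mul (c := B / ε ^ d) hf.integrableOn ?_ ?_
  · exact ((hΩ.measurable_convKernel hd).comp (measurable_const.sub measurable_id)).aestronglyMeasurable
  · refine (ae_restrict_iff' (measurableSet_truncation x ε)).2 (Eventually.of_forall fun y hy => ?_)
    rw [Real.norm_eq_abs, czKernel_eq]
    refine (abs_convKernel_le hd hB _).trans ?_
    have : ε < ‖x - y‖ := hy
    gcongr

theorem HasCZValue.add {f g : Space d → ℝ} {x : Space d} {a b : ℝ} (ha : HasCZValue Ω f x a)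
    (hb : HasCZValue Ω g x b) : HasCZValue Ω (fun y => f y + g y) x (a + b) := by
  refine ⟨fun ε hε => ?_, ?_⟩
  · simp only [mul_add]
    exact (ha.1 ε hε).add (hb.1 ε hε)
  · refine (ha.2.add hb.2).congr' ?_
    filter_upwards [self_mem_nhdsWithin] with ε hε
    simp only [mul_add]
    exact (integral_add (ha.1 ε hε) (hb.1 ε hε)).symm

theorem HasCZValue.const_mul {f : Space d → ℝ} {x : Space d} {a : ℝ} (ha : HasCZValue Ω f x a)
    (c : ℝ) : HasCZValue Ω (fun y => c * f y) x (c * a) := by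
  refine ⟨fun ε hε => ?_, ?_⟩
  · simp only [mul_left_comm _ c]
    exact (ha.1 ε hε).const_mul c
  · refine (ha.2.const_mul c).congr fun ε => ?_
    simp only [mul_left_comm _ c]
    exact (integral_const_mul _ _).symm

/-- Where `f` is constant the annuli contribute nothing, so the truncated integrals do not change
below the radius r. This replaces any general theorem on the existence of principal values. -/
theorem IsCZSymbol.hasCZValue_of_eq_const (hd : d ≠ 0) (hΩ : IsCZSymbol Ω) {f : Space d → ℝ}
    (hf : Integrable f) {x : Space d} {r c : ℝ} (hr : 0 < r)
    (hc : ∀ y, ‖x - y‖ ≤ r → f y = c) :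
    HasCZValue Ω f x (∫ y in {y | r < ‖x - y‖}, czKernel Ω x y * f y) := by
  refine ⟨fun ε hε => hΩ.integrableOn_truncation hd hf x hε, ?_⟩
  refine tendsto_const_nhds.congr' ?_
  have : ∀ᶠ ε in 𝓝[>] (0 : ℝ), ε ∈ Set.Ioo 0 r := Ioo_mem_nhdsGT hr
  filter_upwards [this] with ε hε
  have hset : {y | ε < ‖x - y‖} = {y | r < ‖x - y‖} ∪ {y | ε < ‖x - y‖ ∧ ‖x - y‖ ≤ r} := by
    ext y
    simp only [Set.mem_ofPred_eq, Set.mem_union]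
    have := hε.2
    constructor
    · intro h
      rcases lt_or_ge r ‖x - y‖ with h' | h'
      · exact Or.inl h'
      · exact Or.inr ⟨h, h'⟩
    · rintro (h | h)
      · linarith
      · exact h.1
  have hms : MeasurableSet {y : Space d | ε < ‖x - y‖ ∧ ‖x - y‖ ≤ r} :=
    (measurableSet_truncation x ε).inter
      (measurableSet_le (f := fun y : Space d => ‖x - y‖) (by fun_prop) measurable_const)
  have hint := hΩ.integrableOn_truncation hd hf x hε.1
  rw [hset] at hint ⊢
  rw [setIntegral_union _ hms (hint.mono_set Set.subset_union_left)
    (hint.mono_set Set.subset_union_right)]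
  · have h1 : ∫ y in {y | ε < ‖x - y‖ ∧ ‖x - y‖ ≤ r}, czKernel Ω x y * f y =
        ∫ y in {y | ε < ‖x - y‖ ∧ ‖x - y‖ ≤ r}, convKernel Ω (x - y) * c := by
      refine setIntegral_congr_fun hms fun y hy => ?_
      simp only [czKernel_eq, hc y hy.2]
    have h2 : ∫ y in {y | ε < ‖x - y‖ ∧ ‖x - y‖ ≤ r}, convKernel Ω (x - y) = 0 := by
      have hms' : MeasurableSet {z : Space d | ε < ‖z‖ ∧ ‖z‖ ≤ r} :=
        (measurableSet_lt measurable_const measurable_norm).inter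
          (measurableSet_le measurable_norm measurable_const)
      rw [← hΩ.setIntegral_annulus_eq_zero hd ε r, ← integral_indicator hms,
        ← integral_indicator hms', ← integral_sub_left_eq_self
          ({z : Space d | ε < ‖z‖ ∧ ‖z‖ ≤ r}.indicator (convKernel Ω)) volume x]
      rfl
    rw [h1, integral_mul_const, h2, zero_mul, add_zero]
  · rw [Set.disjoint_left]
    rintro y hy ⟨_, hy2⟩
    exact absurd hy (not_lt.2 hy2)

theorem IsCZSymbol.integrable_of_eq_zero (hd : d ≠ 0) (hΩ : IsCZSymbol Ω) {f : Space d → ℝ}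
    (hf : Integrable f) {x : Space d} {r : ℝ} (hr : 0 < r)
    (h0 : ∀ y, ‖x - y‖ ≤ r → f y = 0) : Integrable (fun y => czKernel Ω x y * f y) := by
  refine (integrableOn_iff_integrable_of_support_subset fun y hy => ?_).1
    (hΩ.integrableOn_truncation hd hf x hr)
  by_contra h
  exact hy (by simp [h0 y (not_lt.1 h)])

theorem IsCZSymbol.hasCZValue_of_eq_zero (hd : d ≠ 0) (hΩ : IsCZSymbol Ω) {f : Space d → ℝ}
    (hf : Integrable f) {x : Space d} {r : ℝ} (hr : 0 < r)
    (h0 : ∀ y, ‖x - y‖ ≤ r → f y = 0) :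
    HasCZValue Ω f x (∫ y, czKernel Ω x y * f y) := by
  have h := hΩ.hasCZValue_of_eq_const hd hf hr h0
  rwa [setIntegral_eq_integral_of_forall_compl_eq_zero] at h
  intro y hy
  simp [h0 y (not_lt.1 hy)]

/-! ### Dilations -/

/-- The map `y ↦ (y - a) / s`. -/
noncomputable def dilation (a : Space d) (s : ℝ) (y : Space d) : Space d := s⁻¹ • (y - a)

theorem map_dilation (a : Space d) {s : ℝ} (hs : 0 < s) :
    Measure.map (dilation a s) (volume : Measure (Space d)) =
      ENNReal.ofReal s ^ d • (volume : Measure (Space d)) := by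
  have h1 : dilation a s = (fun y => s⁻¹ • y) ∘ fun y => y - a := rfl
  rw [h1, ← Measure.map_map (by fun_prop) (by fun_prop),
    (measurePreserving_sub_right volume a).map_eq]
  have h2 := Measure.map_addHaar_smul (volume : Measure (Space d)) (inv_ne_zero hs.ne')
  rw [finrank_euclideanSpace_fin, inv_pow, inv_inv, abs_of_pos (by positivity),
    ENNReal.ofReal_pow hs.le] at h2
  exact h2

theorem measurableEmbedding_dilation (a : Space d) {s : ℝ} (hs : 0 < s) :
    MeasurableEmbedding (dilation a s) :=
  (((Homeomorph.subRight a).trans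
    (Homeomorph.smulOfNeZero s⁻¹ (inv_ne_zero hs.ne'))).measurableEmbedding)

theorem lintegral_comp_dilation (a : Space d) {s : ℝ} (hs : 0 < s) (H : Space d → ℝ≥0∞) :
    ∫⁻ y, H (dilation a s y) = ENNReal.ofReal s ^ d * ∫⁻ y, H y := by
  rw [← (measurableEmbedding_dilation a hs).lintegral_map, map_dilation a hs,
    lintegral_smul_measure, smul_eq_mul]

theorem integral_comp_dilation (a : Space d) {s : ℝ} (hs : 0 < s) (H : Space d → ℝ) :
    ∫ y, H (dilation a s y) = s ^ d * ∫ y, H y := by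
  rw [← (measurableEmbedding_dilation a hs).integral_map, map_dilation a hs,
    integral_smul_measure, smul_eq_mul, ENNReal.toReal_pow, ENNReal.toReal_ofReal hs.le]

theorem integrable_comp_dilation (a : Space d) {s : ℝ} (hs : 0 < s) {H : Space d → ℝ}
    (hH : Integrable H) : Integrable fun y => H (dilation a s y) := by
  refine (measurableEmbedding_dilation a hs).integrable_map_iff.1 ?_
  rw [map_dilation a hs]
  exact hH.smul_measure (by finiteness)

/-- T commutes with translations and dilations: the factor s^(-d) of the kernel cancels the
Jacobian. -/
theorem HasCZValue.comp_dilation (hd : d ≠ 0) (hΩ : IsCZSymbol Ω) {f : Space d → ℝ} {x : Space d}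
    {t : ℝ} (h : HasCZValue Ω f x t) (a : Space d) {s : ℝ} (hs : 0 < s) :
    HasCZValue Ω (fun y => f (dilation a s y)) (a + s • x) t := by
  have hk : ∀ y, czKernel Ω (a + s • x) y = (s ^ d)⁻¹ * czKernel Ω x (dilation a s y) := by
    intro y
    rw [czKernel_eq, czKernel_eq, ← hΩ.convKernel_smul hd hs, dilation, smul_sub,
      smul_inv_smul₀ hs.ne']
    congr 1
    abel
  have hn : ∀ y, ‖a + s • x - y‖ = s * ‖x - dilation a s y‖ := by
    intro y
    rw [← abs_of_pos hs, ← Real.norm_eq_abs, ← norm_smul, dilation, smul_sub, Real.norm_eq_abs,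
      abs_of_pos hs, smul_inv_smul₀ hs.ne']
    congr 1
    abel
  have hind : ∀ ε y, {y | ε < ‖a + s • x - y‖}.indicator
      (fun y => czKernel Ω (a + s • x) y * f (dilation a s y)) y =
      (s ^ d)⁻¹ * {y | ε / s < ‖x - y‖}.indicator (fun y => czKernel Ω x y * f y)
        (dilation a s y) := by
    intro ε y
    have : ε < ‖a + s • x - y‖ ↔ ε / s < ‖x - dilation a s y‖ := by
      rw [hn, div_lt_iff₀ hs, mul_comm]
    by_cases hy : ε < ‖a + s • x - y‖
    · rw [Set.indicator_of_mem (by exact hy), Set.indicator_of_mem (by exact this.1 hy), hk,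
        mul_assoc]
    · rw [Set.indicator_of_notMem (by exact hy), Set.indicator_of_notMem (by exact this.not.1 hy),
        mul_zero]
  have hint : ∀ ε, ∫ y in {y | ε < ‖a + s • x - y‖},
      czKernel Ω (a + s • x) y * f (dilation a s y) =
      ∫ y in {y | ε / s < ‖x - y‖}, czKernel Ω x y * f y := by
    intro ε
    rw [← integral_indicator (measurableSet_truncation _ _),
      ← integral_indicator (measurableSet_truncation _ _)]
    simp only [hind]
    rw [integral_const_mul, integral_comp_dilation a hs
      (fun y => {y | ε / s < ‖x - y‖}.indicator (fun y => czKernel Ω x y * f y) y)]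
    field_simp
  refine ⟨fun ε hε => ?_, ?_⟩
  · rw [← integrable_indicator_iff (measurableSet_truncation _ _)]
    have h1 := h.1 (ε / s) (by positivity)
    rw [← integrable_indicator_iff (measurableSet_truncation _ _)] at h1
    simp only [funext (hind ε)]
    exact (integrable_comp_dilation a hs h1).const_mul _
  · simp only [hint]
    refine h.2.comp (tendsto_nhdsWithin_of_tendsto_nhds_of_eventually_within _ ?_ ?_)
    · have : Tendsto (fun ε : ℝ => ε / s) (𝓝 0) (𝓝 (0 / s)) :=
        (continuous_id.div_const s).tendsto 0
      rw [zero_div] at this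
      exact this.mono_left nhdsWithin_le_nhds
    · filter_upwards [self_mem_nhdsWithin] with ε hε
      exact div_pos hε hs

end

section

/-! ### Regularity of `T W` away from the support of `W` -/

variable {d : ℕ} {Ω : Space d → ℝ}

theorem ENNReal.tsum_ofReal_half_pow (a : ℝ) (ha : 0 ≤ a) :
    ∑' k : ℕ, ENNReal.ofReal (a * (1 / 2) ^ k) = ENNReal.ofReal (2 * a) := by
  rw [← ENNReal.ofReal_tsum_of_nonneg (fun k => by positivity)
    (summable_geometric_two.mul_left a), tsum_mul_left, tsum_geometric_two, mul_comm]

/-- On the k-th dyadic annulus the growth R^d loses against R^(-(d+1)) by a factor 1 / R, so the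
annuli sum geometrically. -/
theorem lintegral_div_norm_pow_le {W : Space d → ℝ≥0∞} (hW : Measurable W) {c : Space d} {A R₀ : ℝ}
    (hA : 0 ≤ A) (hR₀ : 0 < R₀) (h0 : ∀ y, ‖y - c‖ < R₀ → W y = 0)
    (hgrowth : ∀ R, R₀ ≤ R → ∫⁻ y in Metric.closedBall c R, W y ≤ ENNReal.ofReal (A * R ^ d)) :
    ∫⁻ y, W y * ENNReal.ofReal (1 / ‖y - c‖ ^ (d + 1)) ≤
      ENNReal.ofReal (2 ^ (d + 1) * (A / R₀)) := by
  set ρ : ℕ → ℝ := fun k => 2 ^ k * R₀ with hρ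
  have hρ0 : ∀ k, 0 < ρ k := fun k => by positivity
  calc ∫⁻ y, W y * ENNReal.ofReal (1 / ‖y - c‖ ^ (d + 1))
      ≤ ∫⁻ y, ∑' k : ℕ, ENNReal.ofReal (1 / ρ k ^ (d + 1)) *
          (Metric.closedBall c (ρ (k + 1))).indicator W y := by
        refine lintegral_mono fun y => ?_
        rcases lt_or_ge ‖y - c‖ R₀ with hy | hy
        · simp [h0 y hy]
        obtain ⟨k, hk1, hk2⟩ := exists_nat_pow_near (x := ‖y - c‖ / R₀) (y := 2)
          (by rwa [le_div_iff₀ hR₀, one_mul]) (by norm_num)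
        rw [le_div_iff₀ hR₀] at hk1
        rw [div_lt_iff₀ hR₀] at hk2
        refine le_trans ?_ (ENNReal.le_tsum k)
        rw [Set.indicator_of_mem (by rw [mem_closedBall_iff_norm]; exact hk2.le), mul_comm]
        have := hρ0 k
        gcongr
    _ = ∑' k : ℕ, ENNReal.ofReal (1 / ρ k ^ (d + 1)) *
          ∫⁻ y in Metric.closedBall c (ρ (k + 1)), W y := by
        rw [lintegral_tsum fun k =>
          ((hW.indicator Metric.isClosed_closedBall.measurableSet).const_mul _).aemeasurable]
        refine tsum_congr fun k => ?_
        rw [lintegral_const_mul _ (hW.indicator Metric.isClosed_closedBall.measurableSet),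
          lintegral_indicator Metric.isClosed_closedBall.measurableSet]
    _ ≤ ∑' k : ℕ, ENNReal.ofReal (2 ^ d * (A / R₀) * (1 / 2) ^ k) := by
        refine ENNReal.tsum_le_tsum fun k => ?_
        have h1 : R₀ ≤ ρ (k + 1) := by
          rw [hρ]
          exact le_mul_of_one_le_left hR₀.le (one_le_pow₀ (by norm_num))
        calc _ ≤ ENNReal.ofReal (1 / ρ k ^ (d + 1)) * ENNReal.ofReal (A * ρ (k + 1) ^ d) := by
              gcongr
              exact hgrowth _ h1
          _ = _ := by
              have := hρ0 k
              rw [← ENNReal.ofReal_mul (by positivity)]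
              congr 1
              have h2 : ρ (k + 1) = 2 * ρ k := by simp only [hρ]; ring
              rw [h2, mul_pow 2 (ρ k) d, pow_succ (ρ k)]
              have h3 : (1 / 2 : ℝ) ^ k = R₀ / ρ k := by
                simp only [hρ, div_pow, one_pow]
                field_simp
              rw [h3]
              field_simp
    _ = _ := by
        rw [ENNReal.tsum_ofReal_half_pow _ (by positivity)]
        ring_nf

/-- Controls the interaction of a ball with everything outside it. The constant depends on Ω only,
and the bound A / R₀ scales like a density divided by a length. -/
theorem IsCZSymbol.exists_lipschitz_integral (hd : d ≠ 0) (hΩ : IsCZSymbol Ω) :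
    ∃ C : ℝ, 0 ≤ C ∧ ∀ (W : Space d → ℝ) (c : Space d) (A R₀ ρ : ℝ), Measurable W →
      (∀ y, 0 ≤ W y) → Integrable W → 0 ≤ A → 0 < ρ → 2 * ρ ≤ R₀ →
      (∀ y, ‖y - c‖ < R₀ → W y = 0) →
      (∀ R, R₀ ≤ R → ∫⁻ y in Metric.closedBall c R, ENNReal.ofReal (W y) ≤
        ENNReal.ofReal (A * R ^ d)) →
      ∀ x ∈ Metric.closedBall c ρ, ∀ x' ∈ Metric.closedBall c ρ,
        |(∫ y, czKernel Ω x y * W y) - ∫ y, czKernel Ω x' y * W y| ≤ C * (A / R₀) * ‖x - x'‖ := by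
  obtain ⟨C, hC0, hC⟩ := hΩ.exists_lipschitz hd
  refine ⟨C * 2 ^ (d + 1), by positivity,
    fun W c A R₀ ρ hWm hW0 hWi hA hρ hR h0 hgrowth x hx x' hx' => ?_⟩
  have hR₀ : 0 < R₀ := by linarith
  have hint : ∀ x ∈ Metric.closedBall c ρ, Integrable fun y => czKernel Ω x y * W y := by
    intro x hx
    refine hΩ.integrable_of_eq_zero hd hWi (x := x) (r := ρ / 2) (by positivity) fun y hy => h0 y ?_
    rw [mem_closedBall_iff_norm] at hx
    have := norm_sub_le_norm_sub_add_norm_sub y x c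
    rw [norm_sub_rev y x] at this
    linarith
  rw [← integral_sub (hint x hx) (hint x' hx')]
  have hker : ∀ y, ‖czKernel Ω x y * W y - czKernel Ω x' y * W y‖ ≤
      C * ‖x - x'‖ * (W y * (1 / ‖y - c‖ ^ (d + 1))) := by
    intro y
    rcases lt_or_ge ‖y - c‖ R₀ with hy | hy
    · simp [h0 y hy]
    · rw [← sub_mul, norm_mul, Real.norm_eq_abs, Real.norm_eq_abs, abs_of_nonneg (hW0 y)]
      calc _ ≤ C / ‖y - c‖ ^ (d + 1) * ‖x - x'‖ * W y := by
            gcongr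
            · exact hW0 y
            · exact hC c y x x' ρ hρ (by linarith) hx hx'
        _ = _ := by ring
  have hmain := lintegral_div_norm_pow_le hWm.ennreal_ofReal hA hR₀
    (fun y hy => by rw [h0 y hy, ENNReal.ofReal_zero]) hgrowth
  rw [← Real.norm_eq_abs, ← ENNReal.ofReal_le_ofReal_iff (by positivity), ofReal_norm]
  calc _ ≤ ∫⁻ y, ‖czKernel Ω x y * W y - czKernel Ω x' y * W y‖ₑ :=
        enorm_integral_le_lintegral_enorm _
    _ ≤ ∫⁻ y, ENNReal.ofReal (C * ‖x - x'‖) *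
          (ENNReal.ofReal (W y) * ENNReal.ofReal (1 / ‖y - c‖ ^ (d + 1))) := by
        refine lintegral_mono fun y => ?_
        rw [← ENNReal.ofReal_mul (hW0 y), ← ENNReal.ofReal_mul (by positivity),
          ← ofReal_norm]
        exact ENNReal.ofReal_le_ofReal (hker y)
    _ ≤ ENNReal.ofReal (C * ‖x - x'‖) * ENNReal.ofReal (2 ^ (d + 1) * (A / R₀)) := by
        rw [lintegral_const_mul' _ _ ENNReal.ofReal_ne_top]
        gcongr
    _ = _ := by
        rw [← ENNReal.ofReal_mul (by positivity)]
        ring_nf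

end

section

/-! ### Profiles and the self-similar construction -/

variable {d : ℕ} {Ω : Space d → ℝ}

/-- The volume of the unit ball. -/
noncomputable def unitVol (d : ℕ) : ℝ≥0∞ := volume (Metric.ball (0 : Space d) 1)

theorem unitVol_ne_top : unitVol d ≠ ∞ := measure_ball_lt_top.ne

theorem unitVol_ne_zero : unitVol d ≠ 0 := (Metric.measure_ball_pos _ _ one_pos).ne'

theorem volume_closedBall_eq (x : Space d) {R : ℝ} (hR : 0 ≤ R) :
    volume (Metric.closedBall x R) = ENNReal.ofReal R ^ d * unitVol d := by
  rw [Measure.addHaar_closedBall _ _ hR, finrank_euclideanSpace_fin, ENNReal.ofReal_pow hR]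
  rfl

theorem norm_dilation (a : Space d) {s : ℝ} (hs : 0 < s) (y : Space d) :
    ‖dilation a s y‖ = dist y a / s := by
  rw [dilation, norm_smul, norm_inv, Real.norm_eq_abs, abs_of_pos hs, dist_eq_norm]
  field_simp

theorem add_smul_dilation (a : Space d) {s : ℝ} (hs : 0 < s) (x : Space d) :
    a + s • dilation a s x = x := by
  rw [dilation, smul_inv_smul₀ hs.ne', add_sub_cancel]

/-- `f` is constant in a neighbourhood of almost every point. -/
def AELocallyConst (f : Space d → ℝ) : Prop := ∀ᵐ x, ∃ c, ∀ᶠ y in 𝓝 x, f y = c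

theorem AELocallyConst.add {f g : Space d → ℝ} (hf : AELocallyConst f) (hg : AELocallyConst g) :
    AELocallyConst fun x => f x + g x := by
  filter_upwards [hf, hg] with x ⟨a, ha⟩ ⟨b, hb⟩
  refine ⟨a + b, ?_⟩
  filter_upwards [ha, hb] with y h1 h2
  rw [h1, h2]

theorem AELocallyConst.const_mul {f : Space d → ℝ} (hf : AELocallyConst f) (c : ℝ) :
    AELocallyConst fun x => c * f x := by
  filter_upwards [hf] with x ⟨a, ha⟩
  refine ⟨c * a, ?_⟩
  filter_upwards [ha] with y h1
  rw [h1]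

theorem AELocallyConst.sum {ι : Type*} {F : Finset ι} {f : ι → Space d → ℝ}
    (hf : ∀ i ∈ F, AELocallyConst (f i)) : AELocallyConst fun x => ∑ i ∈ F, f i x := by
  classical
  induction F using Finset.induction_on with
  | empty => exact Eventually.of_forall fun x => ⟨0, by simp⟩
  | insert i F hi ih =>
    simp only [Finset.sum_insert hi]
    exact (hf i (Finset.mem_insert_self _ _)).add
      (ih fun j hj => hf j (Finset.mem_insert_of_mem hj))

theorem ae_dilation {P : Space d → Prop} (h : ∀ᵐ x, P x) (a : Space d) {s : ℝ} (hs : 0 < s) :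
    ∀ᵐ x, P (dilation a s x) := by
  refine ae_of_ae_map (measurableEmbedding_dilation a hs).measurable.aemeasurable ?_
  rw [map_dilation a hs]
  exact Measure.ae_smul_measure h _

theorem continuous_dilation (a : Space d) (s : ℝ) : Continuous (dilation a s) := by
  unfold dilation
  fun_prop

theorem AELocallyConst.comp_dilation {f : Space d → ℝ} (hf : AELocallyConst f) (a : Space d)
    {s : ℝ} (hs : 0 < s) : AELocallyConst fun x => f (dilation a s x) := by
  filter_upwards [ae_dilation hf a hs] with x ⟨c, hc⟩
  exact ⟨c, (continuous_dilation a s).continuousAt.eventually hc⟩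

theorem aeLocallyConst_indicator_closedBall (p : Space d) {r : ℝ} (hr : 0 < r) :
    AELocallyConst ((Metric.closedBall p r).indicator 1) := by
  have h := Measure.addHaar_sphere_of_ne_zero (volume : Measure (Space d)) p hr.ne'
  filter_upwards [compl_mem_ae_iff.2 h] with x hx
  rcases lt_or_gt_of_ne (show dist x p ≠ r from hx) with h1 | h1
  · refine ⟨1, ?_⟩
    filter_upwards [Metric.isOpen_ball.mem_nhds (Metric.mem_ball.2 h1)] with y hy
    exact Set.indicator_of_mem (Metric.ball_subset_closedBall hy) _
  · refine ⟨0, ?_⟩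
    filter_upwards [Metric.isClosed_closedBall.isOpen_compl.mem_nhds
      (show x ∈ (Metric.closedBall p r)ᶜ by simpa using h1)] with y hy
    exact Set.indicator_of_notMem hy _

/-- A bounded, almost everywhere locally constant weight on the unit ball, of the same mass as the
unit ball, satisfying a local `A₁` condition. -/
structure IsProfile (C : ℝ≥0∞) (w : Space d → ℝ) : Prop where
  measurable : Measurable w
  nonneg : ∀ x, 0 ≤ w x
  one_le : ∀ x, w x ≠ 0 → 1 ≤ w x
  support : ∀ x, w x ≠ 0 → ‖x‖ ≤ 1
  lintegral_eq : ∫⁻ x, ENNReal.ofReal (w x) = unitVol d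
  bounded : ∃ H : ℝ, ∀ x, w x ≤ H
  aeLocallyConst : AELocallyConst w
  localA1 : LocalA1 C fun x => ENNReal.ofReal (w x)

theorem IsProfile.integrable {C : ℝ≥0∞} {w : Space d → ℝ} (h : IsProfile C w) :
    Integrable w := by
  refine ⟨h.measurable.aestronglyMeasurable, ?_⟩
  rw [hasFiniteIntegral_iff_ofReal (Eventually.of_forall h.nonneg), h.lintegral_eq]
  exact unitVol_ne_top.lt_top

theorem isProfile_indicator {C : ℝ≥0∞} (hC : unitVol d ≤ C) :
    IsProfile C ((Metric.closedBall (0 : Space d) 1).indicator 1) := by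
  have hof : ∀ x, ENNReal.ofReal ((Metric.closedBall (0 : Space d) 1).indicator 1 x) =
      (Metric.closedBall (0 : Space d) 1).indicator 1 x := by
    intro x
    by_cases hx : x ∈ Metric.closedBall (0 : Space d) 1 <;> simp only [hx, Set.indicator_of_mem,
      Set.indicator_of_notMem, not_false_eq_true, Pi.one_apply, ENNReal.ofReal_one,
      ENNReal.ofReal_zero]
  refine ⟨measurable_one.indicator Metric.isClosed_closedBall.measurableSet, ?_, ?_, ?_, ?_,
    ⟨1, ?_⟩, aeLocallyConst_indicator_closedBall 0 one_pos, ?_⟩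
  · exact fun x => Set.indicator_nonneg (fun _ _ => zero_le_one) x
  · intro x hx
    rw [Set.indicator_of_mem (Set.mem_of_indicator_ne_zero hx), Pi.one_apply]
  · intro x hx
    simpa using Set.mem_of_indicator_ne_zero hx
  · simp only [hof]
    rw [lintegral_indicator_one Metric.isClosed_closedBall.measurableSet,
      volume_closedBall_eq _ zero_le_one]
    simp
  · exact fun x => Set.indicator_le_self' (fun _ _ => zero_le_one) x
  · intro x hx R hR
    simp only [hof] at hx ⊢
    rw [Set.indicator_of_mem (Set.mem_of_indicator_ne_zero hx), Pi.one_apply, mul_one]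
    calc _ ≤ ∫⁻ y in Metric.closedBall x R, 1 :=
          lintegral_mono fun y => Set.indicator_le_self' (fun _ _ => zero_le_one) y
      _ ≤ _ := by
          rw [setLIntegral_one, volume_closedBall_eq _ hR.le, mul_comm]
          gcongr

/-- The data of one step of the construction: two balls `J` of radius `r` on which the weight is
left unchanged, and a family `F` of centres of balls of radius `s` into which the remaining mass is
moved, with density `lam`. -/
structure Scheme (d : ℕ) where
  p₁ : Space d
  p₂ : Space d
  r : ℝ
  s : ℝ
  lam : ℝ
  F : Finset (Space d)
  r_pos : 0 < r
  s_pos : 0 < s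
  one_le_lam : 1 ≤ lam
  mass : 2 * r ^ d + lam * s ^ d * F.card = 1
  separated : ∀ a ∈ F, ∀ b ∈ F, a ≠ b → 4 * s < dist a b
  dist_p₁ : ∀ a ∈ F, r + 4 * s ≤ dist a p₁
  dist_p₂ : ∀ a ∈ F, r + 4 * s ≤ dist a p₂
  dist_p₁_p₂ : 2 * r < dist p₁ p₂
  norm_F : ∀ a ∈ F, ‖a‖ + s ≤ 1
  norm_p₁ : ‖p₁‖ + r ≤ 1
  norm_p₂ : ‖p₂‖ + r ≤ 1

namespace Scheme

variable (S : Scheme d)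

/-- The two balls on which the weight is left unchanged. -/
def core : Set (Space d) := Metric.closedBall S.p₁ S.r ∪ Metric.closedBall S.p₂ S.r

theorem measurableSet_core : MeasurableSet S.core :=
  Metric.isClosed_closedBall.measurableSet.union Metric.isClosed_closedBall.measurableSet

/-- One step of the construction. -/
noncomputable def step (w : Space d → ℝ) (x : Space d) : ℝ :=
  S.core.indicator 1 x + S.lam * ∑ a ∈ S.F, w (dilation a S.s x)

/-- The part of `S.step w` that lives outside of the ball around `a`. -/
noncomputable def rest (w : Space d → ℝ) (a : Space d) (x : Space d) : ℝ :=
  S.step w x - S.lam * w (dilation a S.s x)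

variable {S} {C : ℝ≥0∞} {w : Space d → ℝ}

variable (S) in
theorem lam_pos : 0 < S.lam := one_pos.trans_le S.one_le_lam

theorem _root_.MuckenhouptWheeden.IsProfile.comp_dilation_eq_zero (hw : IsProfile C w)
    {a y : Space d} {s : ℝ} (hs : 0 < s) (h : s < dist y a) : w (dilation a s y) = 0 := by
  by_contra h0
  have := hw.support _ h0
  rw [norm_dilation a hs, div_le_one hs] at this
  linarith

theorem disjoint_core : Disjoint (Metric.closedBall S.p₁ S.r) (Metric.closedBall S.p₂ S.r) :=
  Metric.closedBall_disjoint_closedBall (by linarith [S.dist_p₁_p₂])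

theorem notMem_core {a y : Space d} (ha : a ∈ S.F) (h : dist y a ≤ 2 * S.s) : y ∉ S.core := by
  have hs := S.s_pos
  rintro (h1 | h1)
  · have := S.dist_p₁ a ha
    have := dist_triangle_left a S.p₁ y
    rw [Metric.mem_closedBall] at h1
    linarith
  · have := S.dist_p₂ a ha
    have := dist_triangle_left a S.p₂ y
    rw [Metric.mem_closedBall] at h1
    linarith

/-- The separation constants of the scheme serve this purpose: within distance 2s of a centre
neither the core nor any other child is met. -/
theorem step_eq_of_dist_le (hw : IsProfile C w) {a y : Space d} (ha : a ∈ S.F)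
    (h : dist y a ≤ 2 * S.s) : S.step w y = S.lam * w (dilation a S.s y) := by
  rw [step, Set.indicator_of_notMem (notMem_core ha h), zero_add,
    Finset.sum_eq_single_of_mem a ha]
  intro b hb hba
  refine hw.comp_dilation_eq_zero S.s_pos ?_
  have h1 := S.separated b hb a ha hba
  have h2 := dist_triangle_left b a y
  linarith [S.s_pos]

theorem lt_dist_of_mem_core {x y : Space d} (hx : x ∈ S.core) (h : dist y x ≤ 2 * S.s)
    {a : Space d} (ha : a ∈ S.F) : S.s < dist y a := by
  have hs := S.s_pos
  have h3 := dist_triangle_left a x y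
  rcases hx with h1 | h1
  · have := S.dist_p₁ a ha
    have := dist_triangle a x S.p₁
    rw [Metric.mem_closedBall] at h1
    linarith
  · have := S.dist_p₂ a ha
    have := dist_triangle a x S.p₂
    rw [Metric.mem_closedBall] at h1
    linarith

theorem step_eq_of_core (hw : IsProfile C w) {x y : Space d} (hx : x ∈ S.core)
    (h : dist y x ≤ 2 * S.s) : S.step w y = S.core.indicator 1 y := by
  rw [step, Finset.sum_eq_zero, mul_zero, add_zero]
  exact fun a ha => hw.comp_dilation_eq_zero S.s_pos (lt_dist_of_mem_core hx h ha)

theorem step_eq_one (hw : IsProfile C w) {x : Space d} (hx : x ∈ S.core) : S.step w x = 1 := by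
  rw [step_eq_of_core hw hx (by simpa using S.s_pos.le), Set.indicator_of_mem hx, Pi.one_apply]

theorem exists_of_step_ne_zero (hw : IsProfile C w) {x : Space d} (h : S.step w x ≠ 0) :
    x ∈ S.core ∨ ∃ a ∈ S.F, dist x a ≤ S.s ∧ w (dilation a S.s x) ≠ 0 := by
  by_contra! hcon
  apply h
  rw [step, Set.indicator_of_notMem hcon.1, zero_add, Finset.sum_eq_zero, mul_zero]
  intro a ha
  by_contra h0
  refine h0 (hw.comp_dilation_eq_zero S.s_pos ?_)
  by_contra hle
  exact h0 (hcon.2 a ha (not_lt.1 hle))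

theorem measurable_step (hw : IsProfile C w) : Measurable (S.step w) := by
  refine (measurable_one.indicator S.measurableSet_core).add (measurable_const.mul ?_)
  exact Finset.measurable_sum _ fun a _ =>
    hw.measurable.comp (measurableEmbedding_dilation a S.s_pos).measurable

theorem rest_nonneg (hw : IsProfile C w) {a : Space d} (ha : a ∈ S.F) (x : Space d) :
    0 ≤ S.rest w a x := by
  rw [rest, step]
  have h1 : 0 ≤ S.core.indicator (1 : Space d → ℝ) x :=
    Set.indicator_nonneg (fun _ _ => zero_le_one) x
  have h2 := Finset.single_le_sum (f := fun a => w (dilation a S.s x))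
    (fun a _ => hw.nonneg (dilation a S.s x)) ha
  have := mul_le_mul_of_nonneg_left h2 S.lam_pos.le
  linarith

theorem step_nonneg (hw : IsProfile C w) (x : Space d) : 0 ≤ S.step w x :=
  add_nonneg (Set.indicator_nonneg (fun _ _ => zero_le_one) x)
    (mul_nonneg S.lam_pos.le (Finset.sum_nonneg fun _ _ => hw.nonneg _))

theorem ofReal_step (hw : IsProfile C w) (x : Space d) :
    ENNReal.ofReal (S.step w x) = S.core.indicator 1 x +
      ENNReal.ofReal S.lam * ∑ a ∈ S.F, ENNReal.ofReal (w (dilation a S.s x)) := by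
  have h1 : 0 ≤ S.core.indicator (1 : Space d → ℝ) x :=
    Set.indicator_nonneg (fun _ _ => zero_le_one) x
  rw [step, ENNReal.ofReal_add h1
    (mul_nonneg S.lam_pos.le (Finset.sum_nonneg fun _ _ => hw.nonneg _)),
    ENNReal.ofReal_mul S.lam_pos.le, ENNReal.ofReal_sum_of_nonneg fun _ _ => hw.nonneg _]
  congr 1
  by_cases hx : x ∈ S.core <;> simp [hx]

theorem lintegral_comp (hw : IsProfile C w) (a : Space d) :
    ∫⁻ y, ENNReal.ofReal (w (dilation a S.s y)) = ENNReal.ofReal S.s ^ d * unitVol d := by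
  rw [lintegral_comp_dilation a S.s_pos (fun y => ENNReal.ofReal (w y)), hw.lintegral_eq]

/-- At scales above s a child counts only through its mass, which before the factor `lam` is the
volume of its ball. The children that meet the ball of radius R are disjoint and lie in the ball of
radius 3R; the core has density one, which is at most `lam`. -/
theorem lintegral_step_closedBall_le (hw : IsProfile C w) (c : Space d) {R : ℝ} (hR : S.s ≤ R) :
    ∫⁻ y in Metric.closedBall c R, ENNReal.ofReal (S.step w y) ≤
      ENNReal.ofReal S.lam * (1 + 3 ^ d) * unitVol d * ENNReal.ofReal R ^ d := by
  have hs := S.s_pos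
  have hR0 : 0 < R := hs.trans_le hR
  simp only [ofReal_step hw]
  have hm : Measurable fun y => S.core.indicator (1 : Space d → ℝ≥0∞) y :=
    measurable_one.indicator S.measurableSet_core
  have hwm : ∀ a ∈ S.F, Measurable fun y => ENNReal.ofReal (w (dilation a S.s y)) := fun a _ =>
    (hw.measurable.comp (measurableEmbedding_dilation a S.s_pos).measurable).ennreal_ofReal
  rw [lintegral_add_left hm, lintegral_const_mul _ (Finset.measurable_sum _ hwm),
    lintegral_finsetSum _ hwm]
  have h1 : ∫⁻ y in Metric.closedBall c R, S.core.indicator (1 : Space d → ℝ≥0∞) y ≤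
      ENNReal.ofReal R ^ d * unitVol d := by
    rw [← volume_closedBall_eq c hR0.le, ← setLIntegral_one]
    exact lintegral_mono fun y => Set.indicator_le_self' (fun _ _ => zero_le_one) y
  have h2 : ∑ a ∈ S.F, ∫⁻ y in Metric.closedBall c R, ENNReal.ofReal (w (dilation a S.s y)) ≤
      3 ^ d * (ENNReal.ofReal R ^ d * unitVol d) := by
    classical
    calc _ ≤ ∑ a ∈ S.F, if dist a c ≤ R + S.s then volume (Metric.closedBall a S.s) else 0 := by
          refine Finset.sum_le_sum fun a ha => ?_
          split_ifs with h
          · rw [volume_closedBall_eq a hs.le, ← lintegral_comp hw a]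
            exact lintegral_mono' Measure.restrict_le_self le_rfl
          · rw [nonpos_iff_eq_zero, setLIntegral_eq_zero_iff
              Metric.isClosed_closedBall.measurableSet (hwm a ha)]
            refine Eventually.of_forall fun y hy => ?_
            rw [hw.comp_dilation_eq_zero hs, ENNReal.ofReal_zero]
            have := dist_triangle_left a c y
            rw [Metric.mem_closedBall] at hy
            linarith
      _ = volume (⋃ a ∈ S.F.filter fun a => dist a c ≤ R + S.s, Metric.closedBall a S.s) := by
          rw [← Finset.sum_filter, measure_biUnion_finset]
          · intro a ha b hb hab
            refine Metric.closedBall_disjoint_closedBall ?_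
            have := S.separated a (Finset.mem_filter.1 ha).1 b (Finset.mem_filter.1 hb).1 hab
            linarith
          · exact fun a _ => Metric.isClosed_closedBall.measurableSet
      _ ≤ volume (Metric.closedBall c (3 * R)) := by
          refine measure_mono (Set.iUnion₂_subset fun a ha => ?_)
          refine Metric.closedBall_subset_closedBall' ?_
          linarith [(Finset.mem_filter.1 ha).2]
      _ = _ := by
          rw [volume_closedBall_eq _ (by positivity), ENNReal.ofReal_mul (by norm_num), mul_pow,
            mul_assoc]
          simp
  calc _ ≤ ENNReal.ofReal R ^ d * unitVol d +
        ENNReal.ofReal S.lam * (3 ^ d * (ENNReal.ofReal R ^ d * unitVol d)) := by gcongr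
    _ ≤ ENNReal.ofReal S.lam * (ENNReal.ofReal R ^ d * unitVol d) +
        ENNReal.ofReal S.lam * (3 ^ d * (ENNReal.ofReal R ^ d * unitVol d)) := by
        refine add_le_add_left ?_ _
        exact le_mul_of_one_le_left' (by simpa using S.one_le_lam : 1 ≤ ENNReal.ofReal S.lam)
    _ = _ := by ring

theorem lintegral_step (hw : IsProfile C w) :
    ∫⁻ y, ENNReal.ofReal (S.step w y) = unitVol d := by
  have hs := S.s_pos
  have hr := S.r_pos
  simp only [ofReal_step hw]
  have hm : Measurable fun y => S.core.indicator (1 : Space d → ℝ≥0∞) y :=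
    measurable_one.indicator S.measurableSet_core
  have hwm : ∀ a ∈ S.F, Measurable fun y => ENNReal.ofReal (w (dilation a S.s y)) := fun a _ =>
    (hw.measurable.comp (measurableEmbedding_dilation a S.s_pos).measurable).ennreal_ofReal
  rw [lintegral_add_left hm, lintegral_const_mul _ (Finset.measurable_sum _ hwm),
    lintegral_finsetSum _ hwm]
  simp only [lintegral_comp hw]
  rw [lintegral_indicator_one S.measurableSet_core, core,
    measure_union disjoint_core Metric.isClosed_closedBall.measurableSet,
    volume_closedBall_eq _ hr.le, volume_closedBall_eq _ hr.le, Finset.sum_const, nsmul_eq_mul]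
  have h := congrArg ENNReal.ofReal S.mass
  have hl := S.lam_pos
  rw [ENNReal.ofReal_add (by positivity) (by positivity), ENNReal.ofReal_mul (by positivity),
    ENNReal.ofReal_mul (by positivity), ENNReal.ofReal_mul (by positivity),
    ENNReal.ofReal_pow hr.le, ENNReal.ofReal_pow hs.le, ENNReal.ofReal_natCast,
    ENNReal.ofReal_one, ENNReal.ofReal_ofNat] at h
  calc _ = (2 * ENNReal.ofReal S.r ^ d + ENNReal.ofReal S.lam * ENNReal.ofReal S.s ^ d * S.F.card)
        * unitVol d := by ring
    _ = _ := by rw [h, one_mul]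

/-- The point is that the A₁ constant does not grow. For R ≥ s the previous growth bound suffices,
because the weight is at least 1 on its support. For R < s the ball sees either the core alone or a
single child, and a child inherits the constant of `w` by scaling. -/
theorem isProfile_step (hw : IsProfile C w)
    (hC : ENNReal.ofReal S.lam * (1 + 3 ^ d) * unitVol d ≤ C) : IsProfile C (S.step w) := by
  have hs := S.s_pos
  have hl := S.one_le_lam
  have hl' : 1 ≤ ENNReal.ofReal S.lam := by simpa using hl
  refine ⟨measurable_step hw, step_nonneg hw, ?_, ?_, lintegral_step hw, ?_, ?_, ?_⟩
  · intro x hx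
    rcases exists_of_step_ne_zero hw hx with h | ⟨a, ha, hxa, h0⟩
    · rw [step_eq_one hw h]
    · rw [step_eq_of_dist_le hw ha (by linarith)]
      nlinarith [hw.one_le _ h0]
  · intro x hx
    rcases exists_of_step_ne_zero hw hx with h | ⟨a, ha, hxa, h0⟩
    · rcases h with h | h
      · rw [mem_closedBall_iff_norm] at h
        linarith [S.norm_p₁, norm_le_insert' x S.p₁]
      · rw [mem_closedBall_iff_norm] at h
        linarith [S.norm_p₂, norm_le_insert' x S.p₂]
    · rw [dist_eq_norm] at hxa
      linarith [S.norm_F a ha, norm_le_insert' x a]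
  · obtain ⟨H, hH⟩ := hw.bounded
    refine ⟨1 + S.lam * ∑ a ∈ S.F, H, fun x => ?_⟩
    rw [step]
    have h1 : S.core.indicator (1 : Space d → ℝ) x ≤ 1 :=
      Set.indicator_le_self' (fun _ _ => zero_le_one) x
    gcongr
    exact hH _
  · refine AELocallyConst.add ?_ (AELocallyConst.const_mul (AELocallyConst.sum fun a _ =>
      hw.aeLocallyConst.comp_dilation a hs) _)
    rw [core, Set.indicator_union_of_disjoint disjoint_core]
    exact (aeLocallyConst_indicator_closedBall _ S.r_pos).add
      (aeLocallyConst_indicator_closedBall _ S.r_pos)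
  · intro x hx R hR
    have hx' : S.step w x ≠ 0 := fun h => hx (by simp only [h, ENNReal.ofReal_zero])
    beta_reduce
    rcases le_or_gt S.s R with hsR | hsR
    · refine (lintegral_step_closedBall_le hw x hsR).trans ?_
      refine mul_le_mul_left ?_ _
      refine hC.trans (le_mul_of_one_le_right' ?_)
      rw [ENNReal.one_le_ofReal]
      rcases exists_of_step_ne_zero hw hx' with h | ⟨a, ha, hxa, h0⟩
      · rw [step_eq_one hw h]
      · rw [step_eq_of_dist_le hw ha (by linarith)]
        nlinarith [hw.one_le _ h0]
    · rcases exists_of_step_ne_zero hw hx' with h | ⟨a, ha, hxa, h0⟩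
      · rw [step_eq_one hw h, ENNReal.ofReal_one, mul_one]
        calc _ ≤ ∫⁻ y in Metric.closedBall x R, 1 := by
              refine setLIntegral_mono measurable_const fun y hy => ?_
              rw [Metric.mem_closedBall] at hy
              rw [step_eq_of_core hw h (by linarith), ← ENNReal.ofReal_one]
              exact ENNReal.ofReal_le_ofReal (Set.indicator_le_self' (fun _ _ => zero_le_one) y)
          _ = unitVol d * ENNReal.ofReal R ^ d := by
              rw [setLIntegral_one, volume_closedBall_eq _ hR.le, mul_comm]
          _ ≤ _ := by
              gcongr
              refine le_trans ?_ hC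
              refine le_mul_of_one_le_left' ?_
              exact one_le_mul hl' le_self_add
      · rw [step_eq_of_dist_le hw ha (by linarith), ENNReal.ofReal_mul S.lam_pos.le]
        have hA := hw.localA1 (dilation a S.s x)
          (by simpa using (hw.nonneg _).lt_of_ne' h0) (R / S.s) (by positivity)
        have hset : ∀ y, y ∈ Metric.closedBall x R ↔
            dilation a S.s y ∈ Metric.closedBall (dilation a S.s x) (R / S.s) := by
          intro y
          rw [mem_closedBall_iff_norm, mem_closedBall_iff_norm, dilation, dilation, ← smul_sub,
            sub_sub_sub_cancel_right, norm_smul, norm_inv, Real.norm_eq_abs, abs_of_pos hs,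
            le_div_iff₀ hs]
          field_simp
        calc _ = ∫⁻ y in Metric.closedBall x R,
              ENNReal.ofReal S.lam * ENNReal.ofReal (w (dilation a S.s y)) := by
              refine setLIntegral_congr_fun Metric.isClosed_closedBall.measurableSet fun y hy => ?_
              rw [Metric.mem_closedBall] at hy
              have := dist_triangle y x a
              rw [step_eq_of_dist_le hw ha (by linarith), ENNReal.ofReal_mul S.lam_pos.le]
          _ = ENNReal.ofReal S.lam * ∫⁻ y,
              (Metric.closedBall (dilation a S.s x) (R / S.s)).indicator
                (fun y => ENNReal.ofReal (w y)) (dilation a S.s y) := by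
              rw [lintegral_const_mul' _ _ ENNReal.ofReal_ne_top,
                ← lintegral_indicator Metric.isClosed_closedBall.measurableSet]
              congr 1
              refine lintegral_congr fun y => ?_
              by_cases hy : y ∈ Metric.closedBall x R
              · rw [Set.indicator_of_mem hy, Set.indicator_of_mem ((hset y).1 hy)]
              · rw [Set.indicator_of_notMem hy, Set.indicator_of_notMem (fun h => hy ((hset y).2 h))]
          _ = ENNReal.ofReal S.lam * (ENNReal.ofReal S.s ^ d *
              ∫⁻ y in Metric.closedBall (dilation a S.s x) (R / S.s), ENNReal.ofReal (w y)) := by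
              rw [lintegral_comp_dilation a hs, lintegral_indicator
                Metric.isClosed_closedBall.measurableSet]
          _ ≤ ENNReal.ofReal S.lam * (ENNReal.ofReal S.s ^ d *
              (C * ENNReal.ofReal (w (dilation a S.s x)) * ENNReal.ofReal (R / S.s) ^ d)) := by
              gcongr
          _ = C * (ENNReal.ofReal S.lam * ENNReal.ofReal (w (dilation a S.s x))) *
              (ENNReal.ofReal S.s * ENNReal.ofReal (R / S.s)) ^ d := by rw [mul_pow]; ring
          _ = _ := by
              rw [← ENNReal.ofReal_mul hs.le, mul_div_cancel₀ _ hs.ne']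

end Scheme

end

section

/-! ### The lower bound for the singular integral -/

variable {d : ℕ} {Ω : Space d → ℝ}

/-- The principal value of `Tf(x)`. -/
noncomputable def czValue (Ω : Space d → ℝ) (f : Space d → ℝ) (x : Space d) : ℝ :=
  limUnder (𝓝[>] 0) fun ε : ℝ => ∫ y in {y | ε < ‖x - y‖}, czKernel Ω x y * f y

theorem HasCZValue.czValue_eq {f : Space d → ℝ} {x : Space d} {t : ℝ} (h : HasCZValue Ω f x t) :
    czValue Ω f x = t :=
  h.2.limUnder_eq

theorem IsCZSymbol.exists_hasCZValue (hd : d ≠ 0) (hΩ : IsCZSymbol Ω) {f : Space d → ℝ}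
    (hf : Integrable f) {x : Space d} (h : ∃ c, ∀ᶠ y in 𝓝 x, f y = c) :
    HasCZValue Ω f x (czValue Ω f x) := by
  obtain ⟨c, hc⟩ := h
  obtain ⟨r, hr, hball⟩ := Metric.eventually_nhds_iff_ball.1 hc
  have h1 := hΩ.hasCZValue_of_eq_const hd hf (x := x) (r := r / 2) (c := c) (by positivity)
    fun y hy => hball y (by
      rw [mem_ball_iff_norm, norm_sub_rev]
      linarith)
  rwa [h1.czValue_eq]

/-- The `p`-th power of the norm of `Tw + g` in the dual weighted space. -/
noncomputable def dualEnergy (Ω : Space d → ℝ) (p : ℝ) (w g : Space d → ℝ) : ℝ≥0∞ :=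
  ∫⁻ x, ‖czValue Ω w x + g x‖ₑ ^ p * weightPow (fun x => ENNReal.ofReal (w x)) (1 - p) x

namespace Scheme

/-! ### Growth of the energy under one step and under iteration -/

variable {S : Scheme d} {C : ℝ≥0∞} {w : Space d → ℝ}

theorem rest_eq_zero (hw : IsProfile C w) {a y : Space d} (ha : a ∈ S.F)
    (h : dist y a ≤ 2 * S.s) : S.rest w a y = 0 := by
  rw [rest, step_eq_of_dist_le hw ha h, sub_self]

theorem rest_le_step (hw : IsProfile C w) (a y : Space d) : S.rest w a y ≤ S.step w y :=
  sub_le_self _ (mul_nonneg S.lam_pos.le (hw.nonneg _))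

theorem integrable_step (hw : IsProfile C w) : Integrable (S.step w) := by
  refine ⟨(measurable_step hw).aestronglyMeasurable, ?_⟩
  rw [hasFiniteIntegral_iff_ofReal (Eventually.of_forall (step_nonneg hw)), lintegral_step hw]
  exact unitVol_ne_top.lt_top

theorem measurable_rest (hw : IsProfile C w) (a : Space d) : Measurable (S.rest w a) :=
  (measurable_step hw).sub
    ((hw.measurable.comp (measurableEmbedding_dilation a S.s_pos).measurable).const_mul _)

theorem integrable_rest (hw : IsProfile C w) (a : Space d) : Integrable (S.rest w a) :=
  (integrable_step hw).sub ((integrable_comp_dilation a S.s_pos hw.integrable).const_mul _)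

/-- The child's own part is a rescaled copy of T applied to `w`; the rest vanishes near x, so its
integral converges absolutely. -/
theorem czValue_step (hd : d ≠ 0) (hΩ : IsCZSymbol Ω) (hw : IsProfile C w) {a x : Space d}
    (ha : a ∈ S.F) (hx : dist x a ≤ S.s)
    (h : ∃ c, ∀ᶠ y in 𝓝 (dilation a S.s x), w y = c) :
    czValue Ω (S.step w) x = S.lam * czValue Ω w (dilation a S.s x) +
      ∫ y, czKernel Ω x y * S.rest w a y := by
  have hs := S.s_pos
  have h1 := (hΩ.exists_hasCZValue hd hw.integrable h).comp_dilation hd hΩ a hs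
  rw [add_smul_dilation a hs] at h1
  have h2 := hΩ.hasCZValue_of_eq_zero hd (integrable_rest hw a) (x := x) hs fun y hy =>
    rest_eq_zero hw ha (by
      have := dist_triangle_left y a x
      rw [← dist_eq_norm] at hy
      linarith)
  have h3 := (h1.const_mul S.lam).add h2
  have h4 : (fun y => S.lam * w (dilation a S.s y) + S.rest w a y) = S.step w := by
    funext y
    rw [rest]
    ring
  rw [h4] at h3
  exact h3.czValue_eq

/-- The rest vanishes within 2s of the centre and has growth constant of order `lam` at larger
scales, hence the bound `lam` / s. The constant L is the same for all schemes and profiles, so κ can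
be chosen after it. -/
theorem exists_lipschitz_rest (hd : d ≠ 0) (hΩ : IsCZSymbol Ω) :
    ∃ L : ℝ, 0 < L ∧ ∀ (S : Scheme d) (C : ℝ≥0∞) (w : Space d → ℝ), IsProfile C w → ∀ a ∈ S.F,
      ∀ x ∈ Metric.closedBall a S.s, ∀ x' ∈ Metric.closedBall a S.s,
        |(∫ y, czKernel Ω x y * S.rest w a y) - ∫ y, czKernel Ω x' y * S.rest w a y| ≤
          L * (S.lam / S.s) * ‖x - x'‖ := by
  obtain ⟨K, hK0, hK⟩ := hΩ.exists_lipschitz_integral hd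
  set G : ℝ := (1 + 3 ^ d) * (unitVol d).toReal with hG
  have hG0 : 0 ≤ G := by positivity
  refine ⟨K * G + 1, by positivity, fun S C w hw a ha x hx x' hx' => ?_⟩
  have hs := S.s_pos
  have hl := S.lam_pos
  refine (hK (S.rest w a) a (S.lam * G) (2 * S.s) S.s (measurable_rest hw a) (rest_nonneg hw ha)
    (integrable_rest hw a) (by positivity) hs le_rfl ?_ ?_ x hx x' hx').trans ?_
  · intro y hy
    rw [← dist_eq_norm] at hy
    exact rest_eq_zero hw ha hy.le
  · intro R hR
    calc _ ≤ ∫⁻ y in Metric.closedBall a R, ENNReal.ofReal (S.step w y) :=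
          lintegral_mono fun y => ENNReal.ofReal_le_ofReal (rest_le_step hw a y)
      _ ≤ _ := lintegral_step_closedBall_le hw a (by linarith)
      _ = _ := by
          have hR0 : 0 ≤ R := by linarith
          rw [ENNReal.ofReal_mul (by positivity), ENNReal.ofReal_mul hl.le, hG,
            ENNReal.ofReal_mul (by positivity), ENNReal.ofReal_toReal unitVol_ne_top,
            ENNReal.ofReal_add (by norm_num) (by positivity), ENNReal.ofReal_pow (by norm_num),
            ENNReal.ofReal_pow hR0]
          simp [mul_assoc]
  · have h1 : S.lam * G / (2 * S.s) ≤ G * (S.lam / S.s) := by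
      rw [mul_comm S.lam, mul_div_assoc]
      gcongr
      linarith
    calc _ ≤ K * (G * (S.lam / S.s)) * ‖x - x'‖ := by gcongr
      _ ≤ _ := by
          rw [← mul_assoc]
          gcongr
          linarith

/-- The singular integral is at least `2κ` in size, with opposite signs, on the two halved balls of
the core. -/
def IsLarge (S : Scheme d) (Ω : Space d → ℝ) (κ : ℝ) : Prop :=
  ∀ (C : ℝ≥0∞) (w : Space d → ℝ), IsProfile C w →
    (∀ x ∈ Metric.closedBall S.p₁ (S.r / 2), 2 * κ ≤ czValue Ω (S.step w) x) ∧
    (∀ x ∈ Metric.closedBall S.p₂ (S.r / 2), czValue Ω (S.step w) x ≤ -(2 * κ))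

/-- This is why the core has two balls. If g ≥ -κ on the first half ball, the sum is at least κ
there. Otherwise g < -κ at some point, so g < 0 on the second half ball by the oscillation bound,
and the sum stays below -2κ there. The weight is 1 on the core. -/
theorem lintegral_core_ge {p κ : ℝ} (hp : 0 ≤ p) (hκ : 0 ≤ κ) (hw : IsProfile C w)
    (hS : S.IsLarge Ω κ) {g : Space d → ℝ}
    (hg : ∀ x ∈ Metric.closedBall (0 : Space d) 1, ∀ y ∈ Metric.closedBall (0 : Space d) 1,
      |g x - g y| ≤ κ) :
    ENNReal.ofReal κ ^ p * (ENNReal.ofReal (S.r / 2) ^ d * unitVol d) ≤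
      ∫⁻ x in S.core, ‖czValue Ω (S.step w) x + g x‖ₑ ^ p *
        weightPow (fun x => ENNReal.ofReal (S.step w x)) (1 - p) x := by
  have hr := S.r_pos
  have hsub : ∀ p : Space d, Metric.closedBall p (S.r / 2) ⊆ Metric.closedBall p S.r := fun p =>
    Metric.closedBall_subset_closedBall (by linarith)
  have key : ∀ q : Space d, Metric.closedBall q (S.r / 2) ⊆ S.core →
      (∀ x ∈ Metric.closedBall q (S.r / 2), κ ≤ |czValue Ω (S.step w) x + g x|) →
      ENNReal.ofReal κ ^ p * (ENNReal.ofReal (S.r / 2) ^ d * unitVol d) ≤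
      ∫⁻ x in S.core, ‖czValue Ω (S.step w) x + g x‖ₑ ^ p *
        weightPow (fun x => ENNReal.ofReal (S.step w x)) (1 - p) x := by
    intro q hq hlow
    rw [← volume_closedBall_eq q (by positivity), ← setLIntegral_const]
    refine le_trans ?_ (lintegral_mono_set hq)
    refine setLIntegral_mono' Metric.isClosed_closedBall.measurableSet fun x hx => ?_
    have h1 : weightPow (fun x => ENNReal.ofReal (S.step w x)) (1 - p) x = 1 := by
      simp [weightPow, step_eq_one hw (hq hx)]
    rw [h1, mul_one, ← ofReal_norm]
    exact ENNReal.rpow_le_rpow (ENNReal.ofReal_le_ofReal (hlow x hx)) hp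
  have hin₁ : ∀ x ∈ Metric.closedBall S.p₁ (S.r / 2), x ∈ Metric.closedBall (0 : Space d) 1 := by
    refine fun x hx => Metric.closedBall_subset_closedBall' ?_ (hsub _ hx)
    rw [dist_zero_right]
    linarith [S.norm_p₁]
  have hin₂ : ∀ x ∈ Metric.closedBall S.p₂ (S.r / 2), x ∈ Metric.closedBall (0 : Space d) 1 := by
    refine fun x hx => Metric.closedBall_subset_closedBall' ?_ (hsub _ hx)
    rw [dist_zero_right]
    linarith [S.norm_p₂]
  obtain ⟨hS₁, hS₂⟩ := hS C w hw
  by_cases hcase : ∀ x ∈ Metric.closedBall S.p₁ (S.r / 2), -κ ≤ g x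
  · refine key S.p₁ ((hsub _).trans Set.subset_union_left) fun x hx => ?_
    refine le_trans ?_ (le_abs_self _)
    linarith [hS₁ x hx, hcase x hx]
  · push Not at hcase
    obtain ⟨x₀, hx₀, hlt⟩ := hcase
    refine key S.p₂ ((hsub _).trans Set.subset_union_right) fun x hx => ?_
    refine le_trans ?_ (neg_le_abs _)
    have := (abs_le.1 (hg x (hin₂ x hx) x₀ (hin₁ x₀ hx₀))).2
    linarith [hS₂ x hx]

/-- Homogeneity: the function contributes `lam`^p, the weight `lam`^(1-p) and the change of
variables s^d, and the product is exactly the child's share of the mass. -/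
theorem lintegral_child (hd : d ≠ 0) (hΩ : IsCZSymbol Ω) {p : ℝ} (hp : 0 < p)
    (hw : IsProfile C w) {a : Space d} (ha : a ∈ S.F) (g : Space d → ℝ) :
    ∫⁻ x in Metric.closedBall a S.s, ‖czValue Ω (S.step w) x + g x‖ₑ ^ p *
        weightPow (fun x => ENNReal.ofReal (S.step w x)) (1 - p) x =
      ENNReal.ofReal (S.lam * S.s ^ d) * dualEnergy Ω p w fun x =>
        S.lam⁻¹ * (g (a + S.s • x) + ∫ y, czKernel Ω (a + S.s • x) y * S.rest w a y) := by
  have hs := S.s_pos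
  have hl := S.lam_pos
  set g' : Space d → ℝ := fun x =>
    S.lam⁻¹ * (g (a + S.s • x) + ∫ y, czKernel Ω (a + S.s • x) y * S.rest w a y) with hg'
  set H : Space d → ℝ≥0∞ := fun x =>
    ‖czValue Ω w x + g' x‖ₑ ^ p * weightPow (fun x => ENNReal.ofReal (w x)) (1 - p) x with hH
  have hH0 : ∀ x, ¬ dist x a ≤ S.s → H (dilation a S.s x) = 0 := by
    intro x hx
    simp [hH, weightPow, hw.comp_dilation_eq_zero hs (not_le.1 hx)]
  have hmain : ∀ᵐ x, (Metric.closedBall a S.s).indicator (fun x =>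
      ‖czValue Ω (S.step w) x + g x‖ₑ ^ p *
        weightPow (fun x => ENNReal.ofReal (S.step w x)) (1 - p) x) x =
      ENNReal.ofReal S.lam * H (dilation a S.s x) := by
    filter_upwards [ae_dilation hw.aeLocallyConst a hs] with x hx
    by_cases hxa : dist x a ≤ S.s
    · rw [Set.indicator_of_mem (by exact hxa), czValue_step hd hΩ hw ha hxa hx]
      have e1 : S.lam * czValue Ω w (dilation a S.s x) + (∫ y, czKernel Ω x y * S.rest w a y) +
          g x = S.lam * (czValue Ω w (dilation a S.s x) + g' (dilation a S.s x)) := by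
        simp only [hg', add_smul_dilation a hs]
        field_simp
        ring
      rw [e1, enorm_mul, ENNReal.mul_rpow_of_nonneg _ _ hp.le, Real.enorm_of_nonneg hl.le]
      simp only [hH, weightPow]
      rw [step_eq_of_dist_le hw ha (by linarith), ENNReal.ofReal_mul hl.le]
      have hl0 : ENNReal.ofReal S.lam ≠ 0 := by simpa using hl
      by_cases h0 : ENNReal.ofReal (w (dilation a S.s x)) = 0
      · simp [h0]
      · rw [if_neg (mul_ne_zero hl0 h0), if_neg h0,
          ENNReal.mul_rpow_of_ne_top ENNReal.ofReal_ne_top ENNReal.ofReal_ne_top]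
        have e2 : ENNReal.ofReal S.lam ^ p * ENNReal.ofReal S.lam ^ (1 - p) =
            ENNReal.ofReal S.lam := by
          rw [← ENNReal.rpow_add _ _ hl0 ENNReal.ofReal_ne_top, add_sub_cancel, ENNReal.rpow_one]
        rw [mul_mul_mul_comm, e2]
    · rw [Set.indicator_of_notMem (by exact hxa), hH0 x hxa, mul_zero]
  rw [← lintegral_indicator Metric.isClosed_closedBall.measurableSet, lintegral_congr_ae hmain,
    lintegral_const_mul' _ _ ENNReal.ofReal_ne_top, lintegral_comp_dilation a hs,
    ENNReal.ofReal_mul hl.le, ENNReal.ofReal_pow hs.le, mul_assoc]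
  rfl

/-- The class of perturbations with Lipschitz constant 2L is preserved. On a child, the rescaled `g`
has constant at most 2L s / `lam` ≤ L, since s ≤ 1/2 and `lam` ≥ 1, and the rescaled interaction
with the rest contributes another L. On the core, `g` oscillates by at most 4L ≤ κ. -/
theorem le_dualEnergy_step (hd : d ≠ 0) (hΩ : IsCZSymbol Ω) {L : ℝ}
    (hL : ∀ (C : ℝ≥0∞) (w : Space d → ℝ), IsProfile C w → ∀ a ∈ S.F,
      ∀ x ∈ Metric.closedBall a S.s, ∀ x' ∈ Metric.closedBall a S.s,
        |(∫ y, czKernel Ω x y * S.rest w a y) - ∫ y, czKernel Ω x' y * S.rest w a y| ≤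
          L * (S.lam / S.s) * ‖x - x'‖)
    {p κ : ℝ} (hp : 0 < p) (hL0 : 0 ≤ L) (hκ : 4 * L ≤ κ) (hs2 : S.s ≤ 1 / 2) (hw : IsProfile C w)
    (hS : S.IsLarge Ω κ) {E : ℝ≥0∞}
    (hE : ∀ g : Space d → ℝ, (∀ x ∈ Metric.closedBall (0 : Space d) 1,
      ∀ y ∈ Metric.closedBall (0 : Space d) 1, |g x - g y| ≤ 2 * L * ‖x - y‖) →
        E ≤ dualEnergy Ω p w g)
    {g : Space d → ℝ} (hg : ∀ x ∈ Metric.closedBall (0 : Space d) 1,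
      ∀ y ∈ Metric.closedBall (0 : Space d) 1, |g x - g y| ≤ 2 * L * ‖x - y‖) :
    ENNReal.ofReal κ ^ p * (ENNReal.ofReal (S.r / 2) ^ d * unitVol d) +
      ENNReal.ofReal (1 - 2 * S.r ^ d) * E ≤ dualEnergy Ω p (S.step w) g := by
  have hs := S.s_pos
  have hl := S.lam_pos
  have hl1 := S.one_le_lam
  set I : Space d → ℝ≥0∞ := fun x => ‖czValue Ω (S.step w) x + g x‖ₑ ^ p *
    weightPow (fun x => ENNReal.ofReal (S.step w x)) (1 - p) x
  have hdisj : Disjoint S.core (⋃ a ∈ S.F, Metric.closedBall a S.s) := by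
    rw [Set.disjoint_iUnion₂_right]
    refine fun a ha => Set.disjoint_right.2 fun y hy => notMem_core ha ?_
    rw [Metric.mem_closedBall] at hy
    linarith
  have hpw : Set.PairwiseDisjoint (S.F : Set (Space d)) fun a => Metric.closedBall a S.s := by
    intro a ha b hb hab
    refine Metric.closedBall_disjoint_closedBall ?_
    have := S.separated a ha b hb hab
    linarith
  have hcore := lintegral_core_ge (g := g) hp.le (by linarith) hw hS fun x hx y hy => by
    refine (hg x hx y hy).trans ?_
    have : ‖x - y‖ ≤ 2 := by
      rw [mem_closedBall_zero_iff] at hx hy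
      exact (norm_sub_le x y).trans (by linarith)
    nlinarith
  have hchild : ∀ a ∈ S.F, ENNReal.ofReal (S.lam * S.s ^ d) * E ≤
      ∫⁻ x in Metric.closedBall a S.s, I x := by
    intro a ha
    rw [lintegral_child hd hΩ hp hw ha g]
    refine mul_le_mul_right (hE _ fun x hx y hy => ?_) _
    have hmem : ∀ x ∈ Metric.closedBall (0 : Space d) 1,
        a + S.s • x ∈ Metric.closedBall a S.s := by
      intro x hx
      rw [mem_closedBall_zero_iff] at hx
      rw [mem_closedBall_iff_norm, add_sub_cancel_left, norm_smul, Real.norm_eq_abs, abs_of_pos hs]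
      nlinarith
    have hmem' : ∀ x ∈ Metric.closedBall (0 : Space d) 1,
        a + S.s • x ∈ Metric.closedBall (0 : Space d) 1 := by
      refine fun x hx => Metric.closedBall_subset_closedBall' ?_ (hmem x hx)
      rw [dist_zero_right]
      linarith [S.norm_F a ha]
    have h1 := hg _ (hmem' x hx) _ (hmem' y hy)
    have h2 := hL C w hw a ha _ (hmem x hx) _ (hmem y hy)
    have h3 : ‖a + S.s • x - (a + S.s • y)‖ = S.s * ‖x - y‖ := by
      rw [add_sub_add_left_eq_sub, ← smul_sub, norm_smul, Real.norm_eq_abs, abs_of_pos hs]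
    rw [h3] at h1 h2
    rw [← mul_sub, abs_mul, abs_of_pos (inv_pos.2 hl), add_sub_add_comm]
    have h4 := (abs_add_le _ _).trans (add_le_add h1 h2)
    rw [inv_mul_le_iff₀ hl]
    refine h4.trans ?_
    have h5 : L * (S.lam / S.s) * (S.s * ‖x - y‖) = S.lam * (L * ‖x - y‖) := by
      field_simp
    have h6 : 0 ≤ L * ‖x - y‖ := by positivity
    rw [h5]
    nlinarith
  calc _ ≤ (∫⁻ x in S.core, I x) + ∑ a ∈ S.F, ∫⁻ x in Metric.closedBall a S.s, I x := by
        refine add_le_add hcore ?_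
        refine le_trans (le_of_eq ?_) (Finset.sum_le_sum hchild)
        -- By conservation of mass the children together carry the fraction 1 - 2r^d.
        rw [Finset.sum_const, nsmul_eq_mul, ← mul_assoc, ← ENNReal.ofReal_natCast,
          ← ENNReal.ofReal_mul (by positivity), ← S.mass]
        ring_nf
    _ = ∫⁻ x in S.core ∪ ⋃ a ∈ S.F, Metric.closedBall a S.s, I x := by
        rw [lintegral_union (Finset.measurableSet_biUnion _ fun a _ =>
          Metric.isClosed_closedBall.measurableSet) hdisj,
          lintegral_biUnion_finset hpw fun a _ => Metric.isClosed_closedBall.measurableSet]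
    _ ≤ _ := setLIntegral_le_lintegral _ _

/-- The iterated construction. -/
noncomputable def iter (S : Scheme d) : ℕ → Space d → ℝ
  | 0 => (Metric.closedBall (0 : Space d) 1).indicator 1
  | N + 1 => S.step (iter S N)

theorem isProfile_iter (hC : ENNReal.ofReal S.lam * (1 + 3 ^ d) * unitVol d ≤ C) (N : ℕ) :
    IsProfile C (S.iter N) := by
  induction N with
  | zero =>
    refine isProfile_indicator (le_trans ?_ hC)
    exact le_mul_of_one_le_left' (one_le_mul (by simpa using S.one_le_lam) le_self_add)
  | succ N ih => exact isProfile_step ih hC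

/-- Solves the recursion of `le_dualEnergy_step`. A step gains a multiple of (r/2)^d and loses the
fraction 2r^d of the old energy. These are comparable up to the factor 2·2^d, so the limit does not
depend on r, although r is tiny when κ is large. -/
theorem le_dualEnergy_iter (hd : d ≠ 0) (hΩ : IsCZSymbol Ω) {L : ℝ}
    (hL : ∀ (C : ℝ≥0∞) (w : Space d → ℝ), IsProfile C w → ∀ a ∈ S.F,
      ∀ x ∈ Metric.closedBall a S.s, ∀ x' ∈ Metric.closedBall a S.s,
        |(∫ y, czKernel Ω x y * S.rest w a y) - ∫ y, czKernel Ω x' y * S.rest w a y| ≤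
          L * (S.lam / S.s) * ‖x - x'‖)
    {p κ : ℝ} (hp : 0 < p) (hL0 : 0 ≤ L) (hκ : 4 * L ≤ κ) (hs2 : S.s ≤ 1 / 2)
    (hS : S.IsLarge Ω κ) (N : ℕ) {g : Space d → ℝ}
    (hg : ∀ x ∈ Metric.closedBall (0 : Space d) 1,
      ∀ y ∈ Metric.closedBall (0 : Space d) 1, |g x - g y| ≤ 2 * L * ‖x - y‖) :
    ENNReal.ofReal κ ^ p * (unitVol d * ENNReal.ofReal (2 * 2 ^ d)⁻¹) *
      ENNReal.ofReal (1 - (1 - 2 * S.r ^ d) ^ N) ≤ dualEnergy Ω p (S.iter N) g := by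
  have hr := S.r_pos
  have hm : 2 * S.r ^ d ≤ 1 := by
    have := S.mass
    have : 0 ≤ S.lam * S.s ^ d * S.F.card := by
      have := S.lam_pos; have := S.s_pos
      positivity
    linarith
  induction N generalizing g with
  | zero => simp
  | succ N ih =>
    refine le_trans ?_ (le_dualEnergy_step hd hΩ hL hp hL0 hκ hs2
      (isProfile_iter le_rfl N) hS (fun g hg => ih hg) hg)
    have hpow : (1 - 2 * S.r ^ d) ^ N ≤ 1 := pow_le_one₀ (by linarith) (by
      have : 0 ≤ 2 * S.r ^ d := by positivity
      linarith)
    have e : (1 : ℝ) - (1 - 2 * S.r ^ d) ^ (N + 1) =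
        2 * S.r ^ d + (1 - 2 * S.r ^ d) * (1 - (1 - 2 * S.r ^ d) ^ N) := by ring
    have e2 : ENNReal.ofReal (2 * 2 ^ d)⁻¹ * ENNReal.ofReal (2 * S.r ^ d) =
        ENNReal.ofReal (S.r / 2) ^ d := by
      rw [← ENNReal.ofReal_mul (by positivity), ← ENNReal.ofReal_pow (by positivity), div_pow]
      congr 1
      field_simp
    rw [e, ENNReal.ofReal_add (by positivity) (mul_nonneg (by linarith) (by linarith)),
      ENNReal.ofReal_mul (p := 1 - 2 * S.r ^ d) (by linarith), mul_add, ← e2]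
    refine le_of_eq ?_
    ring

theorem exists_profile (hd : d ≠ 0) (hΩ : IsCZSymbol Ω) {L : ℝ}
    (hL : ∀ (C : ℝ≥0∞) (w : Space d → ℝ), IsProfile C w → ∀ a ∈ S.F,
      ∀ x ∈ Metric.closedBall a S.s, ∀ x' ∈ Metric.closedBall a S.s,
        |(∫ y, czKernel Ω x y * S.rest w a y) - ∫ y, czKernel Ω x' y * S.rest w a y| ≤
          L * (S.lam / S.s) * ‖x - x'‖)
    {p κ : ℝ} (hp : 0 < p) (hL0 : 0 ≤ L) (hκ : 4 * L ≤ κ) (hs2 : S.s ≤ 1 / 2)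
    (hS : S.IsLarge Ω κ) (hC : ENNReal.ofReal S.lam * (1 + 3 ^ d) * unitVol d ≤ C) :
    ∃ w, IsProfile C w ∧ ∀ g : Space d → ℝ, (∀ x ∈ Metric.closedBall (0 : Space d) 1,
      ∀ y ∈ Metric.closedBall (0 : Space d) 1, |g x - g y| ≤ 2 * L * ‖x - y‖) →
        ENNReal.ofReal κ ^ p * (unitVol d * ENNReal.ofReal (2 * 2 ^ d)⁻¹) * ENNReal.ofReal (1 / 2) ≤
          dualEnergy Ω p w g := by
  have hr := S.r_pos
  have hm : 2 * S.r ^ d ≤ 1 := by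
    have := S.mass
    have : 0 ≤ S.lam * S.s ^ d * S.F.card := by
      have := S.lam_pos; have := S.s_pos
      positivity
    linarith
  -- Enough generations for half of the mass to lie in cores.
  obtain ⟨N, hN⟩ := exists_pow_lt_of_lt_one (show (0 : ℝ) < 1 / 2 by norm_num)
    (show 1 - 2 * S.r ^ d < 1 by
      have : 0 < 2 * S.r ^ d := by positivity
      linarith)
  refine ⟨S.iter N, isProfile_iter hC N, fun g hg => ?_⟩
  refine le_trans ?_ (le_dualEnergy_iter hd hΩ hL hp hL0 hκ hs2 hS N hg)
  gcongr
  linarith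

end Scheme

end

section

/-! ### Largeness of the singular integral on the core -/

variable {d : ℕ} {Ω : Space d → ℝ}

theorem HasCZValue.sum {ι : Type*} {F : Finset ι} {f : ι → Space d → ℝ} {x : Space d} {t : ι → ℝ}
    (h : ∀ i ∈ F, HasCZValue Ω (f i) x (t i)) :
    HasCZValue Ω (fun y => ∑ i ∈ F, f i y) x (∑ i ∈ F, t i) := by
  classical
  induction F using Finset.induction_on with
  | empty => exact ⟨fun ε hε => by simp, by simp⟩
  | insert i F hi ih =>
    simp only [Finset.sum_insert hi]
    exact (h i (Finset.mem_insert_self _ _)).add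
      (ih fun j hj => h j (Finset.mem_insert_of_mem hj))

theorem IsProfile.integral_eq {C : ℝ≥0∞} {w : Space d → ℝ} (hw : IsProfile C w) :
    ∫ x, w x = (unitVol d).toReal := by
  rw [integral_eq_lintegral_of_nonneg_ae (Eventually.of_forall hw.nonneg)
    hw.measurable.aestronglyMeasurable, hw.lintegral_eq]

namespace Scheme

variable {S : Scheme d} {C : ℝ≥0∞} {w : Space d → ℝ}

theorem comp_dilation_eq_zero_of_core (hw : IsProfile C w) {a x y : Space d} (ha : a ∈ S.F)
    (hx : x ∈ S.core) (hy : ‖x - y‖ ≤ S.s) : w (dilation a S.s y) = 0 := by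
  refine hw.comp_dilation_eq_zero S.s_pos (lt_dist_of_mem_core hx ?_ ha)
  rw [dist_comm, dist_eq_norm]
  linarith [S.s_pos]

/-- Only the mass and the support of the rescaled profile enter, so the bounds on the core are
uniform in `w`. -/
theorem le_integral_child (hd : d ≠ 0) (hΩ : IsCZSymbol Ω) (hw : IsProfile C w) {a x : Space d}
    (ha : a ∈ S.F) (hx : x ∈ S.core) {σ k : ℝ}
    (hk : ∀ y ∈ Metric.closedBall a S.s, k ≤ σ * convKernel Ω (x - y)) :
    k * (S.s ^ d * (unitVol d).toReal) ≤ σ * ∫ y, czKernel Ω x y * w (dilation a S.s y) := by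
  have hs := S.s_pos
  have hint := integrable_comp_dilation a hs hw.integrable
  have h1 := hΩ.integrable_of_eq_zero hd hint (x := x) hs fun y hy =>
    comp_dilation_eq_zero_of_core hw ha hx hy
  rw [← hw.integral_eq, ← integral_comp_dilation a hs, ← integral_const_mul, ← integral_const_mul]
  refine integral_mono (hint.const_mul _) (h1.const_mul _) fun y => ?_
  simp only
  by_cases hy : dist y a ≤ S.s
  · rw [← mul_assoc]
    exact mul_le_mul_of_nonneg_right (hk y hy) (hw.nonneg _)
  · rw [hw.comp_dilation_eq_zero hs (not_le.1 hy)]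
    simp

/-- The volume of the core is comparable to r^d and the kernel is at most B (r/2)^(-d) in the given
region, so r cancels. -/
theorem abs_setIntegral_core_le (hd : d ≠ 0) {B : ℝ} (hB0 : 0 ≤ B)
    (hB : ∀ z, z ≠ 0 → |Ω z| ≤ B) (x : Space d) :
    |∫ y in {y | S.r / 2 < ‖x - y‖}, czKernel Ω x y * S.core.indicator 1 y| ≤
      2 * 2 ^ d * B * (unitVol d).toReal := by
  have hr := S.r_pos
  have h1 : ∫ y in {y | S.r / 2 < ‖x - y‖}, czKernel Ω x y * S.core.indicator 1 y =
      ∫ y in S.core ∩ {y | S.r / 2 < ‖x - y‖}, czKernel Ω x y := by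
    rw [Set.inter_comm, ← setIntegral_indicator S.measurableSet_core]
    refine integral_congr_ae (Eventually.of_forall fun y => ?_)
    by_cases hy : y ∈ S.core <;> simp [hy]
  have hvol : volume S.core = 2 * (ENNReal.ofReal S.r ^ d * unitVol d) := by
    rw [core, measure_union disjoint_core Metric.isClosed_closedBall.measurableSet,
      volume_closedBall_eq _ hr.le, volume_closedBall_eq _ hr.le, two_mul]
  have hfin : volume S.core ≠ ∞ := by
    have := unitVol_ne_top (d := d)
    rw [hvol]
    finiteness
  rw [h1, ← Real.norm_eq_abs]
  refine (norm_setIntegral_le_of_norm_le_const (C := B / (S.r / 2) ^ d)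
    ((measure_mono Set.inter_subset_left).trans_lt hfin.lt_top) fun y hy => ?_).trans ?_
  · rw [Real.norm_eq_abs, czKernel_eq]
    refine (abs_convKernel_le hd hB _).trans ?_
    have : S.r / 2 < ‖x - y‖ := hy.2
    gcongr
  · have h2 : volume.real (S.core ∩ {y | S.r / 2 < ‖x - y‖}) ≤
        2 * (S.r ^ d * (unitVol d).toReal) := by
      refine (measureReal_mono Set.inter_subset_left hfin).trans (le_of_eq ?_)
      rw [Measure.real, hvol]
      simp [ENNReal.toReal_ofReal hr.le]
    calc _ ≤ B / (S.r / 2) ^ d * (2 * (S.r ^ d * (unitVol d).toReal)) := by gcongr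
      _ = _ := by
          rw [div_pow]
          field_simp

theorem hasCZValue_step (hd : d ≠ 0) (hΩ : IsCZSymbol Ω) (hw : IsProfile C w) {p x : Space d}
    (hp : Metric.closedBall p S.r ⊆ S.core) (hx : x ∈ Metric.closedBall p (S.r / 2)) :
    HasCZValue Ω (S.step w) x
      ((∫ y in {y | S.r / 2 < ‖x - y‖}, czKernel Ω x y * S.core.indicator 1 y) +
        S.lam * ∑ a ∈ S.F, ∫ y, czKernel Ω x y * w (dilation a S.s y)) := by
  have hr := S.r_pos
  have hs := S.s_pos
  have hxc : x ∈ S.core := hp (Metric.closedBall_subset_closedBall (by linarith) hx)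
  refine HasCZValue.add ?_ (HasCZValue.const_mul (HasCZValue.sum fun a ha => ?_) _)
  · refine hΩ.hasCZValue_of_eq_const hd ?_ (c := 1) (by positivity) fun y hy => ?_
    · refine (integrable_indicator_iff S.measurableSet_core).2 (integrableOn_const ?_)
      refine ((measure_mono (Set.union_subset_union le_rfl le_rfl)).trans_lt
        (measure_union_lt_top ?_ ?_)).ne <;> exact measure_closedBall_lt_top
    · rw [Set.indicator_of_mem, Pi.one_apply]
      apply hp
      rw [Metric.mem_closedBall] at hx ⊢
      rw [← dist_eq_norm] at hy
      linarith [dist_triangle_left y p x]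
  · exact hΩ.hasCZValue_of_eq_zero hd (integrable_comp_dilation a hs hw.integrable) hs fun y hy =>
      comp_dilation_eq_zero_of_core hw ha hxc hy

/-- Each of the n groups `U i` contributes at least c m₀ times the unit volume, while the core and
the remaining children, which are at distance at least 1/4 and have total mass at most the unit
volume, cost a bounded amount. Growth in n is thus the logarithmic divergence of the kernel along a
cone. -/
theorem le_czValue_step (hd : d ≠ 0) (hΩ : IsCZSymbol Ω) {B : ℝ} (hB0 : 0 ≤ B)
    (hB : ∀ z, z ≠ 0 → |Ω z| ≤ B) {p : Space d} (hp : Metric.closedBall p S.r ⊆ S.core)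
    {σ c m₀ : ℝ} (hσ : |σ| = 1) (hc : 0 ≤ c) (n : ℕ) (t : ℕ → ℝ) (ht : ∀ i, 0 < t i)
    (U : ℕ → Finset (Space d)) (hUF : ∀ i, U i ⊆ S.F)
    (hU : Set.PairwiseDisjoint (Finset.range n : Set ℕ) U)
    (hlow : ∀ i < n, ∀ a ∈ U i, ∀ x ∈ Metric.closedBall p (S.r / 2), ∀ y ∈ Metric.closedBall a S.s,
      c / (2 * t i) ^ d ≤ σ * convKernel Ω (x - y))
    (hfar : ∀ a ∈ S.F, (∀ i < n, a ∉ U i) → ∀ x ∈ Metric.closedBall p (S.r / 2),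
      ∀ y ∈ Metric.closedBall a S.s, 1 / 4 ≤ ‖x - y‖)
    (hcount : ∀ i < n, m₀ * (2 * t i) ^ d ≤ (U i).card * S.s ^ d) (hm₀ : 0 ≤ m₀)
    (hw : IsProfile C w) {x : Space d} (hx : x ∈ Metric.closedBall p (S.r / 2)) :
    (n * (c * m₀) - (2 * 2 ^ d + 4 ^ d) * B) * (unitVol d).toReal ≤
      σ * czValue Ω (S.step w) x := by
  classical
  have hr := S.r_pos
  have hs := S.s_pos
  have hl := S.lam_pos
  set β := (unitVol d).toReal with hβ
  have hβ0 : 0 ≤ β := ENNReal.toReal_nonneg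
  have hxc : x ∈ S.core := hp (Metric.closedBall_subset_closedBall (by linarith) hx)
  rw [(hasCZValue_step hd hΩ hw hp hx).czValue_eq, mul_add]
  set T : Space d → ℝ := fun a => σ * ∫ y, czKernel Ω x y * w (dilation a S.s y) with hT
  have h1 : -(2 * 2 ^ d * B * β) ≤
      σ * ∫ y in {y | S.r / 2 < ‖x - y‖}, czKernel Ω x y * S.core.indicator 1 y := by
    have := abs_setIntegral_core_le (S := S) hd hB0 hB x
    refine neg_le_of_abs_le ?_
    rwa [abs_mul, hσ, one_mul]
  have h2 : σ * (S.lam * ∑ a ∈ S.F, ∫ y, czKernel Ω x y * w (dilation a S.s y)) =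
      S.lam * ∑ a ∈ S.F, T a := by
    rw [hT, mul_left_comm, Finset.mul_sum]
  set F₁ := (Finset.range n).biUnion U with hF₁
  have hF₁F : F₁ ⊆ S.F := Finset.biUnion_subset.2 fun i _ => hUF i
  have h3 : n * (c * m₀) * β ≤ ∑ a ∈ F₁, T a := by
    rw [hF₁, Finset.sum_biUnion hU]
    calc n * (c * m₀) * β = ∑ i ∈ Finset.range n, c * m₀ * β := by
          rw [Finset.sum_const, Finset.card_range, nsmul_eq_mul]
          ring
      _ ≤ _ := by
          refine Finset.sum_le_sum fun i hi => ?_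
          have hi' := Finset.mem_range.1 hi
          have hti := ht i
          calc c * m₀ * β = c / (2 * t i) ^ d * (m₀ * (2 * t i) ^ d) * β := by field_simp
            _ ≤ c / (2 * t i) ^ d * ((U i).card * S.s ^ d) * β := by
                exact mul_le_mul_of_nonneg_right
                  (mul_le_mul_of_nonneg_left (hcount i hi') (by positivity)) hβ0
            _ = ∑ a ∈ U i, c / (2 * t i) ^ d * (S.s ^ d * β) := by
                rw [Finset.sum_const, nsmul_eq_mul]
                ring
            _ ≤ _ := Finset.sum_le_sum fun a ha =>
                le_integral_child hd hΩ hw (hUF i ha) hxc (hlow i hi' a ha x hx)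
  have h4 : ∑ a ∈ S.F \ F₁, -(B * 4 ^ d) * (S.s ^ d * β) ≤ ∑ a ∈ S.F \ F₁, T a := by
    refine Finset.sum_le_sum fun a ha => ?_
    rw [Finset.mem_sdiff] at ha
    refine le_integral_child hd hΩ hw ha.1 hxc fun y hy => ?_
    refine neg_le_of_abs_le ?_
    rw [abs_mul, hσ, one_mul]
    refine (abs_convKernel_le hd hB _).trans ?_
    have h5 : 1 / 4 ≤ ‖x - y‖ := by
      refine hfar a ha.1 (fun i hi hai => ha.2 ?_) x hx y hy
      exact Finset.mem_biUnion.2 ⟨i, Finset.mem_range.2 hi, hai⟩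
    calc B / ‖x - y‖ ^ d ≤ B / (1 / 4) ^ d := by gcongr
      _ = B * 4 ^ d := by rw [one_div, inv_pow, div_inv_eq_mul]
  have hcard : S.lam * ((S.F \ F₁).card * S.s ^ d) ≤ 1 := by
    have h6 : ((S.F \ F₁).card : ℝ) ≤ S.F.card := by
      exact_mod_cast Finset.card_le_card Finset.sdiff_subset
    have h7 : 0 ≤ 2 * S.r ^ d := by positivity
    calc _ ≤ S.lam * (S.F.card * S.s ^ d) := by gcongr
      _ ≤ 1 := by linarith [S.mass]
  rw [Finset.sum_const, nsmul_eq_mul] at h4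
  have h5 : -(B * 4 ^ d * β) ≤ S.lam * ∑ a ∈ S.F \ F₁, T a := by
    have := mul_le_mul_of_nonneg_left h4 hl.le
    have h8 : S.lam * ((S.F \ F₁).card * S.s ^ d) * (B * 4 ^ d * β) ≤ 1 * (B * 4 ^ d * β) := by
      gcongr
    linarith
  have h6 : n * (c * m₀) * β ≤ S.lam * ∑ a ∈ F₁, T a := by
    have h9 : 0 ≤ n * (c * m₀) * β := by positivity
    exact h3.trans (le_mul_of_one_le_left (h9.trans h3) S.one_le_lam)
  rw [h2, ← Finset.sum_sdiff hF₁F, mul_add]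
  linarith

end Scheme

end

section

/-! ### Existence of schemes with large singular integrals -/

variable {d : ℕ} {Ω : Space d → ℝ}

theorem IsCZSymbol.continuous_sphere (hΩ : IsCZSymbol Ω) :
    Continuous fun x : Metric.sphere (0 : Space d) 1 => Ω x := by
  refine hΩ.contDiffOn.continuousOn.comp_continuous continuous_subtype_val fun x => ?_
  rintro h
  have := x.2
  rw [mem_sphere_zero_iff_norm, h, norm_zero] at this
  norm_num at this

theorem IsCZSymbol.exists_neg (hd : d ≠ 0) (hΩ : IsCZSymbol Ω) :
    ∃ e : Space d, ‖e‖ = 1 ∧ Ω e < 0 := by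
  have : Nonempty (Fin d) := ⟨⟨0, Nat.pos_of_ne_zero hd⟩⟩
  by_contra! hcon
  have hcont := hΩ.continuous_sphere
  obtain ⟨x, hx, hx0⟩ := hΩ.exists_ne_zero
  have h1 := Continuous.integral_pos_of_hasCompactSupport_nonneg_nonzero
    (μ := (volume : Measure (Space d)).toSphere) (x := ⟨x, hx⟩) hcont
    (HasCompactSupport.of_compactSpace _)
    (fun x => hcon x (mem_sphere_zero_iff_norm.1 x.2)) hx0
  exact h1.ne' hΩ.integral_sphere_eq_zero

theorem IsCZSymbol.neg (hΩ : IsCZSymbol Ω) : IsCZSymbol fun x => -Ω x where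
  homogeneous t x ht hx := by rw [hΩ.homogeneous t x ht hx]
  contDiffOn := hΩ.contDiffOn.neg
  integral_sphere_eq_zero := by rw [integral_neg, hΩ.integral_sphere_eq_zero, neg_zero]
  exists_ne_zero := by
    obtain ⟨x, hx, h⟩ := hΩ.exists_ne_zero
    exact ⟨x, hx, neg_ne_zero.2 h⟩

/-- Mass placed in direction e from x is seen through the kernel at x - y, close to the direction
-e; hence the cone about -e. Applied to -Ω, it also gives a cone where Ω is positive. -/
theorem IsCZSymbol.exists_cone (hd : d ≠ 0) (hΩ : IsCZSymbol Ω) :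
    ∃ (e : Space d) (c ρ : ℝ), ‖e‖ = 1 ∧ 0 < c ∧ 0 < ρ ∧
      ∀ z ∈ Metric.closedBall (-e) ρ, z ≠ 0 ∧ Ω z ≤ -c := by
  obtain ⟨e, he, hlt⟩ := hΩ.exists_neg hd
  have he0 : e ≠ 0 := by
    rintro rfl
    norm_num at he
  have hca : ContinuousAt Ω e :=
    hΩ.contDiffOn.continuousOn.continuousAt (isOpen_compl_singleton.mem_nhds he0)
  have h1 : ∀ᶠ z in 𝓝 e, z ≠ 0 ∧ Ω z < Ω e / 2 :=
    (show ∀ᶠ z in 𝓝 e, z ≠ 0 from isOpen_compl_singleton.mem_nhds he0).and (hca.eventually_lt_const (by linarith))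
  obtain ⟨ρ, hρ, hball⟩ := Metric.nhds_basis_closedBall.eventually_iff.1 h1
  refine ⟨-e, -(Ω e / 2), ρ, by rwa [norm_neg], by linarith, hρ, fun z hz => ?_⟩
  rw [neg_neg] at hz ⊢
  exact ⟨(hball hz).1, (hball hz).2.le⟩

/-- A finite packing of a bounded set by disjoint balls whose enlargements cover. -/
theorem exists_packing (A : Set (Space d)) (hA : Bornology.IsBounded A) {ρ : ℝ} (hρ : 0 < ρ) :
    ∃ F : Finset (Space d), (∀ a ∈ F, a ∈ A) ∧ (∀ a ∈ F, ∀ b ∈ F, a ≠ b → 2 * ρ < dist a b) ∧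
      ∀ a ∈ A, ∃ b ∈ F, dist a b ≤ 5 * ρ := by
  obtain ⟨u, huA, hdisj, hcov⟩ := Vitali.exists_disjoint_subfamily_covering_enlargement_closedBall
    A id (fun _ => ρ) ρ (fun _ _ => le_rfl) 5 (by norm_num)
  simp only [id] at hdisj hcov
  have hfin : u.Finite := by
    obtain ⟨R, hR⟩ := hA.subset_closedBall 0
    have h := Measure.finite_const_le_meas_of_disjoint_iUnion (volume : Measure (Space d))
      (ε := volume (Metric.ball (0 : Space d) ρ)) (Metric.measure_ball_pos _ _ hρ)
      (As := fun a : u => Metric.closedBall (a : Space d) ρ)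
      (fun a => Metric.isClosed_closedBall.measurableSet)
      (fun a b hab => hdisj a.2 b.2 (Subtype.coe_injective.ne hab))
      (ne_top_of_le_ne_top (measure_closedBall_lt_top (x := (0 : Space d)) (r := R + ρ)).ne
        (measure_mono (Set.iUnion_subset fun a => Metric.closedBall_subset_closedBall' (by
          have := hR (huA a.2)
          rw [Metric.mem_closedBall] at this
          linarith))))
    have h2 : {a : u | volume (Metric.ball (0 : Space d) ρ) ≤
        volume (Metric.closedBall (a : Space d) ρ)} = Set.univ := by
      refine Set.eq_univ_of_forall fun a => ?_
      change volume (Metric.ball (0 : Space d) ρ) ≤ volume (Metric.closedBall (a : Space d) ρ)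
      rw [← Measure.addHaar_ball_center volume (a : Space d)]
      exact measure_mono Metric.ball_subset_closedBall
    rw [h2] at h
    exact Set.finite_coe_iff.1 (Set.finite_univ_iff.1 h)
  refine ⟨hfin.toFinset, fun a ha => huA (hfin.mem_toFinset.1 ha), fun a ha b hb hab => ?_,
    fun a ha => ?_⟩
  · have h1 := hdisj (hfin.mem_toFinset.1 ha) (hfin.mem_toFinset.1 hb) hab
    rw [Function.onFun, disjoint_closedBall_closedBall_iff hρ.le hρ.le] at h1
    linarith
  · obtain ⟨b, hb, hsub⟩ := hcov a ha
    exact ⟨b, hfin.mem_toFinset.2 hb, hsub (Metric.mem_closedBall_self hρ.le)⟩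

theorem card_mul_pow_le {F : Finset (Space d)} {ρ R : ℝ} {c : Space d} (hρ : 0 < ρ) (hR : 0 ≤ R)
    (hsep : ∀ a ∈ F, ∀ b ∈ F, a ≠ b → 2 * ρ < dist a b) (hF : ∀ a ∈ F, dist a c + ρ ≤ R) :
    F.card * ρ ^ d ≤ R ^ d := by
  have h1 : volume (⋃ a ∈ F, Metric.closedBall a ρ) ≤ volume (Metric.closedBall c R) :=
    measure_mono (Set.iUnion₂_subset fun a ha =>
      Metric.closedBall_subset_closedBall' (by linarith [hF a ha]))
  rw [measure_biUnion_finset (fun a ha b hb hab =>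
    Metric.closedBall_disjoint_closedBall (by linarith [hsep a ha b hb hab]))
    fun a _ => Metric.isClosed_closedBall.measurableSet, volume_closedBall_eq _ hR] at h1
  simp only [volume_closedBall_eq _ hρ.le, Finset.sum_const, nsmul_eq_mul] at h1
  rw [← mul_assoc, ENNReal.mul_le_mul_iff_left unitVol_ne_zero unitVol_ne_top,
    ← ENNReal.ofReal_pow hρ.le, ← ENNReal.ofReal_pow hR, ← ENNReal.ofReal_natCast,
    ← ENNReal.ofReal_mul (by positivity), ENNReal.ofReal_le_ofReal_iff (by positivity)] at h1
  exact h1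

theorem pow_le_card_mul_pow {F : Finset (Space d)} {ρ R : ℝ} {c : Space d} (hρ : 0 ≤ ρ)
    (hR : 0 ≤ R) (hcov : ∀ a ∈ Metric.closedBall c R, ∃ b ∈ F, dist a b ≤ ρ) :
    R ^ d ≤ F.card * ρ ^ d := by
  have h1 : volume (Metric.closedBall c R) ≤ volume (⋃ b ∈ F, Metric.closedBall b ρ) := by
    refine measure_mono fun a ha => ?_
    obtain ⟨b, hb, hab⟩ := hcov a ha
    exact Set.mem_biUnion hb hab
  replace h1 := h1.trans (measure_biUnion_finset_le F _)
  rw [volume_closedBall_eq _ hR] at h1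
  simp only [volume_closedBall_eq _ hρ, Finset.sum_const, nsmul_eq_mul] at h1
  rw [← mul_assoc, ENNReal.mul_le_mul_iff_left unitVol_ne_zero unitVol_ne_top,
    ← ENNReal.ofReal_pow hρ, ← ENNReal.ofReal_pow hR, ← ENNReal.ofReal_natCast,
    ← ENNReal.ofReal_mul (by positivity), ENNReal.ofReal_le_ofReal_iff (by positivity)] at h1
  exact h1

theorem le_convKernel_of_cone (hΩ : IsCZSymbol Ω) {σ c ρ : ℝ} (hc : 0 < c) {e : Space d}
    (he : ‖e‖ = 1) (hcone : ∀ z ∈ Metric.closedBall (-e) ρ, z ≠ 0 ∧ c ≤ σ * Ω z) (hρ1 : ρ ≤ 1)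
    {t : ℝ} (ht : 0 < t) {z : Space d} (hz : ‖z + t • e‖ ≤ ρ * t) :
    c / (2 * t) ^ d ≤ σ * convKernel Ω z := by
  have hmem : t⁻¹ • z ∈ Metric.closedBall (-e) ρ := by
    rw [mem_closedBall_iff_norm, sub_neg_eq_add]
    have : t⁻¹ • z + e = t⁻¹ • (z + t • e) := by rw [smul_add, inv_smul_smul₀ ht.ne']
    rw [this, norm_smul, norm_inv, Real.norm_eq_abs, abs_of_pos ht, inv_mul_le_iff₀ ht]
    linarith
  obtain ⟨hz0, hcz⟩ := hcone _ hmem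
  have hz0' : z ≠ 0 := fun h => hz0 (by rw [h, smul_zero])
  rw [hΩ.homogeneous _ _ (by positivity) hz0'] at hcz
  rw [convKernel, ← mul_div_assoc]
  have hn : ‖z‖ ≤ 2 * t := by
    have h1 := norm_sub_le (z + t • e) (t • e)
    rw [add_sub_cancel_right, norm_smul, he, Real.norm_eq_abs, abs_of_pos ht] at h1
    nlinarith
  have hzp : 0 < ‖z‖ := norm_pos_iff.2 hz0'
  have hcz0 : 0 ≤ σ * Ω z := hc.le.trans hcz
  gcongr

/-- Scale i is represented by the ball of radius η t_i about p + t_i e, with t_i = 2^(-i-3). It is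
covered by balls of radius 10s about centres, so comparison of volumes gives the count with m₀ =
(η/20)^d. The aperture 3η leaves room for moving x by r/2 and y by s. -/
theorem Scheme.le_czValue_of_shells (hd : d ≠ 0) (hΩ : IsCZSymbol Ω) {B : ℝ} (hB0 : 0 ≤ B)
    (hB : ∀ z, z ≠ 0 → |Ω z| ≤ B) {S : Scheme d} {p e : Space d} (he : ‖e‖ = 1) {η σ c : ℝ}
    (hη0 : 0 < η) (hη : η ≤ 1 / 16) (hσ : |σ| = 1) (hc : 0 < c)
    (hcone : ∀ z ∈ Metric.closedBall (-e) (3 * η), z ≠ 0 ∧ c ≤ σ * Ω z) (n : ℕ)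
    (hr : S.r = η * (1 / 2) ^ (n + 3)) (hs : S.s = η * (1 / 2) ^ (n + 3) / 20)
    (hp : Metric.closedBall p S.r ⊆ S.core)
    (hcov : ∀ i < n, ∀ a : Space d, dist a (p + (1 / 2 : ℝ) ^ (i + 3) • e) ≤ η * (1 / 2) ^ (i + 3) →
      ∃ b ∈ S.F, dist a b ≤ 10 * S.s)
    (hfar : ∀ a ∈ S.F, (∃ i < n, dist a (p + (1 / 2 : ℝ) ^ (i + 3) • e) ≤ η * (1 / 2) ^ (i + 3)) ∨
      1 / 2 ≤ dist a p)
    {C : ℝ≥0∞} {w : Space d → ℝ} (hw : IsProfile C w)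
    {x : Space d} (hx : x ∈ Metric.closedBall p (S.r / 2)) :
    (n * (c * (η / 20) ^ d) - (2 * 2 ^ d + 4 ^ d) * B) * (unitVol d).toReal ≤
      σ * czValue Ω (S.step w) x := by
  classical
  set δ : ℝ := (1 / 2) ^ (n + 3) with hδ
  have hδ0 : 0 < δ := by positivity
  have hδ1 : δ ≤ 1 / 8 := by
    rw [hδ, pow_add]
    have : (1 / 2 : ℝ) ^ n ≤ 1 := pow_le_one₀ (by norm_num) (by norm_num)
    linarith
  have hηδ : 0 < η * δ := by positivity
  have hηδ1 : η * δ ≤ 1 / 16 * (1 / 8) := by gcongr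
  set t : ℕ → ℝ := fun i => (1 / 2) ^ (i + 3) with ht
  have ht0 : ∀ i, 0 < t i := fun i => by positivity
  have hδt : ∀ i < n, δ ≤ t i := fun i hi =>
    pow_le_pow_of_le_one (by norm_num) (by norm_num) (by omega)
  -- The radius is doubled so that every centre used in the covering is counted; since η ≤ 1/16 the
  -- groups remain disjoint.
  set U : ℕ → Finset (Space d) := fun i =>
    S.F.filter fun a => dist a (p + t i • e) ≤ 2 * (η * t i) with hU
  refine le_czValue_step hd hΩ hB0 hB hp hσ hc.le n t ht0 U (fun i => Finset.filter_subset _ _)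
    ?_ ?_ ?_ ?_ (by positivity) hw hx
  · have hlt : ∀ i j, i < j → Disjoint (U i) (U j) := by
      intro i j hij
      rw [Finset.disjoint_left]
      intro a hai haj
      have h1 := (Finset.mem_filter.1 hai).2
      have h2 := (Finset.mem_filter.1 haj).2
      have h3 : t j ≤ t i / 2 := by
        have : t (i + 1) = t i / 2 := by simp only [ht]; ring
        rw [← this]
        exact pow_le_pow_of_le_one (by norm_num) (by norm_num) (by omega)
      have h4 := dist_triangle_left (p + t i • e) (p + t j • e) a
      rw [dist_eq_norm (p + t i • e), add_sub_add_left_eq_sub, ← sub_smul, norm_smul, he, mul_one,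
        Real.norm_eq_abs, abs_of_nonneg (by linarith [ht0 i])] at h4
      have h5 : η * t j ≤ η * (t i / 2) := by gcongr
      have h6 : η * t i ≤ 1 / 16 * t i := by
        have := ht0 i
        gcongr
      linarith [ht0 i]
    intro i _ j _ hij
    rcases lt_or_gt_of_ne hij with h | h
    · exact hlt i j h
    · exact (hlt j i h).symm
  · intro i hi a ha x hx y hy
    refine le_convKernel_of_cone hΩ hc he hcone (by linarith) (ht0 i) ?_
    have h1 := (Finset.mem_filter.1 ha).2
    rw [Metric.mem_closedBall, dist_eq_norm] at hx hy
    rw [dist_eq_norm] at h1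
    have h2 : x - y + t i • e = (x - p) - (y - a) - (a - (p + t i • e)) := by abel
    have h3 := norm_sub_le ((x - p) - (y - a)) (a - (p + t i • e))
    have h4 := norm_sub_le (x - p) (y - a)
    have h5 : η * δ ≤ η * t i := by
      have := hδt i hi
      gcongr
    rw [h2]
    rw [hr] at hx
    rw [hs] at hy
    linarith
  · intro a ha hnot x hx y hy
    rcases hfar a ha with ⟨i, hi, hia⟩ | h
    · refine absurd (Finset.mem_filter.2 ⟨ha, hia.trans ?_⟩) (hnot i hi)
      have : 0 < η * t i := mul_pos hη0 (ht0 i)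
      simp only [ht] at this
      linarith
    · rw [Metric.mem_closedBall] at hx hy
      have h1 := dist_triangle a y p
      have h2 := dist_triangle y x p
      rw [dist_comm a y] at h1
      rw [← dist_eq_norm, dist_comm x y]
      rw [hr] at hx
      rw [hs] at hy
      linarith
  · intro i hi
    have h5 : η * δ ≤ η * t i := by
      have := hδt i hi
      gcongr
    have h1 := pow_le_card_mul_pow (F := U i) (ρ := 10 * S.s) (R := η * t i)
      (c := p + t i • e) (by linarith [S.s_pos]) (mul_pos hη0 (ht0 i)).le fun a ha => by
        obtain ⟨b, hb, hab⟩ := hcov i hi a ha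
        refine ⟨b, Finset.mem_filter.2 ⟨hb, ?_⟩, hab⟩
        have h2 := dist_triangle_left b (p + t i • e) a
        rw [Metric.mem_closedBall] at ha
        rw [hs] at hab
        linarith
    have h2 : (η / 20) ^ d * (2 * t i) ^ d = (η * t i) ^ d / 10 ^ d := by
      rw [← mul_pow, ← div_pow]
      congr 1
      ring
    rw [h2, div_le_iff₀ (by positivity), mul_assoc, ← mul_pow, mul_comm S.s]
    exact h1

theorem dist_shell {p e a : Space d} (he : ‖e‖ = 1) {t η : ℝ} (ht : 0 < t)
    (h : dist a (p + t • e) ≤ η * t) : t - η * t ≤ dist a p ∧ dist a p ≤ t + η * t := by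
  have h1 : dist (p + t • e) p = t := by
    rw [dist_eq_norm, add_sub_cancel_left, norm_smul, he, mul_one, Real.norm_eq_abs, abs_of_pos ht]
  have h2 := dist_triangle a (p + t • e) p
  have h3 := dist_triangle_left (p + t • e) p a
  constructor <;> linarith

/-- Only n, and with it r and s, depends on κ. The density stays bounded because the children of
scale 0 alone already occupy a volume that depends on η and d only. -/
theorem IsCZSymbol.exists_scheme (hd : d ≠ 0) (hΩ : IsCZSymbol Ω) :
    ∃ Λ : ℝ, ∀ κ : ℝ, ∃ S : Scheme d, S.lam ≤ Λ ∧ S.s ≤ 1 / 2 ∧ S.IsLarge Ω κ := by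
  obtain ⟨B, hB0, hB⟩ := hΩ.exists_bound
  obtain ⟨e₁, c₁, ρ₁, he₁, hc₁, hρ₁, hcone₁⟩ := hΩ.neg.exists_cone hd
  obtain ⟨e₂, c₂, ρ₂, he₂, hc₂, hρ₂, hcone₂⟩ := hΩ.exists_cone hd
  set c := min c₁ c₂ with hc
  have hc0 : 0 < c := lt_min hc₁ hc₂
  set η := min (min (ρ₁ / 3) (ρ₂ / 3)) (1 / 16) with hη
  have hη0 : 0 < η := by positivity
  have hη16 : η ≤ 1 / 16 := min_le_right _ _
  have hη₁ : 3 * η ≤ ρ₁ := by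
    have : η ≤ ρ₁ / 3 := (min_le_left _ _).trans (min_le_left _ _)
    linarith
  have hη₂ : 3 * η ≤ ρ₂ := by
    have : η ≤ ρ₂ / 3 := (min_le_left _ _).trans (min_le_right _ _)
    linarith
  set β := (unitVol d).toReal with hβ
  have hβ0 : 0 < β := ENNReal.toReal_pos unitVol_ne_zero unitVol_ne_top
  refine ⟨((η / 80) ^ d)⁻¹, fun κ => ?_⟩
  have hm₀ : 0 < c * (η / 20) ^ d := by positivity
  obtain ⟨n₀, hn₀⟩ := exists_nat_gt ((2 * κ / β + (2 * 2 ^ d + 4 ^ d) * B) / (c * (η / 20) ^ d))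
  -- At least one scale is needed, since scale 0 gives the lower bound for the volume of the
  -- children.
  set n := n₀ + 1 with hn
  have hnlarge : 2 * κ ≤ (n * (c * (η / 20) ^ d) - (2 * 2 ^ d + 4 ^ d) * B) * β := by
    rw [div_lt_iff₀ hm₀] at hn₀
    rw [← div_le_iff₀ hβ0]
    have : (n : ℝ) = n₀ + 1 := by rw [hn]; push_cast; ring
    rw [this]
    linarith
  set δ : ℝ := (1 / 2) ^ (n + 3) with hδ
  have hδ0 : 0 < δ := by positivity
  have hδ1 : δ ≤ 1 / 16 := by
    rw [hδ, hn, pow_add, pow_add]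
    have : (1 / 2 : ℝ) ^ n₀ ≤ 1 := pow_le_one₀ (by norm_num) (by norm_num)
    linarith
  have hηδ : 0 < η * δ := by positivity
  have hηδ1 : η * δ ≤ 1 / 16 * δ := by gcongr
  set t : ℕ → ℝ := fun i => (1 / 2) ^ (i + 3) with ht
  have ht0 : ∀ i, 0 < t i := fun i => by positivity
  have ht8 : ∀ i, t i ≤ 1 / 8 := by
    intro i
    simp only [ht, pow_add]
    have : (1 / 2 : ℝ) ^ i ≤ 1 := pow_le_one₀ (by norm_num) (by norm_num)
    linarith
  have hδt : ∀ i < n, 2 * δ ≤ t i := by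
    intro i hi
    have h1 : 2 * δ = (1 / 2) ^ (n + 2) := by rw [hδ]; ring
    rw [h1]
    exact pow_le_pow_of_le_one (by norm_num) (by norm_num) (by omega)
  set p₁ : Space d := (1 / 2 : ℝ) • e₁ with hp₁
  set p₂ : Space d := -((1 / 2 : ℝ) • e₁) with hp₂
  have hnp₁ : ‖p₁‖ = 1 / 2 := by
    rw [hp₁, norm_smul, he₁, Real.norm_eq_abs, abs_of_pos (by norm_num), mul_one]
  have hnp₂ : ‖p₂‖ = 1 / 2 := by rw [hp₂, norm_neg, ← hp₁, hnp₁]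
  have hpp : dist p₁ p₂ = 1 := by
    rw [dist_eq_norm, hp₁, hp₂, sub_neg_eq_add, ← add_smul, norm_smul, he₁]
    norm_num
  set A : Set (Space d) := {a | ∃ i < n, dist a (p₁ + t i • e₁) ≤ η * t i ∨
    dist a (p₂ + t i • e₂) ≤ η * t i} with hA
  have hηt : ∀ i, η * t i ≤ 1 / 16 * t i := fun i => by
    have := ht0 i
    gcongr
  have hside : ∀ a ∈ A, (δ ≤ dist a p₁ ∧ dist a p₁ ≤ 1 / 4 ∧
        ∃ i < n, dist a (p₁ + t i • e₁) ≤ η * t i) ∨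
      (δ ≤ dist a p₂ ∧ dist a p₂ ≤ 1 / 4 ∧ ∃ i < n, dist a (p₂ + t i • e₂) ≤ η * t i) := by
    rintro a ⟨i, hi, h | h⟩
    · have h1 := dist_shell he₁ (ht0 i) h
      exact Or.inl ⟨by linarith [hδt i hi, hηt i], by linarith [ht8 i, hηt i], i, hi, h⟩
    · have h1 := dist_shell he₂ (ht0 i) h
      exact Or.inr ⟨by linarith [hδt i hi, hηt i], by linarith [ht8 i, hηt i], i, hi, h⟩
  have hdist : ∀ a ∈ A, δ ≤ dist a p₁ ∧ δ ≤ dist a p₂ ∧ ‖a‖ ≤ 3 / 4 := by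
    intro a ha
    have h12 := dist_triangle_left p₁ p₂ a
    have hn₁ := dist_triangle a p₁ 0
    have hn₂ := dist_triangle a p₂ 0
    rw [dist_zero_right, dist_zero_right] at hn₁ hn₂
    rcases hside a ha with ⟨h1, h2, _⟩ | ⟨h1, h2, _⟩
    · exact ⟨h1, by linarith, by linarith⟩
    · exact ⟨by linarith, h1, by linarith⟩
  have hAb : Bornology.IsBounded A := isBounded_iff_forall_norm_le.2
    ⟨3 / 4, fun a ha => (hdist a ha).2.2⟩
  -- With s = r/20 one has r + 4s < δ, so the core stays clear of all children.
  set r := η * δ with hr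
  set s := η * δ / 20 with hs
  have hs0 : 0 < s := by positivity
  -- Packing with radius 2s yields the separation 4s and the covering radius 10s.
  obtain ⟨F, hFA, hsep, hcov⟩ := exists_packing A hAb (ρ := 2 * s) (by positivity)
  have hupper : F.card * (2 * s) ^ d ≤ 1 ^ d :=
    card_mul_pow_le (c := 0) (by positivity) zero_le_one hsep fun a ha => by
      rw [dist_zero_right]
      linarith [(hdist a (hFA a ha)).2.2]
  have hlower : (η / 80) ^ d ≤ F.card * s ^ d := by
    have h1 := pow_le_card_mul_pow (F := F) (ρ := 10 * s) (R := η * t 0) (c := p₁ + t 0 • e₁)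
      (by positivity) (mul_pos hη0 (ht0 0)).le fun a ha => by
        obtain ⟨b, hb, hab⟩ := hcov a ⟨0, by omega, Or.inl ha⟩
        exact ⟨b, hb, by linarith⟩
    have h2 : η / 80 = η * t 0 / 10 := by simp only [ht]; ring
    rw [h2, div_pow, div_le_iff₀ (by positivity), mul_assoc, ← mul_pow, mul_comm s]
    exact h1
  have hcard0 : 0 < F.card * s ^ d := lt_of_lt_of_le (by positivity) hlower
  -- Balls of radius 2s still pack into the unit ball, which gains 2^d ≥ 2. Together with 2r^d ≤ 1/2
  -- this gives `lam` ≥ 1.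
  have hcard : F.card * s ^ d ≤ 1 / 2 := by
    have h2 : (2 : ℝ) ≤ 2 ^ d := le_self_pow₀ (by norm_num) hd
    rw [mul_pow, one_pow] at hupper
    nlinarith
  have hr0 : 0 < r := hηδ
  have hrd : r ^ d ≤ 1 / 4 := by
    refine (pow_le_of_le_one hr0.le (by linarith) hd).trans ?_
    linarith
  have hrd0 : 0 < r ^ d := by positivity
  let S : Scheme d :=
    { p₁ := p₁
      p₂ := p₂
      r := r
      s := s
      lam := (1 - 2 * r ^ d) / (F.card * s ^ d)
      F := F
      r_pos := hr0
      s_pos := hs0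
      one_le_lam := by
        rw [le_div_iff₀ hcard0]
        linarith
      mass := by
        rw [mul_assoc, mul_comm (s ^ d), div_mul_cancel₀ _ hcard0.ne']
        ring
      separated := fun a ha b hb hab => by linarith [hsep a ha b hb hab]
      dist_p₁ := fun a ha => by linarith [(hdist a (hFA a ha)).1]
      dist_p₂ := fun a ha => by linarith [(hdist a (hFA a ha)).2.1]
      dist_p₁_p₂ := by linarith
      norm_F := fun a ha => by linarith [(hdist a (hFA a ha)).2.2]
      norm_p₁ := by linarith
      norm_p₂ := by linarith }
  refine ⟨S, ?_, ?_, ?_⟩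
  · change (1 - 2 * r ^ d) / (F.card * s ^ d) ≤ ((η / 80) ^ d)⁻¹
    rw [← one_div]
    gcongr
    linarith
  · change s ≤ 1 / 2
    linarith
  · have hcov' : ∀ a ∈ A, ∃ b ∈ S.F, dist a b ≤ 10 * S.s := by
      intro a ha
      obtain ⟨b, hb, hab⟩ := hcov a ha
      refine ⟨b, hb, hab.trans (le_of_eq ?_)⟩
      change 5 * (2 * s) = 10 * s
      ring
    intro C w hw
    constructor
    · intro x hx
      have h1 := S.le_czValue_of_shells hd hΩ hB0 hB he₁ hη0 hη16 (σ := 1) abs_one hc0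
        (fun z hz => by
          obtain ⟨h0, hz'⟩ := hcone₁ z (Metric.closedBall_subset_closedBall hη₁ hz)
          exact ⟨h0, by linarith [min_le_left c₁ c₂]⟩)
        n rfl rfl (p := p₁) Set.subset_union_left
        (fun i hi a ha => hcov' a ⟨i, hi, Or.inl ha⟩)
        (fun a ha => by
          rcases hside a (hFA a ha) with ⟨_, _, h⟩ | ⟨_, h, _⟩
          · exact Or.inl h
          · exact Or.inr (by linarith [dist_triangle_left p₁ p₂ a]))
        hw hx
      linarith
    · intro x hx
      have h1 := S.le_czValue_of_shells hd hΩ hB0 hB he₂ hη0 hη16 (σ := -1) (by norm_num) hc0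
        (fun z hz => by
          obtain ⟨h0, hz'⟩ := hcone₂ z (Metric.closedBall_subset_closedBall hη₂ hz)
          exact ⟨h0, by linarith [min_le_right c₁ c₂]⟩)
        n rfl rfl (p := p₂) Set.subset_union_right
        (fun i hi a ha => hcov' a ⟨i, hi, Or.inr ha⟩)
        (fun a ha => by
          rcases hside a (hFA a ha) with ⟨_, h, _⟩ | ⟨_, _, h⟩
          · exact Or.inr (by linarith [dist_triangle_left p₁ p₂ a])
          · exact Or.inl h)
        hw hx
      linarith

end

section

/-! ### Superposition of distant profiles -/

variable {d : ℕ} {Ω : Space d → ℝ}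

/-- The A₁ constant is fixed before the Lipschitz bound L and the energy M, because it depends only
on the bound Λ for the densities. -/
theorem IsCZSymbol.exists_profiles (hd : d ≠ 0) (hΩ : IsCZSymbol Ω) {p : ℝ} (hp : 0 < p) :
    ∃ C : ℝ≥0∞, C ≠ ∞ ∧ ∀ (L : ℝ) (M : ℝ≥0∞), M ≠ ∞ → ∃ w, IsProfile C w ∧
      ∀ g : Space d → ℝ, (∀ x ∈ Metric.closedBall (0 : Space d) 1,
        ∀ y ∈ Metric.closedBall (0 : Space d) 1, |g x - g y| ≤ L * ‖x - y‖) →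
          M ≤ dualEnergy Ω p w g := by
  obtain ⟨Λ, hΛ⟩ := hΩ.exists_scheme hd
  obtain ⟨L₀, hL₀, hLip⟩ := Scheme.exists_lipschitz_rest hd hΩ
  refine ⟨ENNReal.ofReal Λ * (1 + 3 ^ d) * unitVol d, ?_, fun L M hM => ?_⟩
  · have := unitVol_ne_top (d := d)
    finiteness
  set K : ℝ≥0∞ := unitVol d * ENNReal.ofReal (2 * 2 ^ d)⁻¹ * ENNReal.ofReal (1 / 2) with hK
  have hK0 : K ≠ 0 := by
    refine mul_ne_zero (mul_ne_zero unitVol_ne_zero ?_) ?_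
    · rw [Ne, ENNReal.ofReal_eq_zero, not_le]
      positivity
    · norm_num
  have hKT : K ≠ ∞ := by
    have := unitVol_ne_top (d := d)
    finiteness
  set L' := max L₀ L with hL'
  have hL'0 : 0 < L' := hL₀.trans_le (le_max_left _ _)
  -- The first entry controls the oscillation of the perturbation, the second makes κ^p K at least
  -- M.
  set κ := max (4 * L') ((M / K) ^ (1 / p)).toReal with hκ
  obtain ⟨S, hSΛ, hSs, hSl⟩ := hΛ κ
  have hl := S.lam_pos
  have hs := S.s_pos
  obtain ⟨w, hw, hwg⟩ := S.exists_profile hd hΩ (L := L')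
    (C := ENNReal.ofReal Λ * (1 + 3 ^ d) * unitVol d)
    (fun C w hw a ha x hx x' hx' => (hLip S C w hw a ha x hx x' hx').trans (by
      gcongr
      exact le_max_left _ _)) hp hL'0.le (le_max_left _ _) hSs hSl (by gcongr)
  refine ⟨w, hw, fun g hg => le_trans ?_ (hwg g fun x hx y hy => (hg x hx y hy).trans ?_)⟩
  · have hfin : (M / K) ^ (1 / p) ≠ ∞ :=
      ENNReal.rpow_ne_top_of_nonneg (by positivity) (ENNReal.div_ne_top hM hK0)
    have h1 : (M / K) ^ (1 / p) ≤ ENNReal.ofReal κ := by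
      rw [← ENNReal.ofReal_toReal hfin]
      exact ENNReal.ofReal_le_ofReal (le_max_right _ _)
    have h2 := ENNReal.rpow_le_rpow h1 hp.le
    rw [← ENNReal.rpow_mul, one_div_mul_cancel hp.ne', ENNReal.rpow_one,
      ENNReal.div_le_iff hK0 hKT] at h2
    rwa [mul_assoc]
  · gcongr
    linarith [le_max_right L₀ L]

/-- The superposition `∑ c j • w j (· - x j)`. -/
noncomputable def superpose (c : ℕ → ℝ) (w : ℕ → Space d → ℝ) (x : ℕ → Space d) (y : Space d) : ℝ :=
  (∑' j, ENNReal.ofReal (c j * w j (dilation (x j) 1 y))).toReal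

variable {C : ℝ≥0∞} {c : ℕ → ℝ} {w : ℕ → Space d → ℝ} {x : ℕ → Space d}

theorem superpose_eq (hw : ∀ k, IsProfile C (w k)) (hc : ∀ k, 0 < c k)
    (hx : ∀ j k, j ≠ k → 6 ≤ dist (x j) (x k)) {k : ℕ} {y : Space d} (h : dist y (x k) ≤ 2) :
    superpose c w x y = c k * w k (dilation (x k) 1 y) := by
  rw [superpose, tsum_eq_single k, ENNReal.toReal_ofReal]
  · exact mul_nonneg (hc k).le ((hw k).nonneg _)
  · intro j hj
    rw [(hw j).comp_dilation_eq_zero one_pos, mul_zero, ENNReal.ofReal_zero]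
    have h1 := hx j k hj
    have h2 := dist_triangle_left (x j) (x k) y
    linarith

theorem superpose_eq_zero (hw : ∀ k, IsProfile C (w k)) {y : Space d}
    (h : ∀ k, dist y (x k) ≤ 1 → w k (dilation (x k) 1 y) = 0) : superpose c w x y = 0 := by
  rw [superpose, ENNReal.tsum_eq_zero.2, ENNReal.toReal_zero]
  intro k
  have : w k (dilation (x k) 1 y) = 0 := by
    rcases le_or_gt (dist y (x k)) 1 with h1 | h1
    · exact h k h1
    · exact (hw k).comp_dilation_eq_zero one_pos h1
  rw [this, mul_zero, ENNReal.ofReal_zero]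

theorem exists_of_superpose_ne_zero (hw : ∀ k, IsProfile C (w k)) {y : Space d}
    (h : superpose c w x y ≠ 0) : ∃ k, dist y (x k) ≤ 1 ∧ w k (dilation (x k) 1 y) ≠ 0 := by
  by_contra! hcon
  exact h (superpose_eq_zero hw hcon)

theorem superpose_nonneg (y : Space d) : 0 ≤ superpose c w x y := ENNReal.toReal_nonneg

theorem measurable_superpose (hw : ∀ k, IsProfile C (w k)) : Measurable (superpose c w x) :=
  (Measurable.tsum fun j => (((hw j).measurable.comp
    (measurableEmbedding_dilation (x j) one_pos).measurable).const_mul (c j)).ennreal_ofReal).ennreal_toReal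

theorem ofReal_superpose_le (y : Space d) : ENNReal.ofReal (superpose c w x y) ≤
    ∑' j, ENNReal.ofReal (c j * w j (dilation (x j) 1 y)) := ENNReal.ofReal_toReal_le

theorem aeLocallyConst_superpose (hw : ∀ k, IsProfile C (w k)) (hc : ∀ k, 0 < c k)
    (hx : ∀ j k, j ≠ k → 6 ≤ dist (x j) (x k)) : AELocallyConst (superpose c w x) := by
  have h := ae_all_iff.2 fun k => ((hw k).aeLocallyConst.comp_dilation (x k) one_pos).const_mul (c k)
  filter_upwards [h] with y hy
  by_cases hnear : ∃ k, dist y (x k) ≤ 3 / 2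
  · obtain ⟨k, hk⟩ := hnear
    obtain ⟨e, he⟩ := hy k
    refine ⟨e, ?_⟩
    filter_upwards [he, Metric.ball_mem_nhds y (show (0 : ℝ) < 1 / 2 by norm_num)] with z hz hzy
    rw [superpose_eq hw hc hx (k := k), hz]
    have := dist_triangle z y (x k)
    rw [Metric.mem_ball] at hzy
    linarith
  · push Not at hnear
    refine ⟨0, ?_⟩
    filter_upwards [Metric.ball_mem_nhds y (show (0 : ℝ) < 1 / 2 by norm_num)] with z hzy
    refine superpose_eq_zero hw fun k hk => ?_
    have := dist_triangle_left y (x k) z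
    rw [Metric.mem_ball] at hzy
    linarith [hnear k]

theorem lintegral_translate (hw : ∀ k, IsProfile C (w k)) (hc : ∀ k, 0 < c k) (j : ℕ) :
    ∫⁻ y, ENNReal.ofReal (c j * w j (dilation (x j) 1 y)) = ENNReal.ofReal (c j) * unitVol d := by
  simp only [ENNReal.ofReal_mul (hc j).le]
  rw [lintegral_const_mul' _ _ ENNReal.ofReal_ne_top,
    lintegral_comp_dilation (x j) one_pos (fun y => ENNReal.ofReal (w j y)), (hw j).lintegral_eq]
  simp

theorem measurable_translate (hw : ∀ k, IsProfile C (w k)) (j : ℕ) :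
    Measurable fun y => ENNReal.ofReal (c j * w j (dilation (x j) 1 y)) :=
  (((hw j).measurable.comp
    (measurableEmbedding_dilation (x j) one_pos).measurable).const_mul (c j)).ennreal_ofReal

theorem integrable_superpose (hw : ∀ k, IsProfile C (w k)) (hc : ∀ k, 0 < c k)
    (hc2 : ∀ k, c k ≤ (1 / 2) ^ k) : Integrable (superpose c w x) := by
  refine ⟨(measurable_superpose hw).aestronglyMeasurable, ?_⟩
  rw [hasFiniteIntegral_iff_ofReal (Eventually.of_forall superpose_nonneg)]
  calc _ ≤ ∫⁻ y, ∑' j, ENNReal.ofReal (c j * w j (dilation (x j) 1 y)) :=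
        lintegral_mono fun y => ofReal_superpose_le y
    _ = ∑' j, ENNReal.ofReal (c j) * unitVol d := by
        rw [lintegral_tsum fun j => (measurable_translate hw j).aemeasurable]
        exact tsum_congr fun j => lintegral_translate hw hc j
    _ ≤ ∑' j, ENNReal.ofReal (1 * (1 / 2) ^ j) * unitVol d := by
        refine ENNReal.tsum_le_tsum fun j => ?_
        gcongr
        rw [one_mul]
        exact hc2 j
    _ < ∞ := by
        rw [ENNReal.tsum_mul_right, ENNReal.tsum_ofReal_half_pow 1 zero_le_one]
        exact ENNReal.mul_lt_top ENNReal.ofReal_lt_top unitVol_ne_top.lt_top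

/-- The part of the superposition away from `x k`. -/
noncomputable def superposeRest (c : ℕ → ℝ) (w : ℕ → Space d → ℝ) (x : ℕ → Space d) (k : ℕ)
    (y : Space d) : ℝ :=
  superpose c w x y - c k * w k (dilation (x k) 1 y)

theorem superposeRest_eq_zero (hw : ∀ k, IsProfile C (w k)) (hc : ∀ k, 0 < c k)
    (hx : ∀ j k, j ≠ k → 6 ≤ dist (x j) (x k)) {k : ℕ} {y : Space d} (h : dist y (x k) ≤ 2) :
    superposeRest c w x k y = 0 := by
  rw [superposeRest, superpose_eq hw hc hx h, sub_self]

theorem superposeRest_eq (hw : ∀ k, IsProfile C (w k)) {k : ℕ} {y : Space d}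
    (h : 1 < dist y (x k)) : superposeRest c w x k y = superpose c w x y := by
  rw [superposeRest, (hw k).comp_dilation_eq_zero one_pos h, mul_zero, sub_zero]

theorem superposeRest_nonneg (hw : ∀ k, IsProfile C (w k)) (hc : ∀ k, 0 < c k)
    (hx : ∀ j k, j ≠ k → 6 ≤ dist (x j) (x k)) (k : ℕ) (y : Space d) :
    0 ≤ superposeRest c w x k y := by
  rcases le_or_gt (dist y (x k)) 2 with h | h
  · rw [superposeRest_eq_zero hw hc hx h]
  · rw [superposeRest_eq hw (by linarith)]
    exact superpose_nonneg y

theorem ofReal_superposeRest_le (hw : ∀ k, IsProfile C (w k)) (hc : ∀ k, 0 < c k)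
    (hx : ∀ j k, j ≠ k → 6 ≤ dist (x j) (x k)) (k : ℕ) (y : Space d) :
    ENNReal.ofReal (superposeRest c w x k y) ≤
      ∑' j, if j = k then 0 else ENNReal.ofReal (c j * w j (dilation (x j) 1 y)) := by
  rcases le_or_gt (dist y (x k)) 2 with h | h
  · rw [superposeRest_eq_zero hw hc hx h, ENNReal.ofReal_zero]
    exact bot_le
  · rw [superposeRest_eq hw (by linarith)]
    refine (ofReal_superpose_le y).trans (ENNReal.tsum_le_tsum fun j => ?_)
    split_ifs with hj
    · rw [hj, (hw k).comp_dilation_eq_zero one_pos (by linarith), mul_zero, ENNReal.ofReal_zero]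
    · exact le_rfl

theorem measurable_superposeRest (hw : ∀ k, IsProfile C (w k)) (k : ℕ) :
    Measurable (superposeRest c w x k) :=
  (measurable_superpose hw).sub (((hw k).measurable.comp
    (measurableEmbedding_dilation (x k) one_pos).measurable).const_mul _)

/-- Another bump j meets the ball only if 2R ≥ D(m) with m = max(j, k). Then c_k R^d ≥ 2^(m+1), so
the mass of bump j, at most the unit volume, is at most 2^(-j-1) c_k R^d times it. Summation over j
gives exactly the factor 1. -/
theorem lintegral_superposeRest_le (hd : d ≠ 0) (hw : ∀ k, IsProfile C (w k)) (hc : ∀ k, 0 < c k)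
    (hc1 : ∀ k, c k ≤ 1) {D : ℕ → ℝ} (hD6 : ∀ m, 6 ≤ D m)
    (hD : ∀ j k, j ≠ k → D (max j k) ≤ dist (x j) (x k))
    (hDc : ∀ m i, i ≤ m → 2 ^ (m + 2) ≤ D m * c i) (k : ℕ) {z : Space d}
    (hz : z ∈ Metric.closedBall (x k) 1) {R : ℝ} (hR : 0 < R) :
    ∫⁻ y in Metric.closedBall z R, ENNReal.ofReal (superposeRest c w x k y) ≤
      ENNReal.ofReal (c k) * unitVol d * ENNReal.ofReal R ^ d := by
  have hx : ∀ j k, j ≠ k → 6 ≤ dist (x j) (x k) := fun j k h => (hD6 _).trans (hD j k h)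
  have hterm : ∀ j, (∫⁻ y in Metric.closedBall z R,
      if j = k then 0 else ENNReal.ofReal (c j * w j (dilation (x j) 1 y))) ≤
      ENNReal.ofReal (1 / 2 * (1 / 2) ^ j) *
        (ENNReal.ofReal (c k) * unitVol d * ENNReal.ofReal R ^ d) := by
    intro j
    by_cases hj : j = k
    · simp [hj]
    simp only [hj, if_false]
    rw [Metric.mem_closedBall] at hz
    rcases lt_or_ge (R + 1) (dist z (x j)) with hfar | hnear
    · refine (le_of_eq ?_ : _ ≤ (0 : ℝ≥0∞)).trans bot_le
      rw [setLIntegral_eq_zero_iff Metric.isClosed_closedBall.measurableSet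
        (measurable_translate hw j)]
      refine Eventually.of_forall fun y hy => ?_
      rw [(hw j).comp_dilation_eq_zero one_pos, mul_zero, ENNReal.ofReal_zero]
      rw [Metric.mem_closedBall] at hy
      have := dist_triangle_left z (x j) y
      linarith
    · set m := max j k with hm
      have h1 := hD j k hj
      have h2 := dist_triangle_left (x j) (x k) z
      have h3 := hD6 m
      have h4 := hDc m k (le_max_right _ _)
      have h5 : D m ≤ 2 * R := by linarith
      have hR1 : 1 ≤ R := by linarith
      have hck := hc k
      have h6 : (2 : ℝ) ^ (m + 2) ≤ 2 * (R ^ d * c k) := by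
        have : R ≤ R ^ d := le_self_pow₀ hR1 hd
        calc (2 : ℝ) ^ (m + 2) ≤ D m * c k := h4
          _ ≤ 2 * R ^ d * c k := by
              gcongr
              linarith
          _ = _ := by ring
      have h7 : (2 : ℝ) ^ j ≤ 2 ^ m := pow_le_pow_right₀ (by norm_num) (le_max_left _ _)
      have h8 : 1 ≤ 1 / 2 * (1 / 2) ^ j * (c k * R ^ d) := by
        rw [one_div, inv_pow, ← mul_inv, inv_mul_eq_div, le_div_iff₀ (by positivity)]
        rw [pow_add] at h6
        linarith
      calc _ ≤ ∫⁻ y, ENNReal.ofReal (c j * w j (dilation (x j) 1 y)) :=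
            lintegral_mono' Measure.restrict_le_self le_rfl
        _ = ENNReal.ofReal (c j) * unitVol d := lintegral_translate hw hc j
        _ ≤ 1 * unitVol d := by
            gcongr
            exact ENNReal.ofReal_le_one.2 (hc1 j)
        _ ≤ ENNReal.ofReal (1 / 2 * (1 / 2) ^ j * (c k * R ^ d)) * unitVol d := by
            gcongr
            exact ENNReal.one_le_ofReal.2 h8
        _ = _ := by
            rw [ENNReal.ofReal_mul (by positivity), ENNReal.ofReal_mul hck.le,
              ENNReal.ofReal_pow hR.le]
            ring
  calc _ ≤ ∫⁻ y in Metric.closedBall z R,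
        ∑' j, if j = k then 0 else ENNReal.ofReal (c j * w j (dilation (x j) 1 y)) :=
        lintegral_mono fun y => ofReal_superposeRest_le hw hc hx k y
    _ = ∑' j, ∫⁻ y in Metric.closedBall z R,
        if j = k then 0 else ENNReal.ofReal (c j * w j (dilation (x j) 1 y)) := by
        refine lintegral_tsum fun j => ?_
        split_ifs
        · exact aemeasurable_const
        · exact (measurable_translate hw j).aemeasurable
    _ ≤ _ := ENNReal.tsum_le_tsum hterm
    _ = _ := by
        rw [ENNReal.tsum_mul_right, ENNReal.tsum_ofReal_half_pow _ (by norm_num)]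
        norm_num

/-- The nearby bump contributes C, and all the others contribute the unit volume times c_k, which is
at most the weight at z because profiles are at least 1 on their support. -/
theorem localA1_superpose (hd : d ≠ 0) (hw : ∀ k, IsProfile C (w k)) (hc : ∀ k, 0 < c k)
    (hc1 : ∀ k, c k ≤ 1) {D : ℕ → ℝ} (hD6 : ∀ m, 6 ≤ D m)
    (hD : ∀ j k, j ≠ k → D (max j k) ≤ dist (x j) (x k))
    (hDc : ∀ m i, i ≤ m → 2 ^ (m + 2) ≤ D m * c i) :
    LocalA1 (C + unitVol d) fun y => ENNReal.ofReal (superpose c w x y) := by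
  have hx : ∀ j k, j ≠ k → 6 ≤ dist (x j) (x k) := fun j k h => (hD6 _).trans (hD j k h)
  intro z hz R hR
  obtain ⟨k, hzk, h0⟩ := exists_of_superpose_ne_zero hw
    (fun h => hz (by simp only [h, ENNReal.ofReal_zero]) : superpose c w x z ≠ 0)
  have hA := (hw k).localA1 (dilation (x k) 1 z)
    (by simpa using ((hw k).nonneg _).lt_of_ne' h0) R hR
  have hset : ∀ y, y ∈ Metric.closedBall z R ↔
      dilation (x k) 1 y ∈ Metric.closedBall (dilation (x k) 1 z) R := by
    intro y
    simp [dilation]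
  have h1 : ∫⁻ y in Metric.closedBall z R, ENNReal.ofReal (w k (dilation (x k) 1 y)) ≤
      C * ENNReal.ofReal (w k (dilation (x k) 1 z)) * ENNReal.ofReal R ^ d := by
    refine le_trans (le_of_eq ?_) hA
    rw [← lintegral_indicator Metric.isClosed_closedBall.measurableSet,
      ← lintegral_indicator Metric.isClosed_closedBall.measurableSet]
    have h2 := lintegral_comp_dilation (x k) one_pos
      ((Metric.closedBall (dilation (x k) 1 z) R).indicator fun y => ENNReal.ofReal (w k y))
    rw [ENNReal.ofReal_one, one_pow, one_mul] at h2
    rw [← h2]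
    refine lintegral_congr fun y => ?_
    by_cases hy : y ∈ Metric.closedBall z R
    · rw [Set.indicator_of_mem hy, Set.indicator_of_mem ((hset y).1 hy)]
    · rw [Set.indicator_of_notMem hy, Set.indicator_of_notMem (fun h => hy ((hset y).2 h))]
  have hwm : Measurable fun y => ENNReal.ofReal (c k) * ENNReal.ofReal (w k (dilation (x k) 1 y)) :=
    ((hw k).measurable.comp
      (measurableEmbedding_dilation (x k) one_pos).measurable).ennreal_ofReal.const_mul _
  have hone : 1 ≤ ENNReal.ofReal (w k (dilation (x k) 1 z)) := by
    simpa using (hw k).one_le _ h0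
  beta_reduce
  calc _ = ∫⁻ y in Metric.closedBall z R, (ENNReal.ofReal (c k) *
        ENNReal.ofReal (w k (dilation (x k) 1 y)) +
        ENNReal.ofReal (superposeRest c w x k y)) := by
        refine lintegral_congr fun y => ?_
        rw [← ENNReal.ofReal_mul (hc k).le, ← ENNReal.ofReal_add
          (mul_nonneg (hc k).le ((hw k).nonneg _)) (superposeRest_nonneg hw hc hx k y),
          superposeRest, add_sub_cancel]
    _ = ENNReal.ofReal (c k) *
        (∫⁻ y in Metric.closedBall z R, ENNReal.ofReal (w k (dilation (x k) 1 y))) +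
        ∫⁻ y in Metric.closedBall z R, ENNReal.ofReal (superposeRest c w x k y) := by
        rw [lintegral_add_left hwm, lintegral_const_mul' _ _ ENNReal.ofReal_ne_top]
    _ ≤ ENNReal.ofReal (c k) *
        (C * ENNReal.ofReal (w k (dilation (x k) 1 z)) * ENNReal.ofReal R ^ d) +
        ENNReal.ofReal (c k) * unitVol d * ENNReal.ofReal R ^ d := by
        gcongr
        exact lintegral_superposeRest_le hd hw hc hc1 hD6 hD hDc k hzk hR
    _ ≤ ENNReal.ofReal (c k) *
        (C * ENNReal.ofReal (w k (dilation (x k) 1 z)) * ENNReal.ofReal R ^ d) +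
        ENNReal.ofReal (c k) * unitVol d * ENNReal.ofReal R ^ d *
          ENNReal.ofReal (w k (dilation (x k) 1 z)) := by
        refine add_le_add_right ?_ _
        exact le_mul_of_one_le_right' hone
    _ = _ := by
        rw [superpose_eq hw hc hx (by linarith : dist z (x k) ≤ 2), ENNReal.ofReal_mul (hc k).le]
        ring

theorem czValue_superpose (hd : d ≠ 0) (hΩ : IsCZSymbol Ω) (hw : ∀ k, IsProfile C (w k))
    (hc : ∀ k, 0 < c k) (hc2 : ∀ k, c k ≤ (1 / 2) ^ k)
    (hx : ∀ j k, j ≠ k → 6 ≤ dist (x j) (x k)) {k : ℕ} {z : Space d} (hz : dist z (x k) ≤ 1)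
    (h : ∃ e, ∀ᶠ y in 𝓝 (dilation (x k) 1 z), w k y = e) :
    czValue Ω (superpose c w x) z = c k * czValue Ω (w k) (dilation (x k) 1 z) +
      ∫ y, czKernel Ω z y * superposeRest c w x k y := by
  have h1 := (hΩ.exists_hasCZValue hd (hw k).integrable h).comp_dilation hd hΩ (x k) one_pos
  rw [add_smul_dilation (x k) one_pos] at h1
  have hint : Integrable (superposeRest c w x k) := (integrable_superpose hw hc hc2).sub
    ((integrable_comp_dilation (x k) one_pos (hw k).integrable).const_mul _)
  have h2 := hΩ.hasCZValue_of_eq_zero hd hint (x := z) one_pos fun y hy =>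
    superposeRest_eq_zero hw hc hx (by
      have := dist_triangle_left y (x k) z
      rw [← dist_eq_norm] at hy
      linarith)
  have h3 := (h1.const_mul (c k)).add h2
  have h4 : (fun y => c k * w k (dilation (x k) 1 y) + superposeRest c w x k y) =
      superpose c w x := by
    funext y
    rw [superposeRest]
    ring
  rw [h4] at h3
  exact h3.czValue_eq

/-- The factor c_k on the right is essential: after division by the height of bump k the influence
of the other bumps has a universal Lipschitz constant. -/
theorem exists_lipschitz_superposeRest (hd : d ≠ 0) (hΩ : IsCZSymbol Ω) :
    ∃ L : ℝ, ∀ (C : ℝ≥0∞) (c : ℕ → ℝ) (w : ℕ → Space d → ℝ) (x : ℕ → Space d) (D : ℕ → ℝ),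
      (∀ k, IsProfile C (w k)) → (∀ k, 0 < c k) → (∀ k, c k ≤ (1 / 2) ^ k) → (∀ m, 6 ≤ D m) →
      (∀ j k, j ≠ k → D (max j k) ≤ dist (x j) (x k)) →
      (∀ m i, i ≤ m → 2 ^ (m + 2) ≤ D m * c i) →
      ∀ k, ∀ z ∈ Metric.closedBall (x k) 1, ∀ z' ∈ Metric.closedBall (x k) 1,
        |(∫ y, czKernel Ω z y * superposeRest c w x k y) -
          ∫ y, czKernel Ω z' y * superposeRest c w x k y| ≤ c k * (L * ‖z - z'‖) := by
  obtain ⟨K, hK0, hK⟩ := hΩ.exists_lipschitz_integral hd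
  refine ⟨K * ((unitVol d).toReal / 2), fun C c w x D hw hc hc2 hD6 hD hDc k z hz z' hz' => ?_⟩
  have hx : ∀ j k, j ≠ k → 6 ≤ dist (x j) (x k) := fun j k h => (hD6 _).trans (hD j k h)
  have hc1 : ∀ k, c k ≤ 1 := fun k =>
    (hc2 k).trans (pow_le_one₀ (by norm_num) (by norm_num))
  have hck := hc k
  have hint : Integrable (superposeRest c w x k) := (integrable_superpose hw hc hc2).sub
    ((integrable_comp_dilation (x k) one_pos (hw k).integrable).const_mul _)
  refine (hK (superposeRest c w x k) (x k) (c k * (unitVol d).toReal) 2 1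
    (measurable_superposeRest hw k) (superposeRest_nonneg hw hc hx k) hint (by positivity) one_pos
    (by norm_num) ?_ ?_ z hz z' hz').trans (le_of_eq (by ring))
  · intro y hy
    rw [← dist_eq_norm] at hy
    exact superposeRest_eq_zero hw hc hx hy.le
  · intro R hR
    refine (lintegral_superposeRest_le hd hw hc hc1 hD6 hD hDc k
      (Metric.mem_closedBall_self zero_le_one) (by linarith)).trans (le_of_eq ?_)
    rw [ENNReal.ofReal_mul (by positivity), ENNReal.ofReal_mul hck.le,
      ENNReal.ofReal_toReal unitVol_ne_top, ENNReal.ofReal_pow (by linarith)]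

end

section

/-! ### The counterexample -/

variable {d : ℕ} {Ω : Space d → ℝ} {C : ℝ≥0∞} {a b : ℕ → ℝ} {w : ℕ → Space d → ℝ}
  {x : ℕ → Space d} {p : ℝ}

/-- The centres lie on a line at the partial sums of D, so the gap before centre m is at least D(m).
The sum of reciprocals in D(m) handles all i ≤ m at once. -/
theorem exists_distant_centers {e : Space d} (he : ‖e‖ = 1) {s : ℕ → ℝ} (hs : ∀ k, 0 < s k) :
    ∃ (D : ℕ → ℝ) (x : ℕ → Space d), (∀ m, 6 ≤ D m) ∧
      (∀ j k, j ≠ k → D (max j k) ≤ dist (x j) (x k)) ∧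
      ∀ m i, i ≤ m → 2 ^ (m + 2) ≤ D m * s i := by
  set D : ℕ → ℝ := fun m => 6 + 2 ^ (m + 2) * ∑ i ∈ Finset.range (m + 1), (s i)⁻¹ with hDdef
  have hsum : ∀ m, 0 ≤ ∑ i ∈ Finset.range (m + 1), (s i)⁻¹ := fun m =>
    Finset.sum_nonneg fun i _ => (inv_pos.2 (hs i)).le
  have hD6 : ∀ m, 6 ≤ D m := fun m => by
    simp only [hDdef]
    have : 0 ≤ 2 ^ (m + 2) * ∑ i ∈ Finset.range (m + 1), (s i)⁻¹ :=
      mul_nonneg (by positivity) (hsum m)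
    linarith
  have hlt : ∀ j k, j < k → D k ≤ ∑ i ∈ Finset.range (k + 1), D i -
      ∑ i ∈ Finset.range (j + 1), D i := by
    intro j k hjk
    rw [Finset.sum_range_succ _ k]
    have : ∑ i ∈ Finset.range (j + 1), D i ≤ ∑ i ∈ Finset.range k, D i :=
      Finset.sum_le_sum_of_subset_of_nonneg (Finset.range_mono hjk) fun i _ _ => by
        linarith [hD6 i]
    linarith
  refine ⟨D, fun k => (∑ i ∈ Finset.range (k + 1), D i) • e, hD6, fun j k hjk => ?_,
    fun m i hi => ?_⟩
  · rw [dist_eq_norm, ← sub_smul, norm_smul, he, mul_one, Real.norm_eq_abs]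
    rcases lt_or_gt_of_ne hjk with h | h
    · rw [max_eq_right h.le, abs_sub_comm]
      exact (hlt j k h).trans (le_abs_self _)
    · rw [max_eq_left h.le]
      exact (hlt k j h).trans (le_abs_self _)
  · have h1 : (s i)⁻¹ ≤ ∑ i ∈ Finset.range (m + 1), (s i)⁻¹ :=
      Finset.single_le_sum (f := fun i => (s i)⁻¹) (fun i _ => (inv_pos.2 (hs i)).le)
        (Finset.mem_range.2 (Nat.lt_succ_of_le hi))
    have h2 : (2 : ℝ) ^ (m + 2) * (s i)⁻¹ ≤ D m := by
      simp only [hDdef]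
      have : (2 : ℝ) ^ (m + 2) * (s i)⁻¹ ≤ 2 ^ (m + 2) * ∑ i ∈ Finset.range (m + 1), (s i)⁻¹ := by
        gcongr
      linarith
    rwa [← div_eq_mul_inv, div_le_iff₀ (hs i)] at h2

/-! ### Norms of f and of Tf in the weighted space -/

theorem weightPow_weightPow {w : Space d → ℝ≥0∞} (hwT : ∀ x, w x ≠ ∞) {α β : ℝ} (h : α * β = 1) :
    weightPow (weightPow w α) β = w := by
  funext x
  by_cases h0 : w x = 0
  · simp [weightPow, h0]
  · have h1 : w x ^ α ≠ 0 := by simp [ENNReal.rpow_eq_zero_iff, h0, hwT x]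
    simp only [weightPow, h0, if_false, h1]
    rw [← ENNReal.rpow_mul, h, ENNReal.rpow_one]

theorem measurable_weightPow {w : Space d → ℝ≥0∞} (hw : Measurable w) (α : ℝ) :
    Measurable (weightPow w α) :=
  Measurable.ite (measurableSet_eq_fun hw measurable_const) measurable_const (hw.pow_const α)

theorem weightPow_superpose (hw : ∀ k, IsProfile C (w k)) (hb : ∀ k, 0 < b k)
    (hx : ∀ j k, j ≠ k → 6 ≤ dist (x j) (x k)) {k : ℕ} {y : Space d} (h : dist y (x k) ≤ 1)
    (α : ℝ) : weightPow (fun y => ENNReal.ofReal (superpose b w x y)) α y =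
      ENNReal.ofReal (b k) ^ α *
        weightPow (fun y => ENNReal.ofReal (w k y)) α (dilation (x k) 1 y) := by
  have hb0 : ENNReal.ofReal (b k) ≠ 0 := by simpa using hb k
  simp only [weightPow]
  rw [superpose_eq hw hb hx (by linarith), ENNReal.ofReal_mul (hb k).le]
  by_cases h0 : ENNReal.ofReal (w k (dilation (x k) 1 y)) = 0
  · simp [h0]
  · rw [if_neg (mul_ne_zero hb0 h0), if_neg h0,
      ENNReal.mul_rpow_of_ne_top ENNReal.ofReal_ne_top ENNReal.ofReal_ne_top]

theorem lintegral_lt_top_of_le_profiles (hw : ∀ k, IsProfile C (w k)) {F : Space d → ℝ≥0∞}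
    (h0 : ∀ y, superpose a w x y = 0 → F y = 0)
    (h : ∀ k y, dist y (x k) ≤ 1 → w k (dilation (x k) 1 y) ≠ 0 →
      F y ≤ ENNReal.ofReal ((1 / 2) ^ k * w k (dilation (x k) 1 y))) :
    ∫⁻ y, F y < ∞ := by
  have hpos : ∀ k : ℕ, (0 : ℝ) < (1 / 2) ^ k := fun k => by positivity
  calc ∫⁻ y, F y ≤ ∫⁻ y, ∑' k, ENNReal.ofReal ((1 / 2) ^ k * w k (dilation (x k) 1 y)) := by
        refine lintegral_mono fun y => ?_
        by_cases hy : superpose a w x y = 0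
        · rw [h0 y hy]
          exact bot_le
        · obtain ⟨k, hk, hk0⟩ := exists_of_superpose_ne_zero hw hy
          exact (h k y hk hk0).trans
            (ENNReal.le_tsum (f := fun k => ENNReal.ofReal ((1 / 2) ^ k * w k (dilation (x k) 1 y))) k)
    _ = ∑' k : ℕ, ENNReal.ofReal ((1 / 2) ^ k) * unitVol d := by
        rw [lintegral_tsum fun k => (measurable_translate hw k).aemeasurable]
        exact tsum_congr fun k => lintegral_translate hw hpos k
    _ = ENNReal.ofReal (2 * 1) * unitVol d := by
        rw [ENNReal.tsum_mul_right, ← ENNReal.tsum_ofReal_half_pow 1 zero_le_one]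
        simp
    _ < ∞ := by
        have := unitVol_ne_top (d := d)
        finiteness

/-- The computation of `Scheme.lintegral_child` without dilation, with different factors a_k for the
function and b_k for the weight. -/
theorem setLIntegral_czValue_superpose (hd : d ≠ 0) (hΩ : IsCZSymbol Ω)
    (hw : ∀ k, IsProfile C (w k)) (ha : ∀ k, 0 < a k) (ha2 : ∀ k, a k ≤ (1 / 2) ^ k)
    (hb : ∀ k, 0 < b k) (hx : ∀ j k, j ≠ k → 6 ≤ dist (x j) (x k)) (hp : 0 < p) (k : ℕ) :
    ∫⁻ z in Metric.closedBall (x k) 1, ‖czValue Ω (superpose a w x) z‖ₑ ^ p *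
        weightPow (fun y => ENNReal.ofReal (superpose b w x y)) (1 - p) z =
      ENNReal.ofReal (a k) ^ p * ENNReal.ofReal (b k) ^ (1 - p) *
        dualEnergy Ω p (w k) fun z =>
          (a k)⁻¹ * ∫ y, czKernel Ω (x k + z) y * superposeRest a w x k y := by
  set g : Space d → ℝ := fun z =>
    (a k)⁻¹ * ∫ y, czKernel Ω (x k + z) y * superposeRest a w x k y with hg
  set H : Space d → ℝ≥0∞ := fun z => ‖czValue Ω (w k) z + g z‖ₑ ^ p *
    weightPow (fun y => ENNReal.ofReal (w k y)) (1 - p) z with hH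
  have hak := ha k
  have hH0 : ∀ z, ¬ dist z (x k) ≤ 1 → H (dilation (x k) 1 z) = 0 := by
    intro z hz
    simp [hH, weightPow, (hw k).comp_dilation_eq_zero one_pos (not_le.1 hz)]
  have hmain : ∀ᵐ z, (Metric.closedBall (x k) 1).indicator (fun z =>
      ‖czValue Ω (superpose a w x) z‖ₑ ^ p *
        weightPow (fun y => ENNReal.ofReal (superpose b w x y)) (1 - p) z) z =
      ENNReal.ofReal (a k) ^ p * ENNReal.ofReal (b k) ^ (1 - p) * H (dilation (x k) 1 z) := by
    filter_upwards [ae_dilation (hw k).aeLocallyConst (x k) one_pos] with z hz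
    by_cases hzk : dist z (x k) ≤ 1
    · have e0 : x k + dilation (x k) 1 z = z := by
        simpa using add_smul_dilation (x k) one_pos z
      have e1 : a k * czValue Ω (w k) (dilation (x k) 1 z) +
          (∫ y, czKernel Ω z y * superposeRest a w x k y) =
          a k * (czValue Ω (w k) (dilation (x k) 1 z) + g (dilation (x k) 1 z)) := by
        simp only [hg, e0]
        field_simp
      rw [Set.indicator_of_mem (by exact hzk), czValue_superpose hd hΩ hw ha ha2 hx hzk hz, e1,
        enorm_mul, ENNReal.mul_rpow_of_nonneg _ _ hp.le, Real.enorm_of_nonneg hak.le,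
        weightPow_superpose hw hb hx hzk, mul_mul_mul_comm]
    · rw [Set.indicator_of_notMem (by exact hzk), hH0 z hzk, mul_zero]
  have hcT : ENNReal.ofReal (a k) ^ p * ENNReal.ofReal (b k) ^ (1 - p) ≠ ∞ :=
    ENNReal.mul_ne_top (ENNReal.rpow_ne_top_of_nonneg hp.le ENNReal.ofReal_ne_top) (by
      rw [ENNReal.ofReal_rpow_of_pos (hb k)]
      exact ENNReal.ofReal_ne_top)
  rw [← lintegral_indicator Metric.isClosed_closedBall.measurableSet, lintegral_congr_ae hmain,
    lintegral_const_mul' _ _ hcT, lintegral_comp_dilation (x k) one_pos H]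
  simp [dualEnergy, hH]

theorem lintegral_czValue_superpose_eq_top (hd : d ≠ 0) (hΩ : IsCZSymbol Ω)
    (hw : ∀ k, IsProfile C (w k)) (ha : ∀ k, 0 < a k) (ha2 : ∀ k, a k ≤ (1 / 2) ^ k)
    (hb : ∀ k, 0 < b k) (hx : ∀ j k, j ≠ k → 6 ≤ dist (x j) (x k)) (hp : 0 < p)
    (hE : ∀ k, 1 ≤ ENNReal.ofReal (a k) ^ p * ENNReal.ofReal (b k) ^ (1 - p) *
        dualEnergy Ω p (w k) fun z =>
          (a k)⁻¹ * ∫ y, czKernel Ω (x k + z) y * superposeRest a w x k y) :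
    ∫⁻ z, ‖czValue Ω (superpose a w x) z‖ₑ ^ p *
      weightPow (fun y => ENNReal.ofReal (superpose b w x y)) (1 - p) z = ∞ := by
  have hdisj : Pairwise (Function.onFun Disjoint fun k => Metric.closedBall (x k) 1) :=
    fun j k hjk => Metric.closedBall_disjoint_closedBall (by linarith [hx j k hjk])
  refine top_unique ?_
  calc ∞ = ∑' _ : ℕ, (1 : ℝ≥0∞) := (ENNReal.tsum_const_eq_top_of_ne_zero one_ne_zero).symm
    _ ≤ ∑' k, ∫⁻ z in Metric.closedBall (x k) 1, ‖czValue Ω (superpose a w x) z‖ₑ ^ p *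
        weightPow (fun y => ENNReal.ofReal (superpose b w x y)) (1 - p) z :=
        ENNReal.tsum_le_tsum fun k => (hE k).trans
          (setLIntegral_czValue_superpose hd hΩ hw ha ha2 hb hx hp k).ge
    _ = ∫⁻ z in ⋃ k, Metric.closedBall (x k) 1, ‖czValue Ω (superpose a w x) z‖ₑ ^ p *
        weightPow (fun y => ENNReal.ofReal (superpose b w x y)) (1 - p) z :=
        (lintegral_iUnion (fun k => Metric.isClosed_closedBall.measurableSet) hdisj _).symm
    _ ≤ _ := setLIntegral_le_lintegral _ _

/-- The height `a` of the function on a bump where the weight is given the factor `b`. -/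
noncomputable def bumpHeight (p : ℝ) (b : ℕ → ℝ) (k : ℕ) : ℝ :=
  b k ^ (1 - 1 / p) * (1 / 2) ^ k

theorem bumpHeight_pos (hb : ∀ k, 0 < b k) (k : ℕ) : 0 < bumpHeight p b k :=
  mul_pos (Real.rpow_pos_of_pos (hb k) _) (by positivity)

theorem bumpHeight_le (hp : 1 < p) (hb : ∀ k, 0 < b k) (hb1 : ∀ k, b k ≤ 1) (k : ℕ) :
    bumpHeight p b k ≤ (1 / 2) ^ k := by
  have h : 0 ≤ 1 - 1 / p := by
    rw [sub_nonneg, div_le_one (by linarith)]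
    exact hp.le
  exact mul_le_of_le_one_left (by positivity) (Real.rpow_le_one (hb k).le (hb1 k) h)

theorem bumpHeight_rpow (hp : 0 < p) (hb : ∀ k, 0 < b k) (k : ℕ) :
    bumpHeight p b k ^ p = b k ^ (p - 1) * ((1 / 2) ^ k) ^ p := by
  rw [bumpHeight, Real.mul_rpow (Real.rpow_nonneg (hb k).le _) (by positivity),
    ← Real.rpow_mul (hb k).le, sub_mul, one_div_mul_cancel hp.ne', one_mul]

theorem half_pow_rpow_le (hp : 1 < p) (k : ℕ) : (((1 : ℝ) / 2) ^ k) ^ p ≤ (1 / 2) ^ k := by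
  have := Real.rpow_le_rpow_of_exponent_ge (x := ((1 : ℝ) / 2) ^ k) (by positivity)
    (pow_le_one₀ (by norm_num) (by norm_num)) hp.le
  rwa [Real.rpow_one] at this

/-- The exponent 1 - 1/p in `bumpHeight` is chosen to make the powers of b_k cancel. -/
theorem bumpHeight_rpow_mul (hp : 0 < p) (hb : ∀ k, 0 < b k) (k : ℕ) :
    ENNReal.ofReal (bumpHeight p b k) ^ p * ENNReal.ofReal (b k) ^ (1 - p) =
      ENNReal.ofReal (((1 / 2) ^ k) ^ p) := by
  rw [ENNReal.ofReal_rpow_of_pos (bumpHeight_pos hb k), ENNReal.ofReal_rpow_of_pos (hb k),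
    ← ENNReal.ofReal_mul (Real.rpow_nonneg (bumpHeight_pos hb k).le _), bumpHeight_rpow hp hb,
    mul_right_comm, ← Real.rpow_add (hb k)]
  simp

theorem lintegral_superpose_weighted_lt_top (hp : 1 < p) (hw : ∀ k, IsProfile C (w k))
    (hb : ∀ k, 0 < b k) (hx : ∀ j k, j ≠ k → 6 ≤ dist (x j) (x k)) :
    ∫⁻ y, ‖superpose (bumpHeight p b) w x y‖ₑ ^ p *
      weightPow (fun y => ENNReal.ofReal (superpose b w x y)) (1 - p) y < ∞ := by
  have hp0 : 0 < p := by linarith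
  refine lintegral_lt_top_of_le_profiles (a := bumpHeight p b) (x := x) hw (fun y hy => ?_)
    fun k y hy h0 => ?_
  · simp [hy, hp0]
  have hwk : 0 < w k (dilation (x k) 1 y) := ((hw k).nonneg _).lt_of_ne' h0
  have hwk0 : ENNReal.ofReal (w k (dilation (x k) 1 y)) ≠ 0 := by simpa using hwk
  rw [weightPow_superpose hw hb hx hy, superpose_eq hw (bumpHeight_pos hb) hx (by linarith),
    enorm_mul, ENNReal.mul_rpow_of_nonneg _ _ hp0.le,
    Real.enorm_of_nonneg (bumpHeight_pos hb k).le, Real.enorm_of_nonneg hwk.le,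
    mul_mul_mul_comm, bumpHeight_rpow_mul hp0 hb, weightPow, if_neg hwk0,
    ← ENNReal.rpow_add _ _ hwk0 ENNReal.ofReal_ne_top, add_sub_cancel, ENNReal.rpow_one,
    ENNReal.ofReal_mul (by positivity)]
  gcongr
  exact half_pow_rpow_le hp k

/-- On bump k the p-th power of the function is (b_k w_k)^(p-1) 2^(-kp) w_k. Hence b_k w_k ≤ 1 makes
the unweighted norm finite although the profiles themselves are unbounded in k. -/
theorem memLp_superpose (hp : 1 < p) (hw : ∀ k, IsProfile C (w k)) (hb : ∀ k, 0 < b k)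
    (hbw : ∀ k y, b k * w k y ≤ 1) (hx : ∀ j k, j ≠ k → 6 ≤ dist (x j) (x k)) :
    MemLp (superpose (bumpHeight p b) w x) (ENNReal.ofReal p) volume := by
  have hp0 : 0 < p := by linarith
  refine ⟨(measurable_superpose hw).aestronglyMeasurable, ?_⟩
  rw [eLpNorm_lt_top_iff_lintegral_rpow_enorm_lt_top (by simpa using hp0) ENNReal.ofReal_ne_top,
    ENNReal.toReal_ofReal hp0.le]
  refine lintegral_lt_top_of_le_profiles (a := bumpHeight p b) (x := x) hw (fun y hy => ?_)
    fun k y hy h0 => ?_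
  · simp [hy, hp0]
  have hwk : 0 < w k (dilation (x k) 1 y) := ((hw k).nonneg _).lt_of_ne' h0
  have hpos := mul_pos (bumpHeight_pos (p := p) hb k) hwk
  rw [superpose_eq hw (bumpHeight_pos hb) hx (by linarith), Real.enorm_of_nonneg hpos.le,
    ENNReal.ofReal_rpow_of_pos hpos]
  refine ENNReal.ofReal_le_ofReal ?_
  set t := w k (dilation (x k) 1 y) with ht
  have e1 : t ^ p = t ^ (p - 1) * t := by
    rw [← Real.rpow_add_one hwk.ne', sub_add_cancel]
  have e2 : (b k * t) ^ (p - 1) ≤ 1 :=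
    Real.rpow_le_one (mul_pos (hb k) hwk).le (hbw k _) (by linarith)
  rw [Real.mul_rpow (bumpHeight_pos hb k).le hwk.le, bumpHeight_rpow hp0 hb, e1]
  calc b k ^ (p - 1) * ((1 / 2) ^ k) ^ p * (t ^ (p - 1) * t)
      = (b k * t) ^ (p - 1) * (((1 / 2) ^ k) ^ p * t) := by
        rw [Real.mul_rpow (hb k).le hwk.le]
        ring
    _ ≤ 1 * ((1 / 2) ^ k * t) := by
        gcongr
        exact half_pow_rpow_le hp k
    _ = _ := one_mul _

theorem superpose_eq_zero_of_superpose_eq_zero (hw : ∀ k, IsProfile C (w k)) (hb : ∀ k, 0 < b k)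
    (hx : ∀ j k, j ≠ k → 6 ≤ dist (x j) (x k)) {y : Space d} (h : superpose b w x y = 0) :
    superpose a w x y = 0 := by
  refine superpose_eq_zero hw fun k hk => ?_
  rw [superpose_eq hw hb hx (by linarith)] at h
  exact (mul_eq_zero.1 h).resolve_left (hb k).ne'

theorem memWeightedLp_superpose (hp : 1 < p) (hw : ∀ k, IsProfile C (w k))
    (hb : ∀ k, 0 < b k) (hx : ∀ j k, j ≠ k → 6 ≤ dist (x j) (x k)) :
    MemWeightedLp p (weightPow (fun y => ENNReal.ofReal (superpose b w x y)) (1 - p))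
      (superpose (bumpHeight p b) w x) := by
  refine ⟨(measurable_superpose hw).aemeasurable, Eventually.of_forall fun y hy => ?_, ?_⟩
  · refine superpose_eq_zero_of_superpose_eq_zero hw hb hx ?_
    by_contra h0
    have hpos : 0 < superpose b w x y := (superpose_nonneg y).lt_of_ne' h0
    rw [weightPow, if_neg (by simpa using hpos), ENNReal.ofReal_rpow_of_pos hpos,
      ENNReal.ofReal_eq_zero] at hy
    exact absurd hy (not_le.2 (Real.rpow_pos_of_pos hpos _))
  · exact ENNReal.rpow_lt_top_of_nonneg (by positivity)
      (lintegral_superpose_weighted_lt_top hp hw hb hx).ne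

end

end MuckenhouptWheeden

theorem theorem2 (d : ℕ) (hd : 1 ≤ d) (p p' : ℝ) (hp : 1 < p) (hpp' : 1 / p + 1 / p' = 1)
    (Ω : Space d → ℝ) (hΩ : IsCZSymbol Ω) :
    ∃ u v : Space d → ℝ≥0∞, Measurable u ∧ Measurable v ∧
      MaximalBounded p u v ∧
      MaximalBounded p' (weightPow v (1 - p')) (weightPow u (1 - p')) ∧
      MaximalBounded p' (weightPow u (1 - p')) (weightPow v (1 - p')) ∧
      ∃ f Tf : Space d → ℝ, MemWeightedLp p u f ∧ MemLp f (ENNReal.ofReal p) volume ∧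
        (∀ᵐ x ∂(volume : Measure (Space d)), HasCZValue Ω f x (Tf x)) ∧
        weightedNorm p v (fun x => ‖Tf x‖ₑ) = ∞ := by
  have hd0 : d ≠ 0 := by omega
  have hp0 : 0 < p := by linarith
  have hconj : p.HolderConjugate p' := (Real.holderConjugate_iff).2 ⟨hp, by simpa using hpp'⟩
  have hp' : 1 < p' := hconj.symm.lt
  have hmul : (1 - p) * (1 - p') = 1 := by linarith [hconj.mul_eq_add]
  obtain ⟨e, he, -⟩ := hΩ.exists_ne_zero
  obtain ⟨C, hCT, hprof⟩ := hΩ.exists_profiles hd0 hp0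
  obtain ⟨L, hL⟩ := exists_lipschitz_superposeRest hd0 hΩ
  -- L does not depend on the profiles, so they may be chosen now, with energy at least 2^(kp)
  -- against every perturbation of Lipschitz constant L.
  choose w hw hwE using fun k : ℕ =>
    hprof L (ENNReal.ofReal ((((1 : ℝ) / 2) ^ k) ^ p))⁻¹ (ENNReal.inv_ne_top.2 (by
      rw [Ne, ENNReal.ofReal_eq_zero, not_le]
      positivity))
  choose H hH using fun k => (hw k).bounded
  set b : ℕ → ℝ := fun k => (max 1 (H k))⁻¹ with hbdef
  have hmax : ∀ k, 1 ≤ max 1 (H k) := fun k => le_max_left _ _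
  have hb : ∀ k, 0 < b k := fun k => inv_pos.2 (by linarith [hmax k])
  have hb1 : ∀ k, b k ≤ 1 := fun k => inv_le_one_of_one_le₀ (hmax k)
  have hbw : ∀ k y, b k * w k y ≤ 1 := fun k y => by
    rw [hbdef, inv_mul_le_iff₀ (by linarith [hmax k]), mul_one]
    exact (hH k y).trans (le_max_right _ _)
  have ha := bumpHeight_pos (p := p) hb
  have ha2 := bumpHeight_le hp hb hb1
  -- One sequence of centres must serve both the heights, for the Lipschitz bound, and the factors
  -- b_k, for the A₁ condition; hence the minimum.
  obtain ⟨D, x, hD6, hD, hDs⟩ := exists_distant_centers (mem_sphere_zero_iff_norm.1 he)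
    (fun k => lt_min (ha k) (hb k))
  have hx : ∀ j k, j ≠ k → 6 ≤ dist (x j) (x k) := fun j k h => (hD6 _).trans (hD j k h)
  have hDa : ∀ m i, i ≤ m → 2 ^ (m + 2) ≤ D m * bumpHeight p b i := fun m i hi =>
    (hDs m i hi).trans (mul_le_mul_of_nonneg_left (min_le_left _ _) (by linarith [hD6 m]))
  have hDb : ∀ m i, i ≤ m → 2 ^ (m + 2) ≤ D m * b i := fun m i hi =>
    (hDs m i hi).trans (mul_le_mul_of_nonneg_left (min_le_right _ _) (by linarith [hD6 m]))
  set W : Space d → ℝ≥0∞ := fun y => ENNReal.ofReal (superpose b w x y) with hW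
  have hWm : Measurable W := (measurable_superpose hw).ennreal_ofReal
  have hWT : ∀ y, W y ≠ ∞ := fun y => ENNReal.ofReal_ne_top
  have hWA : LocalA1 (C + unitVol d) W := localA1_superpose hd0 hw hb hb1 hD6 hD hDb
  have hKT : C + unitVol d ≠ ∞ := ENNReal.add_ne_top.2 ⟨hCT, unitVol_ne_top⟩
  have hK0 : C + unitVol d ≠ 0 := fun h => unitVol_ne_zero (add_eq_zero.1 h).2
  have hWM := hWA.maximalBounded hp' hKT hWm
  -- As (1-p)(1-p') = 1, the dual weight is W itself, so the second and the third condition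
  -- coincide.
  refine ⟨weightPow W (1 - p), weightPow W (1 - p), measurable_weightPow hWm _,
    measurable_weightPow hWm _, hWA.maximalBounded_weightPow hp hK0 hKT hWm hWT, ?_, ?_,
    superpose (bumpHeight p b) w x, czValue Ω (superpose (bumpHeight p b) w x),
    memWeightedLp_superpose hp hw hb hx, memLp_superpose hp hw hb hbw hx, ?_, ?_⟩
  · rwa [weightPow_weightPow hWT hmul]
  · rwa [weightPow_weightPow hWT hmul]
  · filter_upwards [aeLocallyConst_superpose hw ha hx] with z hz
    exact hΩ.exists_hasCZValue hd0 (integrable_superpose hw ha ha2) hz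
  · rw [weightedNorm, lintegral_czValue_superpose_eq_top hd0 hΩ hw ha ha2 hb hx hp0 fun k => ?_,
      ENNReal.top_rpow_of_pos (by positivity)]
    have hak := ha k
    have hpos : ENNReal.ofReal ((((1 : ℝ) / 2) ^ k) ^ p) ≠ 0 := by
      rw [Ne, ENNReal.ofReal_eq_zero, not_le]
      positivity
    -- The factor 2^(-kp) of bump k is cancelled by its energy; the influence of the other bumps is
    -- an admissible perturbation.
    rw [bumpHeight_rpow_mul hp0 hb, ← ENNReal.mul_inv_cancel hpos ENNReal.ofReal_ne_top]
    refine mul_le_mul_right (hwE k _ fun z hz z' hz' => ?_) _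
    have hmem : ∀ z ∈ Metric.closedBall (0 : Space d) 1, x k + z ∈ Metric.closedBall (x k) 1 := by
      intro z hz
      simpa using hz
    have h1 := hL C _ w x D hw ha ha2 hD6 hD hDa k _ (hmem z hz) _ (hmem z' hz')
    rw [add_sub_add_left_eq_sub] at h1
    rw [← mul_sub, abs_mul, abs_of_pos (inv_pos.2 hak), inv_mul_le_iff₀ hak]
    exact h1
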